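/- Let $K$ be a field, let $a_1,\ldots,a_r$ be positive integers, and let $S=K[x_1,\ldots,x_r]$ be graded by $\deg x_i=a_i$. Let $M=\bigoplus_{n\ge 0}M_n$ be a finitely generated graded $S$-module, with Hilbert function $H(M,n)=\dim_K M_n$ and graded Betti numbers $\beta_{ij}(M)=\dim_K \mathrm{Tor}_i^S(M,K)_j$. Then $\beta_{ij}(M)$ is finite for all $i,j$, for each $i$ only finitely many $\beta_{ij}(M)$ are non-zero, and $M$ has finite projective dimension; denote it by $p$ (with $p=0$ if $M=0$). Let $w>0$ be a real number. The functions $$\zeta_M(z,w)=\sum_{n\ge 0}\frac{H(M,n)}{(n+w)^z},\qquad \zeta_M(z)=\sum_{n\ge 1}\frac{H(M,n)}{n^z},$$ defined by these series for $\mathrm{Re}\,z$ large, have meromorphic continuations to $z\in\mathbb C$. Let $R_M(w,\ell)$ and $R_M(\ell)$ be the residues at $z=\ell$ of these continuations. Define the Bernoulli–Barnes polynomials by $$\frac{z^r e^{xz}}{(e^{a_1z}-1)\cdots(e^{a_rz}-1)}=\sum_{k\ge 0}B_k(x;a_1,\ldots,a_r)\frac{z^k}{k!}.$$ Then for every integer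 $\ell$ with $1\le \ell\le r$: 1. $\displaystyle R_M(w,\ell)=\sum_{i=0}^{p}\sum_{j\ge 0}\beta_{ij}(M)\,\frac{(-1)^{i+r-\ell}}{(\ell-1)!\,(r-\ell)!}\,B_{r-\ell}(w+j;a_1,\ldots,a_r)$; 2. $\displaystyle R_M(\ell)=\sum_{i=0}^{p}\sum_{j\ge 0}\beta_{ij}(M)\,\frac{(-1)^{i+r-\ell}}{(\ell-1)!\,(r-\ell)!}\,B_{r-\ell}(j;a_1,\ldots,a_r)$. -/

import Mathlib

open Filter Topology
open scoped Nat

universe u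

noncomputable section

namespace ZetaBarnes

/-! ### Analytic side: meromorphic continuation, residues, Bernoulli-Barnes polynomials -/

/-- `Z` is a meromorphic function on `ℂ` whose values on some right half plane are the sums of the
(unconditionally convergent) series `∑ n, f n z`; i.e. `Z` is the meromorphic continuation
of the function `z ↦ ∑ n, f n z`. -/
def IsMeromorphicContinuation (f : ℕ → ℂ → ℂ) (Z : ℂ → ℂ) : Prop :=
  Meromorphic Z ∧ ∃ σ : ℝ, ∀ z : ℂ, σ < z.re → HasSum (fun n => f n z) (Z z)

/-- `f` has at `c` a Laurent expansion with finite principal part, in which the coefficient of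
`(z - c)⁻¹` is `R`: the residue of the meromorphic function `f` at `c` is `R`. -/
def HasResidueAt (f : ℂ → ℂ) (c R : ℂ) : Prop :=
  ∃ (N : ℕ) (b : ℕ → ℂ) (g : ℂ → ℂ), AnalyticAt ℂ g c ∧
    ∀ᶠ z in 𝓝[≠] c, f z = R / (z - c) + ∑ k ∈ Finset.range N, b k / (z - c) ^ (k + 2) + g z

/-- The formal power series `(e ^ (c X) - 1) / X`. -/
def expSubOneDivX (c : ℂ) : PowerSeries ℂ :=
  PowerSeries.mk fun n => c ^ (n + 1) / ((n + 1)! : ℂ)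

/-- The Bernoulli-Barnes generating series
`X ^ r * e ^ (x X) / ((e ^ (a₁ X) - 1) ⋯ (e ^ (a_r X) - 1))`. -/
def bernoulliBarnesSeries {r : ℕ} (a : Fin r → ℕ) (x : ℂ) : PowerSeries ℂ :=
  PowerSeries.rescale x (PowerSeries.exp ℂ) * ∏ i, (expSubOneDivX (a i))⁻¹

/-- The value `B_k(x; a₁, …, a_r)` at `x` of the `k`-th Bernoulli-Barnes polynomial. -/
def bernoulliBarnes {r : ℕ} (a : Fin r → ℕ) (k : ℕ) (x : ℂ) : ℂ :=
  (k ! : ℂ) * PowerSeries.coeff k (bernoulliBarnesSeries a x)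

theorem X_mul_expSubOneDivX (c : ℂ) :
    PowerSeries.X * expSubOneDivX c = PowerSeries.rescale c (PowerSeries.exp ℂ) - 1 := by
  ext n
  cases n with
  | zero =>
    rw [PowerSeries.coeff_zero_X_mul, map_sub, PowerSeries.coeff_rescale]
    simp [PowerSeries.coeff_exp]
  | succ n =>
    rw [PowerSeries.coeff_succ_X_mul]
    simp [expSubOneDivX, PowerSeries.coeff_rescale, PowerSeries.coeff_exp,
      PowerSeries.coeff_one, div_eq_mul_inv]

/-- The defining identity of the Bernoulli-Barnes polynomials:
`X ^ r * e ^ (x X) = (∑ k, B_k(x; a) X ^ k / k!) * ∏ i, (e ^ (a i X) - 1)`. -/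
theorem bernoulliBarnes_spec {r : ℕ} (a : Fin r → ℕ) (ha : ∀ i, 0 < a i) (x : ℂ) :
    PowerSeries.X ^ r * PowerSeries.rescale x (PowerSeries.exp ℂ) =
      (PowerSeries.mk fun k => bernoulliBarnes a k x / (k ! : ℂ)) *
        ∏ i, (PowerSeries.rescale (a i : ℂ) (PowerSeries.exp ℂ) - 1) := by
  have h1 : (PowerSeries.mk fun k => bernoulliBarnes a k x / (k ! : ℂ)) =
      bernoulliBarnesSeries a x := by
    ext k
    have hk : (k ! : ℂ) ≠ 0 := by exact_mod_cast Nat.factorial_ne_zero k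
    simp only [PowerSeries.coeff_mk, bernoulliBarnes]
    field_simp
  have h2 : (∏ i, (expSubOneDivX (a i))⁻¹) * ∏ i, expSubOneDivX (a i) = 1 := by
    rw [← Finset.prod_mul_distrib]
    refine Finset.prod_eq_one fun i _ => PowerSeries.inv_mul_cancel _ ?_
    have : (a i : ℂ) ≠ 0 := by exact_mod_cast (ha i).ne'
    simpa [expSubOneDivX, PowerSeries.constantCoeff_mk] using this
  simp_rw [h1, bernoulliBarnesSeries, ← X_mul_expSubOneDivX]
  rw [Finset.prod_mul_distrib, Finset.prod_const, Finset.card_univ, Fintype.card_fin]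
  calc _ = PowerSeries.X ^ r * PowerSeries.rescale x (PowerSeries.exp ℂ) *
        ((∏ i, (expSubOneDivX (a i))⁻¹) * ∏ i, expSubOneDivX (a i)) := by rw [h2, mul_one]
    _ = _ := by ring

/-! ### Algebraic side: graded free resolutions and graded Betti numbers

`S = K[x_1, …, x_r]` is `MvPolynomial (Fin r) K`, graded by `deg x_i = a i`; its degree `n` part is
`MvPolynomial.weightedHomogeneousSubmodule K a n`. -/

variable {K : Type u} [Field K] {r : ℕ}

/-- The degree `n` part of the graded free module `⨁ i, S(-deg i)`, whose basis element with index
`i` has degree `deg i`. -/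
def freePart (K : Type u) [Field K] {r : ℕ} (a : Fin r → ℕ) {ι : Type u} (deg : ι → ℕ) (n : ℕ) :
    Submodule K (ι →₀ MvPolynomial (Fin r) K) where
  carrier := {f | ∀ i m, MvPolynomial.coeff m (f i) ≠ 0 → Finsupp.weight a m + deg i = n}
  zero_mem' := fun i m h => by simp at h
  add_mem' := fun {f g} hf hg i m h => by
    by_cases h1 : MvPolynomial.coeff m (f i) = 0
    · exact hg i m fun h2 => h (by simp [h1, h2])
    · exact hf i m h1
  smul_mem' := fun c f hf i m h => hf i m fun h1 => h (by simp [h1])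

/-- A graded free resolution `⋯ → F₁ → F₀ → M → 0` of the graded `S`-module `M = ⨁ n, 𝓜 n`, where
`F_n = ⨁ i : ι n, S(-deg n i)`; all maps are homogeneous of degree `0`. -/
structure GradedFreeResolution (a : Fin r → ℕ) {M : Type u} [AddCommGroup M] [Module K M]
    [Module (MvPolynomial (Fin r) K) M] (𝓜 : ℕ → Submodule K M) where
  ι : ℕ → Type u
  deg : ∀ n, ι n → ℕ
  ε : (ι 0 →₀ MvPolynomial (Fin r) K) →ₗ[MvPolynomial (Fin r) K] M
  d : ∀ n, (ι (n + 1) →₀ MvPolynomial (Fin r) K) →ₗ[MvPolynomial (Fin r) K]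
    (ι n →₀ MvPolynomial (Fin r) K)
  ε_mem : ∀ i, ε (Finsupp.single i 1) ∈ 𝓜 (deg 0 i)
  d_mem : ∀ n i, d n (Finsupp.single i 1) ∈ freePart K a (deg n) (deg (n + 1) i)
  ε_surjective : Function.Surjective ε
  exact_zero : Function.Exact (d 0) ε
  exact_succ : ∀ n, Function.Exact (d (n + 1)) (d n)

/-- The quotient `Z / (B ∩ Z)`; it is `Z / B` when `B ≤ Z`. -/
abbrev Subquotient {V : Type u} [AddCommGroup V] [Module K V] (Z B : Submodule K V) : Type u :=
  Z ⧸ B.submoduleOf Z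

namespace GradedFreeResolution

variable {a : Fin r → ℕ} {M : Type u} [AddCommGroup M] [Module K M]
  [Module (MvPolynomial (Fin r) K) M] {𝓜 : ℕ → Submodule K M}

/-- The differential of the complex `F ⊗_S K`, where `K = S / (x_1, …, x_r)`. The module
`F_n ⊗_S K` is the `K`-vector space with basis `ι n`, and the matrix of the differential
consists of the constant coefficients of the entries of the matrix of `d n`. -/
def dK (F : GradedFreeResolution a 𝓜) (n : ℕ) : (F.ι (n + 1) →₀ K) →ₗ[K] (F.ι n →₀ K) :=
  Finsupp.linearCombination K fun i =>
    Finsupp.mapRange MvPolynomial.constantCoeff (map_zero _) (F.d n (Finsupp.single i 1))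

/-- The degree `j` part of `F_n ⊗_S K`. -/
def partK (F : GradedFreeResolution a 𝓜) (n j : ℕ) : Submodule K (F.ι n →₀ K) :=
  Finsupp.supported K K {i | F.deg n i = j}

/-- The cycles of homological degree `n` and internal degree `j` in `F ⊗_S K`. -/
def cycles (F : GradedFreeResolution a 𝓜) : ∀ n _j : ℕ, Submodule K (F.ι n →₀ K)
  | 0, j => F.partK 0 j
  | n + 1, j => F.partK (n + 1) j ⊓ LinearMap.ker (F.dK n)

/-- The boundaries of homological degree `n` and internal degree `j` in `F ⊗_S K`. -/
def boundaries (F : GradedFreeResolution a 𝓜) (n j : ℕ) : Submodule K (F.ι n →₀ K) :=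
  (F.partK (n + 1) j).map (F.dK n)

/-- The degree `j` part of `Tor_n(M, K) = H_n(F ⊗_S K)`. -/
abbrev Tor (F : GradedFreeResolution a 𝓜) (n j : ℕ) : Type u :=
  Subquotient (F.cycles n j) (F.boundaries n j)

end GradedFreeResolution

/-! #### The standard graded free resolution -/

section Standard

variable (a : Fin r → ℕ)

theorem mem_iSup_freePart {ι : Type u} (deg : ι → ℕ) (f : ι →₀ MvPolynomial (Fin r) K) :
    f ∈ ⨆ n, freePart K a deg n := by
  classical
  induction f using Finsupp.induction_linear with
  | zero => exact zero_mem _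
  | add f g hf hg => exact add_mem hf hg
  | single i p =>
    induction p using MvPolynomial.monomial_add_induction_on with
    | C c =>
      refine Submodule.mem_iSup_of_mem (deg i) fun k m h => ?_
      by_cases hk : i = k
      · subst hk
        by_cases hm : m = 0
        · simp [hm]
        · simp [MvPolynomial.coeff_C, Ne.symm hm] at h
      · simp [hk] at h
    | monomial_add s c p _ _ hp =>
      rw [Finsupp.single_add]
      refine add_mem ?_ hp
      refine Submodule.mem_iSup_of_mem (Finsupp.weight a s + deg i) fun k m h => ?_
      by_cases hk : i = k
      · subst hk
        by_cases hm : s = m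
        · simp [hm]
        · simp [MvPolynomial.coeff_monomial, hm] at h
      · simp [hk] at h

theorem freePart_indep {ι : Type u} (deg : ι → ℕ)
    (g : ℕ →₀ (ι →₀ MvPolynomial (Fin r) K)) (hg : ∀ n, g n ∈ freePart K a deg n)
    (h0 : (g.sum fun _ x => x) = 0) (n : ℕ) : g n = 0 := by
  classical
  ext i m
  by_contra hne
  have hn := hg n i m (by simpa using hne)
  have h1 : ∑ k ∈ g.support, MvPolynomial.coeff m (g k i) = 0 := by
    have := congrArg (fun f : ι →₀ MvPolynomial (Fin r) K => MvPolynomial.coeff m (f i)) h0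
    simpa [Finsupp.sum, Finsupp.finsetSum_apply, MvPolynomial.coeff_sum] using this
  rw [Finset.sum_eq_single n] at h1
  · exact hne (by simpa using h1)
  · intro k _ hk
    by_contra h2
    exact hk ((hg k i m h2).symm.trans hn)
  · intro hns
    simp [Finsupp.notMem_support_iff.mp hns]

theorem part_indep {M : Type u} [AddCommGroup M] [Module K M] (𝓜 : ℕ → Submodule K M)
    [DirectSum.Decomposition 𝓜] (g : ℕ →₀ M) (hg : ∀ n, g n ∈ 𝓜 n)
    (h0 : (g.sum fun _ x => x) = 0) (n : ℕ) : g n = 0 := by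
  classical
  have h1 : ∑ k ∈ g.support, (DirectSum.decompose 𝓜 (g k) n : M) = 0 := by
    have := congrArg (fun x : M => (DirectSum.decompose 𝓜 x n : M)) h0
    simpa [Finsupp.sum, DirectSum.decompose_sum, DFinsupp.finsetSum_apply] using this
  rw [Finset.sum_eq_single n] at h1
  · rwa [DirectSum.decompose_of_mem_same 𝓜 (hg n)] at h1
  · intro k _ hk
    exact DirectSum.decompose_of_mem_ne 𝓜 (hg k) hk
  · intro hns
    simp [Finsupp.notMem_support_iff.mp hns]

/-- An `S`-linear map which sends basis elements to homogeneous elements of the same degree is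
homogeneous of degree `0`. -/
theorem map_mem {ι N : Type u} [AddCommGroup N] [Module K N] [Module (MvPolynomial (Fin r) K) N]
    (Q : ℕ → Submodule K N)
    (hQ : ∀ p q (s : MvPolynomial (Fin r) K) x,
      s ∈ MvPolynomial.weightedHomogeneousSubmodule K a p → x ∈ Q q → s • x ∈ Q (p + q))
    (deg : ι → ℕ) (T : (ι →₀ MvPolynomial (Fin r) K) →ₗ[MvPolynomial (Fin r) K] N)
    (hT : ∀ i, T (Finsupp.single i 1) ∈ Q (deg i)) (n : ℕ) (f : ι →₀ MvPolynomial (Fin r) K)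
    (hf : f ∈ freePart K a deg n) : T f ∈ Q n := by
  rw [← Finsupp.sum_single f, Finsupp.sum, map_sum]
  refine sum_mem fun i _ => ?_
  have h1 : Finsupp.single i (f i) = f i • Finsupp.single i (1 : MvPolynomial (Fin r) K) := by
    simp
  rw [h1, map_smul]
  by_cases hz : f i = 0
  · simp [hz]
  · obtain ⟨m, hm⟩ := MvPolynomial.ne_zero_iff.mp hz
    have hn := hf i m hm
    have : n = (n - deg i) + deg i := by omega
    rw [this]
    refine hQ _ _ _ _ (fun m' hm' => ?_) (hT i)
    have := hf i m' hm'
    omega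

theorem smul_mem_freePart {ι : Type u} (deg : ι → ℕ) (p q : ℕ) (s : MvPolynomial (Fin r) K)
    (x : ι →₀ MvPolynomial (Fin r) K)
    (hs : s ∈ MvPolynomial.weightedHomogeneousSubmodule K a p) (hx : x ∈ freePart K a deg q) :
    s • x ∈ freePart K a deg (p + q) := by
  classical
  intro i m h
  rw [Finsupp.smul_apply, smul_eq_mul, MvPolynomial.coeff_mul] at h
  obtain ⟨⟨m1, m2⟩, hm, h2⟩ := Finset.exists_ne_zero_of_sum_ne_zero h
  have h3 := hs (left_ne_zero_of_mul h2)
  have h4 : Finsupp.weight a m2 + deg i = q := hx i m2 (right_ne_zero_of_mul h2)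
  change Finsupp.weight a m1 = p at h3
  replace hm := Finset.HasAntidiagonal.mem_antidiagonal.mp hm
  change m1 + m2 = m at hm
  have h5 : Finsupp.weight a m = Finsupp.weight a m1 + Finsupp.weight a m2 := by
    rw [← hm, map_add]
  omega

/-- The kernel of a homogeneous map is generated by homogeneous elements. -/
theorem ker_le {ι N : Type u} [AddCommGroup N] [Module K N] [Module (MvPolynomial (Fin r) K) N]
    (Q : ℕ → Submodule K N)
    (hind : ∀ g : ℕ →₀ N, (∀ n, g n ∈ Q n) → (g.sum fun _ x => x) = 0 → ∀ n, g n = 0)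
    (deg : ι → ℕ) (T : (ι →₀ MvPolynomial (Fin r) K) →ₗ[MvPolynomial (Fin r) K] N)
    (hT : ∀ n, ∀ f ∈ freePart K a deg n, T f ∈ Q n)
    (P : Submodule (MvPolynomial (Fin r) K) (ι →₀ MvPolynomial (Fin r) K))
    (hP : ∀ n, ∀ f ∈ freePart K a deg n, T f = 0 → f ∈ P)
    (f : ι →₀ MvPolynomial (Fin r) K) (hf : T f = 0) : f ∈ P := by
  classical
  obtain ⟨g, hg, rfl⟩ := (Submodule.mem_iSup_iff_exists_finsupp _ _).mp (mem_iSup_freePart a deg f)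
  have h0 : ((g.mapRange T (map_zero _)).sum fun _ x => x) = 0 := by
    rw [Finsupp.sum_mapRange_index (by simp)]
    simpa [Finsupp.sum] using hf
  have h1 := hind _ (fun n => by simpa using hT n _ (hg n)) h0
  exact sum_mem fun n _ => hP n _ (hg n) (by simpa using h1 n)

/-- A stage of the standard resolution: a graded free module together with a submodule. -/
structure Stage (K : Type u) [Field K] (r : ℕ) where
  ι : Type u
  deg : ι → ℕ
  Z : Submodule (MvPolynomial (Fin r) K) (ι →₀ MvPolynomial (Fin r) K)

/-- The index type of the next free module: the homogeneous elements of the given submodule. -/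
abbrev Stage.Index (s : Stage K r) : Type u :=
  {p : ℕ × (s.ι →₀ MvPolynomial (Fin r) K) // p.2 ∈ s.Z ∧ p.2 ∈ freePart K a s.deg p.1}

/-- The next differential, sending each basis element to the homogeneous element which
indexes it. -/
def Stage.map (s : Stage K r) : (s.Index a →₀ MvPolynomial (Fin r) K) →ₗ[MvPolynomial (Fin r) K]
    (s.ι →₀ MvPolynomial (Fin r) K) :=
  Finsupp.linearCombination _ fun p => p.1.2

/-- The next stage. -/
def Stage.next (s : Stage K r) : Stage K r where
  ι := s.Index a
  deg := fun p => p.1.1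
  Z := LinearMap.ker (s.map a)

theorem Stage.map_single (s : Stage K r) (p : s.Index a) :
    s.map a (Finsupp.single p 1) = p.1.2 := by
  rw [Stage.map, Finsupp.linearCombination_single, one_smul]

theorem Stage.map_single_mem (s : Stage K r) (p : s.Index a) :
    s.map a (Finsupp.single p 1) ∈ freePart K a s.deg p.1.1 := by
  rw [Stage.map_single]
  exact p.2.2

/-- The submodule of the stage is generated by its homogeneous elements. -/
def Stage.Homogeneous (s : Stage K r) : Prop :=
  ∀ P : Submodule (MvPolynomial (Fin r) K) (s.ι →₀ MvPolynomial (Fin r) K),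
    (∀ n, ∀ f ∈ freePart K a s.deg n, f ∈ s.Z → f ∈ P) → s.Z ≤ P

theorem Stage.range_map (s : Stage K r) (hs : s.Homogeneous a) :
    LinearMap.range (s.map a) = s.Z := by
  apply le_antisymm
  · rintro _ ⟨g, rfl⟩
    rw [Stage.map, Finsupp.linearCombination_apply]
    exact sum_mem fun i _ => Submodule.smul_mem _ _ i.2.1
  · exact hs _ fun n f hf hz => ⟨Finsupp.single ⟨(n, f), hz, hf⟩ 1, s.map_single a _⟩

theorem Stage.next_homogeneous (s : Stage K r) : (s.next a).Homogeneous a := by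
  intro P hP f hf
  refine ker_le a (freePart K a s.deg) (freePart_indep a _) (s.next a).deg (s.map a) ?_ P hP f hf
  intro k g hg
  refine map_mem a _ (smul_mem_freePart a _) _ _ (s.map_single_mem a) k g hg

theorem Stage.exact_map (s : Stage K r) :
    Function.Exact (((s.next a).map a)) (s.map a) :=
  LinearMap.exact_iff.mpr ((s.next a).range_map a (s.next_homogeneous a)).symm

variable {M : Type u} [AddCommGroup M] [Module K M] [Module (MvPolynomial (Fin r) K) M]
  (𝓜 : ℕ → Submodule K M)

/-- The augmentation of the standard resolution, defined on the free module on all homogeneous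
elements of `M`. -/
def augmentation :
    ((Σ n, 𝓜 n) →₀ MvPolynomial (Fin r) K) →ₗ[MvPolynomial (Fin r) K] M :=
  Finsupp.linearCombination _ fun p => (p.2 : M)

theorem augmentation_single (p : Σ n, 𝓜 n) :
    augmentation (r := r) 𝓜 (Finsupp.single p 1) = p.2 := by
  rw [augmentation, Finsupp.linearCombination_single, one_smul]

theorem augmentation_single_mem (p : Σ n, 𝓜 n) :
    augmentation (r := r) 𝓜 (Finsupp.single p 1) ∈ 𝓜 p.1 := by
  rw [augmentation_single]
  exact p.2.2

/-- The first stage of the standard resolution of `M`. -/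
def stageZero : Stage K r where
  ι := Σ n, 𝓜 n
  deg := fun p => p.1
  Z := LinearMap.ker (augmentation 𝓜)

theorem stageZero_homogeneous [DirectSum.Decomposition 𝓜]
    [SetLike.GradedSMul (MvPolynomial.weightedHomogeneousSubmodule K a) 𝓜] :
    (stageZero (r := r) 𝓜).Homogeneous a := by
  intro P hP f hf
  refine ker_le a 𝓜 (part_indep 𝓜) (stageZero (r := r) 𝓜).deg (augmentation 𝓜) ?_ P hP f hf
  intro n g hg
  refine map_mem a 𝓜 (fun p q s x hs hx => SetLike.GradedSMul.smul_mem hs hx) _ _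
    (augmentation_single_mem 𝓜) n g hg

theorem stageZero_exact [DirectSum.Decomposition 𝓜]
    [SetLike.GradedSMul (MvPolynomial.weightedHomogeneousSubmodule K a) 𝓜] :
    Function.Exact ((stageZero (r := r) 𝓜).map a) (augmentation (r := r) 𝓜) :=
  LinearMap.exact_iff.mpr
    ((stageZero (r := r) 𝓜).range_map a (stageZero_homogeneous a 𝓜)).symm

theorem augmentation_surjective [DirectSum.Decomposition 𝓜] :
    Function.Surjective (augmentation (r := r) 𝓜) := by
  classical
  intro x
  refine ⟨∑ n ∈ (DirectSum.decompose 𝓜 x).support,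
    Finsupp.single ⟨n, DirectSum.decompose 𝓜 x n⟩ 1, ?_⟩
  rw [map_sum]
  simp_rw [augmentation_single]
  exact DirectSum.sum_support_decompose 𝓜 x

/-- The free modules of the standard resolution, with the cycles in them. -/
def stage : ℕ → Stage K r
  | 0 => stageZero 𝓜
  | n + 1 => (stage n).next a

/-- The standard graded free resolution of `M`: `F₀` is free on the homogeneous elements of `M`,
and `F_(n+1)` is free on the homogeneous elements of the kernel of the preceding map. -/
def standardResolution [DirectSum.Decomposition 𝓜]
    [SetLike.GradedSMul (MvPolynomial.weightedHomogeneousSubmodule K a) 𝓜] :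
    GradedFreeResolution a 𝓜 where
  ι n := (stage a 𝓜 n).ι
  deg n := (stage a 𝓜 n).deg
  ε := augmentation 𝓜
  d n := (stage a 𝓜 n).map a
  ε_mem := augmentation_single_mem 𝓜
  d_mem n := (stage a 𝓜 n).map_single_mem a
  ε_surjective := augmentation_surjective 𝓜
  exact_zero := stageZero_exact a 𝓜
  exact_succ n := (stage a 𝓜 n).exact_map a

/-- The graded Betti number `β_ij(M) = dim_K Tor_i(M, K)_j`. -/
def gradedBetti [DirectSum.Decomposition 𝓜]
    [SetLike.GradedSMul (MvPolynomial.weightedHomogeneousSubmodule K a) 𝓜] (i j : ℕ) : ℕ :=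
  Module.finrank K ((standardResolution a 𝓜).Tor i j)

end Standard

/-- The Hilbert function `H(M, n) = dim_K M_n`. -/
def hilbertFunction {M : Type u} [AddCommGroup M] [Module K M] (𝓜 : ℕ → Submodule K M) (n : ℕ) :
    ℕ :=
  Module.finrank K (𝓜 n)

/-- `Z` is the function `ζ_M(·, w)`, the meromorphic continuation of
`∑_{n ≥ 0} H(M, n) / (n + w) ^ z`. -/
def IsZetaW {M : Type u} [AddCommGroup M] [Module K M] (𝓜 : ℕ → Submodule K M) (w : ℝ)
    (Z : ℂ → ℂ) : Prop :=
  IsMeromorphicContinuation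
    (fun n z => (hilbertFunction 𝓜 n : ℂ) / ((n : ℂ) + (w : ℂ)) ^ z) Z

/-- `Z` is the function `ζ_M`, the meromorphic continuation of `∑_{n ≥ 1} H(M, n) / n ^ z`. -/
def IsZeta {M : Type u} [AddCommGroup M] [Module K M] (𝓜 : ℕ → Submodule K M)
    (Z : ℂ → ℂ) : Prop :=
  IsMeromorphicContinuation
    (fun n z => (hilbertFunction 𝓜 (n + 1) : ℂ) / ((n : ℂ) + 1) ^ z) Z

/-- The projective dimension of a module as a natural number (`0` for the zero module, whose
projective dimension is `-∞` in Mathlib, and when the projective dimension is infinite). -/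
def projDim (R M : Type u) [CommRing R] [AddCommGroup M] [Module R M] : ℕ :=
  ((CategoryTheory.projectiveDimension (ModuleCat.of R M)).unbotD 0).toNat

end ZetaBarnes

end

/-! The algebra reduces everything to one identity of power series, `prod_mul_hilbertSeries`: the
Hilbert series times `∏ (1 - X ^ a i)` is `∑ e_j X ^ j`, where `e_j = ∑ (-1) ^ i β_ij`. The analysis
then reads the residues off this rational function.

The terms of `standardResolution` usually have infinite rank, so the identity cannot be had by
counting basis elements. Instead the variables are killed one at a time. With the variables numbered
from `0`, let `H_n(k)` be the homology of the resolution `F` modulo `x_0, …, x_(k-1)`, represented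
by lifts in `F` itself. Since `x_k` is regular on `F / (x_0, …, x_(k-1)) F`, there is a long exact
sequence `H_n(k)(-a_k) → H_n(k) → H_n(k+1) → H_(n-1)(k)(-a_k) → H_(n-1)(k)`. It keeps graded pieces
finite-dimensional, shows that `H_n(k) = 0` for `n > k`, and multiplies the Euler series by `1 - X ^
a_k` (`eulerSeries_succ`). For `k = 0` the homology is `M` in degree `0`; for `k = r` it is `Tor(M,
K)`. The same sequence carries finite generation from `M` to `Tor`, on which the variables act by
zero, so only finitely many `j` occur.

Finite projective dimension is Hilbert's syzygy theorem, proved from the sequence `0 → R[X] ⊗ M →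
R[X] ⊗ M → M → 0`. Betti numbers vanish beyond the projective dimension because there the syzygies
are projective and split off.

On the analytic side, `F(t) = ∑ H(M, n) e ^ (-(n + w) t)` equals `∑ e_j e ^ (-(w + j) t) / ∏ (1 - e
^ (-a_i t))`, so `t ^ r F(t)` has at `0+` an asymptotic expansion with coefficients `∑ e_j (-1) ^ k
B_k(w + j) / k!`. The Mellin transform of `F` is `Γ(z) ζ_M(z, w)`. Removing leading terms `c_k t ^
(k - r)` on `(0, 1]` continues it with the explicit poles `c_k / (z + k - r)`, and division by `Γ`
gives residue `c_(r-ℓ) / (ℓ - 1)!` at `ℓ` (`hasResidueAt_dirichletCont`). For `ζ_M(z)` take `w = 0`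
and drop the constant `H(M, 0)`, which alters only `c_r`. Any two meromorphic continuations agree
near every point, so the residues belong to every continuation. -/

noncomputable section

namespace ZetaBarnes

/-! ### Maps between subquotients -/

section Subquotients

variable {K : Type u} [Field K] {V V₁ V₂ V₃ V₄ V₅ : Type u}
  [AddCommGroup V] [Module K V] [AddCommGroup V₁] [Module K V₁] [AddCommGroup V₂] [Module K V₂]
  [AddCommGroup V₃] [Module K V₃] [AddCommGroup V₄] [Module K V₄] [AddCommGroup V₅] [Module K V₅]

/-- The map between subquotients induced by a linear map. -/
def Subquotient.map (u : V₁ →ₗ[K] V₂) {Z₁ B₁ : Submodule K V₁} {Z₂ B₂ : Submodule K V₂}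
    (hZ : ∀ z ∈ Z₁, u z ∈ Z₂) (hB : ∀ z ∈ Z₁, z ∈ B₁ → u z ∈ B₂) :
    Subquotient Z₁ B₁ →ₗ[K] Subquotient Z₂ B₂ :=
  Submodule.mapQ _ _ (u.restrict hZ) fun z hz => hB z.1 z.2 hz

theorem Subquotient.map_mk (u : V₁ →ₗ[K] V₂) {Z₁ B₁ : Submodule K V₁} {Z₂ B₂ : Submodule K V₂}
    (hZ : ∀ z ∈ Z₁, u z ∈ Z₂) (hB : ∀ z ∈ Z₁, z ∈ B₁ → u z ∈ B₂) (z : Z₁) :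
    Subquotient.map u hZ hB (Submodule.Quotient.mk z) =
      Submodule.Quotient.mk (⟨u z, hZ z z.2⟩ : Z₂) :=
  rfl

theorem Subquotient.mk_eq_zero {Z B : Submodule K V} (z : Z) :
    (Submodule.Quotient.mk z : Subquotient Z B) = 0 ↔ (z : V) ∈ B := by
  rw [Submodule.Quotient.mk_eq_zero]
  rfl

/-- The hypotheses are on representatives, so each exactness claim below becomes a diagram chase
with elements of free modules. -/
theorem Subquotient.map_exact {u : V₁ →ₗ[K] V₂} {v : V₂ →ₗ[K] V₃} {Z₁ B₁ : Submodule K V₁}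
    {Z₂ B₂ : Submodule K V₂} {Z₃ B₃ : Submodule K V₃}
    (hZ : ∀ z ∈ Z₁, u z ∈ Z₂) (hB : ∀ z ∈ Z₁, z ∈ B₁ → u z ∈ B₂)
    (hZ' : ∀ z ∈ Z₂, v z ∈ Z₃) (hB' : ∀ z ∈ Z₂, z ∈ B₂ → v z ∈ B₃)
    (h0 : ∀ z ∈ Z₁, v (u z) ∈ B₃)
    (h1 : ∀ z ∈ Z₂, v z ∈ B₃ → ∃ y ∈ Z₁, z - u y ∈ B₂) :
    Function.Exact (Subquotient.map u hZ hB) (Subquotient.map v hZ' hB') := by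
  intro y
  obtain ⟨y, rfl⟩ := Submodule.Quotient.mk_surjective _ y
  rw [Subquotient.map_mk, Subquotient.mk_eq_zero]
  constructor
  · intro h
    obtain ⟨x, hx, hyx⟩ := h1 y.1 y.2 h
    refine ⟨Submodule.Quotient.mk ⟨x, hx⟩, ?_⟩
    rw [Subquotient.map_mk, eq_comm, ← sub_eq_zero, ← Submodule.Quotient.mk_sub,
      Subquotient.mk_eq_zero]
    exact hyx
  · rintro ⟨x, hx⟩
    obtain ⟨x, rfl⟩ := Submodule.Quotient.mk_surjective _ x
    rw [Subquotient.map_mk, eq_comm, ← sub_eq_zero, ← Submodule.Quotient.mk_sub,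
      Subquotient.mk_eq_zero] at hx
    have h2 := hB' _ (sub_mem y.2 (hZ x x.2)) hx
    rw [map_sub] at h2
    simpa using add_mem h2 (h0 x x.2)

theorem Subquotient.map_bijective {u : V₁ →ₗ[K] V₂} {Z₁ B₁ : Submodule K V₁}
    {Z₂ B₂ : Submodule K V₂}
    (hZ : ∀ z ∈ Z₁, u z ∈ Z₂) (hB : ∀ z ∈ Z₁, z ∈ B₁ → u z ∈ B₂)
    (hinj : ∀ z ∈ Z₁, u z ∈ B₂ → z ∈ B₁) (hsurj : ∀ z ∈ Z₂, ∃ y ∈ Z₁, u y = z) :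
    Function.Bijective (Subquotient.map u hZ hB) := by
  constructor
  · rw [← LinearMap.ker_eq_bot, Submodule.eq_bot_iff]
    intro y hy
    obtain ⟨y, rfl⟩ := Submodule.Quotient.mk_surjective _ y
    rw [LinearMap.mem_ker, Subquotient.map_mk, Subquotient.mk_eq_zero] at hy
    exact (Subquotient.mk_eq_zero _).mpr (hinj y.1 y.2 hy)
  · intro y
    obtain ⟨y, rfl⟩ := Submodule.Quotient.mk_surjective _ y
    obtain ⟨x, hx, hxy⟩ := hsurj y.1 y.2
    refine ⟨Submodule.Quotient.mk ⟨x, hx⟩, ?_⟩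
    rw [Subquotient.map_mk]
    congr 1
    exact Subtype.ext hxy

theorem Subquotient.subsingleton {Z B : Submodule K V} (h : Z ≤ B) :
    Subsingleton (Subquotient Z B) := by
  refine ⟨fun x y => ?_⟩
  obtain ⟨x, rfl⟩ := Submodule.Quotient.mk_surjective _ x
  obtain ⟨y, rfl⟩ := Submodule.Quotient.mk_surjective _ y
  rw [(Subquotient.mk_eq_zero x).mpr (h x.2), (Subquotient.mk_eq_zero y).mpr (h y.2)]

/-- The dimension of the middle term of an exact sequence with five terms. -/
theorem finrank_of_exact {f₁ : V₁ →ₗ[K] V₂} {f₂ : V₂ →ₗ[K] V₃} {f₃ : V₃ →ₗ[K] V₄}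
    {f₄ : V₄ →ₗ[K] V₅} (h₂ : Function.Exact f₁ f₂) (h₃ : Function.Exact f₂ f₃)
    (h₄ : Function.Exact f₃ f₄) [Module.Finite K V₂] [Module.Finite K V₄] :
    Module.Finite K V₃ ∧
      Module.finrank K V₃ + Module.finrank K (LinearMap.range f₁) +
        Module.finrank K (LinearMap.range f₄) = Module.finrank K V₂ + Module.finrank K V₄ := by
  have e2 := LinearMap.exact_iff.mp h₂
  have e3 := LinearMap.exact_iff.mp h₃
  have e4 := LinearMap.exact_iff.mp h₄
  have : Module.Finite K V₃ := by
    have h5 : Module.Finite K (LinearMap.ker f₃) := by rw [e3]; infer_instance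
    have h6 : Module.Finite K (V₃ ⧸ LinearMap.ker f₃) :=
      Module.Finite.equiv f₃.quotKerEquivRange.symm
    exact Module.Finite.of_submodule_quotient (LinearMap.ker f₃)
  have r2 := LinearMap.finrank_range_add_finrank_ker f₂
  have r3 := LinearMap.finrank_range_add_finrank_ker f₃
  have r4 := LinearMap.finrank_range_add_finrank_ker f₄
  rw [e2] at r2
  rw [e3] at r3
  rw [e4] at r4
  exact ⟨this, by omega⟩

end Subquotients

/-! ### Graded free modules -/

section Graded

variable {K : Type u} [Field K] {r : ℕ} {ι κ : Type u}

variable (K r) in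
/-- The ideal generated by the first `k` variables. -/
def varIdeal (k : ℕ) : Ideal (MvPolynomial (Fin r) K) :=
  Ideal.span (MvPolynomial.X '' {i : Fin r | i.val < k})

theorem mem_varIdeal {k : ℕ} {p : MvPolynomial (Fin r) K} :
    p ∈ varIdeal K r k ↔
      ∀ m, MvPolynomial.coeff m p ≠ 0 → ∃ i : Fin r, i.val < k ∧ m i ≠ 0 := by
  simp [varIdeal, MvPolynomial.mem_ideal_span_X_image]

variable (K r ι) in
/-- The submodule of the free module on `ι` generated by the multiples of the first `k`
variables. -/
def varSub (k : ℕ) : Submodule (MvPolynomial (Fin r) K) (ι →₀ MvPolynomial (Fin r) K) :=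
  varIdeal K r k • ⊤

theorem mem_varSub_iff {k : ℕ} {f : ι →₀ MvPolynomial (Fin r) K} :
    f ∈ varSub K r ι k ↔ ∀ i, f i ∈ varIdeal K r k := by
  constructor
  · intro h i
    refine Submodule.smul_induction_on h (fun p hp g _ => ?_) (fun f g hf hg => ?_)
    · exact Ideal.mul_mem_right _ _ hp
    · exact add_mem hf hg
  · intro h
    rw [← Finsupp.sum_single f]
    refine sum_mem fun i _ => ?_
    have : Finsupp.single i (f i) = f i • Finsupp.single i (1 : MvPolynomial (Fin r) K) := by simp
    rw [this]
    exact Submodule.smul_mem_smul (h i) trivial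

theorem mem_varSub {k : ℕ} {f : ι →₀ MvPolynomial (Fin r) K} :
    f ∈ varSub K r ι k ↔
      ∀ i m, MvPolynomial.coeff m (f i) ≠ 0 → ∃ l : Fin r, l.val < k ∧ m l ≠ 0 := by
  simp_rw [mem_varSub_iff, mem_varIdeal]

theorem varSub_zero : varSub K r ι 0 = ⊥ := by
  simp [varSub, varIdeal]

theorem varSub_mono {k l : ℕ} (h : k ≤ l) : varSub K r ι k ≤ varSub K r ι l :=
  Submodule.smul_mono_left (Ideal.span_mono (Set.image_mono fun _ hi => lt_of_lt_of_le hi h))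

theorem map_varSub_mem (T : (ι →₀ MvPolynomial (Fin r) K) →ₗ[MvPolynomial (Fin r) K]
    (κ →₀ MvPolynomial (Fin r) K)) {k : ℕ} {f : ι →₀ MvPolynomial (Fin r) K}
    (hf : f ∈ varSub K r ι k) : T f ∈ varSub K r κ k := by
  have h : T f ∈ (varSub K r ι k).map T := ⟨f, hf, rfl⟩
  rw [varSub, Submodule.map_smul''] at h
  exact Submodule.smul_mono le_rfl le_top h

theorem X_smul_mem_varSub {k : ℕ} (hk : k < r) (f : ι →₀ MvPolynomial (Fin r) K) :
    (MvPolynomial.X ⟨k, hk⟩ : MvPolynomial (Fin r) K) • f ∈ varSub K r ι (k + 1) :=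
  Submodule.smul_mem_smul (Ideal.subset_span ⟨⟨k, hk⟩, by simp, rfl⟩) trivial

theorem coeff_X_smul (i : Fin r) (f : ι →₀ MvPolynomial (Fin r) K) (j : ι) (m : Fin r →₀ ℕ) :
    MvPolynomial.coeff (m + Finsupp.single i 1)
      (((MvPolynomial.X i : MvPolynomial (Fin r) K) • f) j) = MvPolynomial.coeff m (f j) := by
  rw [Finsupp.smul_apply, smul_eq_mul, mul_comm, MvPolynomial.coeff_mul_X]

/-- Regularity of `x_k` modulo the earlier variables: multiplying by it leaves the exponents of
those variables unchanged. -/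
theorem mem_varSub_of_X_smul_mem {k : ℕ} (hk : k < r) {f : ι →₀ MvPolynomial (Fin r) K}
    (h : (MvPolynomial.X ⟨k, hk⟩ : MvPolynomial (Fin r) K) • f ∈ varSub K r ι k) :
    f ∈ varSub K r ι k := by
  rw [mem_varSub] at h ⊢
  intro i m hm
  obtain ⟨l, hl, hl'⟩ := h i (m + Finsupp.single ⟨k, hk⟩ 1) (by rwa [coeff_X_smul])
  refine ⟨l, hl, ?_⟩
  have : (⟨k, hk⟩ : Fin r) ≠ l := by rintro rfl; simp at hl
  simpa [Finsupp.single_apply, this] using hl'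

/-- Coefficientwise division by a variable. -/
def divVar (i : Fin r) :
    (ι →₀ MvPolynomial (Fin r) K) →ₗ[K] (ι →₀ MvPolynomial (Fin r) K) :=
  Finsupp.mapRange.linearMap
    { toFun := fun p => p.divMonomial (Finsupp.single i 1)
      map_add' := fun p q => MvPolynomial.add_divMonomial p q _
      map_smul' := fun c p => by
        ext m
        simp [MvPolynomial.coeff_divMonomial] }

theorem coeff_divVar (i : Fin r) (f : ι →₀ MvPolynomial (Fin r) K) (j : ι) (m : Fin r →₀ ℕ) :
    MvPolynomial.coeff m (divVar i f j) = MvPolynomial.coeff (m + Finsupp.single i 1) (f j) := by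
  simp [divVar, MvPolynomial.coeff_divMonomial, add_comm]

theorem divVar_X_smul (i : Fin r) (f : ι →₀ MvPolynomial (Fin r) K) :
    divVar i ((MvPolynomial.X i : MvPolynomial (Fin r) K) • f) = f := by
  ext j m
  rw [coeff_divVar, coeff_X_smul]

theorem divVar_mem_varSub {k : ℕ} (hk : k < r) {f : ι →₀ MvPolynomial (Fin r) K}
    (h : f ∈ varSub K r ι k) : divVar ⟨k, hk⟩ f ∈ varSub K r ι k := by
  rw [mem_varSub] at h ⊢
  intro i m hm
  rw [coeff_divVar] at hm
  obtain ⟨l, hl, hl'⟩ := h i _ hm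
  refine ⟨l, hl, ?_⟩
  have : (⟨k, hk⟩ : Fin r) ≠ l := by rintro rfl; simp at hl
  simpa [Finsupp.single_apply, this] using hl'

/-- What remains are the monomials not divisible by `x_k`; in an element of `varSub K r ι (k + 1)`
these must involve an earlier variable. -/
theorem sub_X_smul_divVar_mem {k : ℕ} (hk : k < r) {f : ι →₀ MvPolynomial (Fin r) K}
    (h : f ∈ varSub K r ι (k + 1)) :
    f - (MvPolynomial.X ⟨k, hk⟩ : MvPolynomial (Fin r) K) • divVar ⟨k, hk⟩ f ∈ varSub K r ι k := by
  classical
  rw [mem_varSub] at h ⊢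
  intro i m hm
  by_cases hmk : m ⟨k, hk⟩ = 0
  · have h0 : MvPolynomial.coeff m
        (((MvPolynomial.X ⟨k, hk⟩ : MvPolynomial (Fin r) K) • divVar ⟨k, hk⟩ f) i) = 0 := by
      rw [Finsupp.smul_apply, smul_eq_mul, mul_comm, MvPolynomial.coeff_mul_X', if_neg]
      simpa using hmk
    rw [Finsupp.sub_apply, MvPolynomial.coeff_sub, h0, sub_zero] at hm
    obtain ⟨l, hl, hl'⟩ := h i m hm
    refine ⟨l, ?_, hl'⟩
    have : l.val ≠ k := by
      intro hlk
      apply hl'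
      rw [← hmk]
      congr 1
      exact Fin.ext hlk
    omega
  · exfalso
    apply hm
    obtain ⟨m', rfl⟩ : ∃ m', m = m' + Finsupp.single ⟨k, hk⟩ 1 := by
      refine ⟨m - Finsupp.single ⟨k, hk⟩ 1, ?_⟩
      ext l
      by_cases hl : (⟨k, hk⟩ : Fin r) = l
      · subst hl
        simp; omega
      · simp [hl]
    rw [Finsupp.sub_apply, MvPolynomial.coeff_sub, coeff_X_smul, coeff_divVar, sub_self]

variable (a : Fin r → ℕ)

/-- The component of degree `j` of an element of a graded free module. -/
def degComp (deg : ι → ℕ) (j : ℕ) :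
    (ι →₀ MvPolynomial (Fin r) K) →ₗ[K] (ι →₀ MvPolynomial (Fin r) K) :=
  Finsupp.lsum K fun i => Finsupp.lsingle i ∘ₗ
    -- Without the guard, truncated subtraction would keep constant terms sitting in degrees `deg i
    -- > j`.
    (if deg i ≤ j then MvPolynomial.weightedHomogeneousComponent a (j - deg i) else 0)

theorem coeff_degComp (deg : ι → ℕ) (j : ℕ) (f : ι →₀ MvPolynomial (Fin r) K) (i : ι)
    (m : Fin r →₀ ℕ) :
    MvPolynomial.coeff m (degComp a deg j f i) =
      if Finsupp.weight a m + deg i = j then MvPolynomial.coeff m (f i) else 0 := by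
  classical
  induction f using Finsupp.induction_linear with
  | zero => simp
  | add f g hf hg =>
    rw [map_add, Finsupp.add_apply, MvPolynomial.coeff_add, hf, hg]
    split_ifs <;> simp
  | single l p =>
    simp only [degComp, Finsupp.lsum_single, LinearMap.comp_apply, Finsupp.lsingle_apply]
    by_cases hl : l = i
    · subst hl
      simp only [Finsupp.single_eq_same]
      split_ifs with h1 h2 h2
      · rw [MvPolynomial.coeff_weightedHomogeneousComponent, if_pos (by omega)]
      · rw [MvPolynomial.coeff_weightedHomogeneousComponent, if_neg (by omega)]
      · omega
      · simp
    · simp [hl]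

theorem degComp_mem (deg : ι → ℕ) (j : ℕ) (f : ι →₀ MvPolynomial (Fin r) K) :
    degComp a deg j f ∈ freePart K a deg j := by
  intro i m h
  rw [coeff_degComp] at h
  by_contra h1
  simp [h1] at h

theorem degComp_of_mem {deg : ι → ℕ} {j : ℕ} {f : ι →₀ MvPolynomial (Fin r) K}
    (hf : f ∈ freePart K a deg j) : degComp a deg j f = f := by
  ext i m
  rw [coeff_degComp]
  split_ifs with h
  · rfl
  · by_contra h1
    exact h (hf i m (Ne.symm h1))

theorem degComp_of_mem_ne {deg : ι → ℕ} {j l : ℕ} (hjl : l ≠ j) {f : ι →₀ MvPolynomial (Fin r) K}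
    (hf : f ∈ freePart K a deg l) : degComp a deg j f = 0 := by
  ext i m
  rw [coeff_degComp]
  split_ifs with h
  · by_contra h1
    exact hjl ((hf i m h1).symm.trans h)
  · simp

theorem degComp_mem_varSub (deg : ι → ℕ) (j : ℕ) {k : ℕ} {f : ι →₀ MvPolynomial (Fin r) K}
    (hf : f ∈ varSub K r ι k) : degComp a deg j f ∈ varSub K r ι k := by
  rw [mem_varSub] at hf ⊢
  intro i m hm
  rw [coeff_degComp] at hm
  exact hf i m fun h => hm (by simp [h])

/-- A linear map between graded free modules which is homogeneous of degree `0`. -/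
def IsHomogeneousMap (deg : ι → ℕ) (deg' : κ → ℕ)
    (T : (ι →₀ MvPolynomial (Fin r) K) →ₗ[MvPolynomial (Fin r) K]
      (κ →₀ MvPolynomial (Fin r) K)) : Prop :=
  ∀ i, T (Finsupp.single i 1) ∈ freePart K a deg' (deg i)

variable {a} {deg : ι → ℕ} {deg' : κ → ℕ}
  {T : (ι →₀ MvPolynomial (Fin r) K) →ₗ[MvPolynomial (Fin r) K] (κ →₀ MvPolynomial (Fin r) K)}

theorem IsHomogeneousMap.map_mem (hT : IsHomogeneousMap a deg deg' T) {j : ℕ}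
    {f : ι →₀ MvPolynomial (Fin r) K} (hf : f ∈ freePart K a deg j) :
    T f ∈ freePart K a deg' j :=
  ZetaBarnes.map_mem a _ (smul_mem_freePart a deg') deg T hT j f hf

/-- This allows every relation between representatives to be replaced by its component of degree
`j`, so the chases stay inside one graded piece. -/
theorem IsHomogeneousMap.degComp_map (hT : IsHomogeneousMap a deg deg' T) (j : ℕ)
    (f : ι →₀ MvPolynomial (Fin r) K) :
    degComp a deg' j (T f) = T (degComp a deg j f) := by
  refine Submodule.iSup_induction (freePart K a deg)
    (motive := fun f => degComp a deg' j (T f) = T (degComp a deg j f))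
    (mem_iSup_freePart a deg f) (fun l f hf => ?_) (by simp) (fun f g hf hg => ?_)
  · by_cases hl : l = j
    · subst hl
      rw [degComp_of_mem a hf, degComp_of_mem a (hT.map_mem hf)]
    · rw [degComp_of_mem_ne a hl hf, degComp_of_mem_ne a hl (hT.map_mem hf), map_zero]
  · rw [map_add, map_add, map_add, map_add, hf, hg]

end Graded

/-! ### Homology modulo the first variables -/

section RelativeHomology

variable {K : Type u} [Field K] {r : ℕ} {a : Fin r → ℕ} {ι₀ ι₁ ι₂ ι₃ : Type u}

/-- The twist by `-c` is encoded by raising all basis degrees by `c`, which avoids negative degrees;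
the case `j < c` is `freePart_shift_of_lt`. -/
theorem freePart_shift_add {ι : Type u} (deg : ι → ℕ) (c j : ℕ) :
    freePart K a (fun i => deg i + c) (j + c) = freePart K a deg j := by
  ext f
  refine forall₂_congr fun i m => imp_congr_right fun _ => ?_
  change _ + (_ + c) = j + c ↔ _
  omega

theorem freePart_shift_of_lt {ι : Type u} (deg : ι → ℕ) {c j : ℕ} (h : j < c) :
    freePart K a (fun i => deg i + c) j = ⊥ := by
  rw [eq_bot_iff]
  intro f hf
  rw [Submodule.mem_bot]
  ext i m
  by_contra h1
  have := hf i m h1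
  change _ + (_ + c) = j at this
  omega

variable (K) in
/-- Multiplication by a variable on a free module. -/
def mulVar (i : Fin r) (ι : Type u) :
    (ι →₀ MvPolynomial (Fin r) K) →ₗ[MvPolynomial (Fin r) K] (ι →₀ MvPolynomial (Fin r) K) :=
  LinearMap.lsmul _ _ (MvPolynomial.X i)

theorem isHomogeneousMap_mulVar (i : Fin r) {ι : Type u} (deg : ι → ℕ) :
    IsHomogeneousMap a (fun l => deg l + a i) deg (mulVar K i ι) := by
  classical
  intro l l' m hm
  simp only [mulVar, LinearMap.lsmul_apply, Finsupp.smul_single, smul_eq_mul, mul_one] at hm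
  by_cases hl : l = l'
  · subst hl
    rw [Finsupp.single_eq_same, MvPolynomial.coeff_X] at hm
    have hm' : Finsupp.single i 1 = m := by
      by_contra h
      simp [h] at hm
    subst hm'
    simp only [Finsupp.weight_single, smul_eq_mul, one_mul]
    omega
  · simp [hl] at hm

theorem divVar_mem_shift (i : Fin r) {ι : Type u} {deg : ι → ℕ} {j : ℕ}
    {f : ι →₀ MvPolynomial (Fin r) K} (hf : f ∈ freePart K a deg j) :
    divVar i f ∈ freePart K a (fun l => deg l + a i) j := by
  intro l m hm
  rw [coeff_divVar] at hm
  have := hf l _ hm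
  rw [map_add, Finsupp.weight_single, one_smul] at this
  change _ + (_ + _) = j
  omega

/-- The cycles of a map of free modules modulo the first `k` variables. -/
def relCycles (k : ℕ) (g : (ι₁ →₀ MvPolynomial (Fin r) K) →ₗ[MvPolynomial (Fin r) K]
    (ι₀ →₀ MvPolynomial (Fin r) K)) :
    Submodule (MvPolynomial (Fin r) K) (ι₁ →₀ MvPolynomial (Fin r) K) :=
  (varSub K r ι₀ k).comap g

/-- The boundaries of a map of free modules modulo the first `k` variables. -/
def relBoundaries (k : ℕ) (f : (ι₁ →₀ MvPolynomial (Fin r) K) →ₗ[MvPolynomial (Fin r) K]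
    (ι₀ →₀ MvPolynomial (Fin r) K)) :
    Submodule (MvPolynomial (Fin r) K) (ι₀ →₀ MvPolynomial (Fin r) K) :=
  LinearMap.range f ⊔ varSub K r ι₀ k

theorem mem_relBoundaries {k : ℕ} {f : (ι₁ →₀ MvPolynomial (Fin r) K) →ₗ[MvPolynomial (Fin r) K]
    (ι₀ →₀ MvPolynomial (Fin r) K)} {z : ι₀ →₀ MvPolynomial (Fin r) K} :
    z ∈ relBoundaries k f ↔ ∃ u, ∃ v ∈ varSub K r ι₀ k, f u + v = z := by
  simp [relBoundaries, Submodule.mem_sup]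

theorem relBoundaries_mono {k l : ℕ} (h : k ≤ l)
    (f : (ι₁ →₀ MvPolynomial (Fin r) K) →ₗ[MvPolynomial (Fin r) K]
      (ι₀ →₀ MvPolynomial (Fin r) K)) : relBoundaries k f ≤ relBoundaries l f :=
  sup_le_sup_left (varSub_mono h) _

variable {f : (ι₃ →₀ MvPolynomial (Fin r) K) →ₗ[MvPolynomial (Fin r) K]
    (ι₂ →₀ MvPolynomial (Fin r) K)}
  {g : (ι₂ →₀ MvPolynomial (Fin r) K) →ₗ[MvPolynomial (Fin r) K] (ι₁ →₀ MvPolynomial (Fin r) K)}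
  {h : (ι₁ →₀ MvPolynomial (Fin r) K) →ₗ[MvPolynomial (Fin r) K] (ι₀ →₀ MvPolynomial (Fin r) K)}

/-- The part in `P` of the homology of `f` and `g` modulo the first `k` variables. -/
abbrev RelHomology (k : ℕ) (f : (ι₃ →₀ MvPolynomial (Fin r) K) →ₗ[MvPolynomial (Fin r) K]
      (ι₂ →₀ MvPolynomial (Fin r) K))
    (g : (ι₂ →₀ MvPolynomial (Fin r) K) →ₗ[MvPolynomial (Fin r) K]
      (ι₁ →₀ MvPolynomial (Fin r) K)) (P : Submodule K (ι₂ →₀ MvPolynomial (Fin r) K)) : Type u :=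
  Subquotient ((relCycles k g).restrictScalars K ⊓ P) ((relBoundaries k f).restrictScalars K)

theorem degComp_mem_relBoundaries {k : ℕ} {deg₃ : ι₃ → ℕ} {deg₂ : ι₂ → ℕ}
    (hf : IsHomogeneousMap a deg₃ deg₂ f) (j : ℕ) {z : ι₂ →₀ MvPolynomial (Fin r) K}
    (hz : z ∈ relBoundaries k f) : degComp a deg₂ j z ∈ relBoundaries k f := by
  obtain ⟨u, v, hv, rfl⟩ := mem_relBoundaries.mp hz
  rw [map_add, hf.degComp_map]
  exact mem_relBoundaries.mpr ⟨_, _, degComp_mem_varSub a deg₂ j hv, rfl⟩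

theorem degComp_mem_relCycles {k : ℕ} {deg₂ : ι₂ → ℕ} {deg₁ : ι₁ → ℕ}
    (hg : IsHomogeneousMap a deg₂ deg₁ g) (j : ℕ) {z : ι₂ →₀ MvPolynomial (Fin r) K}
    (hz : z ∈ relCycles k g) : degComp a deg₂ j z ∈ relCycles k g := by
  change g _ ∈ varSub K r ι₁ k
  rw [← hg.degComp_map]
  exact degComp_mem_varSub a deg₁ j hz

theorem mulVar_mem_relBoundaries (k : ℕ) (i : Fin r) {z : ι₂ →₀ MvPolynomial (Fin r) K}
    (hz : z ∈ relBoundaries k f) : mulVar K i ι₂ z ∈ relBoundaries k f :=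
  Submodule.smul_mem _ _ hz

/-- Separates the new variable from the old ones by splitting `v` into `x_k` times its quotient and
a remainder in `varSub K r ι₂ k`. -/
theorem mem_relBoundaries_succ {k : ℕ} (hk : k < r) {z : ι₂ →₀ MvPolynomial (Fin r) K} :
    z ∈ relBoundaries (k + 1) f ↔
      ∃ u, ∃ b ∈ relBoundaries k f, b + mulVar K ⟨k, hk⟩ ι₂ u = z := by
  constructor
  · intro hz
    obtain ⟨u, v, hv, rfl⟩ := mem_relBoundaries.mp hz
    refine ⟨divVar ⟨k, hk⟩ v, _, mem_relBoundaries.mpr ⟨u, _, sub_X_smul_divVar_mem hk hv, rfl⟩, ?_⟩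
    simp [mulVar, add_assoc]
  · rintro ⟨u, b, hb, rfl⟩
    exact add_mem (relBoundaries_mono (Nat.le_succ k) f hb)
      (mem_relBoundaries.mpr ⟨0, _, X_smul_mem_varSub hk u, by simp [mulVar]⟩)

variable {k : ℕ}

theorem mem_relCycles_of_mulVar_mem (hk : k < r) {u : ι₂ →₀ MvPolynomial (Fin r) K}
    (hu : mulVar K ⟨k, hk⟩ ι₂ u ∈ relCycles k g) : u ∈ relCycles k g := by
  refine mem_varSub_of_X_smul_mem hk ?_
  rw [← map_smul]
  exact hu

section Connecting

variable {deg₃ : ι₃ → ℕ} {deg₂ : ι₂ → ℕ} {deg₁ : ι₁ → ℕ}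

/-- Multiplication by a variable on homology. -/
def mulHom (hk : k < r) (f : (ι₃ →₀ MvPolynomial (Fin r) K) →ₗ[MvPolynomial (Fin r) K]
      (ι₂ →₀ MvPolynomial (Fin r) K))
    (g : (ι₂ →₀ MvPolynomial (Fin r) K) →ₗ[MvPolynomial (Fin r) K]
      (ι₁ →₀ MvPolynomial (Fin r) K)) (a : Fin r → ℕ) (deg₂ : ι₂ → ℕ) (j : ℕ) :
    RelHomology k f g (freePart K a (fun i => deg₂ i + a ⟨k, hk⟩) j) →ₗ[K]
      RelHomology k f g (freePart K a deg₂ j) :=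
  Subquotient.map ((mulVar K ⟨k, hk⟩ ι₂).restrictScalars K)
    (fun _ hz => Submodule.mem_inf.mpr
      ⟨Submodule.smul_mem (relCycles k g) (MvPolynomial.X ⟨k, hk⟩) (Submodule.mem_inf.mp hz).1,
        (isHomogeneousMap_mulVar _ deg₂).map_mem (Submodule.mem_inf.mp hz).2⟩)
    (fun _ _ hz => mulVar_mem_relBoundaries k _ hz)

theorem relCycles_mono {k l : ℕ} (h : k ≤ l) : relCycles k g ≤ relCycles l g :=
  Submodule.comap_mono (varSub_mono h)

/-- The map from the homology modulo `k` variables to the homology modulo `k + 1` variables. -/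
def projHom (k : ℕ) (f : (ι₃ →₀ MvPolynomial (Fin r) K) →ₗ[MvPolynomial (Fin r) K]
      (ι₂ →₀ MvPolynomial (Fin r) K))
    (g : (ι₂ →₀ MvPolynomial (Fin r) K) →ₗ[MvPolynomial (Fin r) K]
      (ι₁ →₀ MvPolynomial (Fin r) K)) (P : Submodule K (ι₂ →₀ MvPolynomial (Fin r) K)) :
    RelHomology k f g P →ₗ[K] RelHomology (k + 1) f g P :=
  Subquotient.map LinearMap.id (fun _ hz => ⟨relCycles_mono (Nat.le_succ k) hz.1, hz.2⟩)
    (fun _ _ hz => relBoundaries_mono (Nat.le_succ k) f hz)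

/-- The map inducing the connecting homomorphism. -/
def connecting (hk : k < r) (g : (ι₂ →₀ MvPolynomial (Fin r) K) →ₗ[MvPolynomial (Fin r) K]
      (ι₁ →₀ MvPolynomial (Fin r) K)) :
    (ι₂ →₀ MvPolynomial (Fin r) K) →ₗ[K] (ι₁ →₀ MvPolynomial (Fin r) K) :=
  divVar ⟨k, hk⟩ ∘ₗ g.restrictScalars K

/-- The lift in the snake lemma: modulo the earlier variables `g z` is a multiple of `x_k`, and
coefficientwise division is a `K`-linear choice of the quotient. -/
theorem connecting_sub_mem (hk : k < r) {z : ι₂ →₀ MvPolynomial (Fin r) K} (hz : z ∈ relCycles (k + 1) g) :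
    g z - mulVar K ⟨k, hk⟩ ι₁ (connecting hk g z) ∈ varSub K r ι₁ k :=
  sub_X_smul_divVar_mem hk hz

/-- Apply `h` to `g z ≡ x_k y`: since `h (g z) = 0`, the product `x_k (h y)` vanishes modulo the
earlier variables, and `x_k` cancels. -/
theorem connecting_mem_relCycles (hk : k < r) (hgh : ∀ z, h (g z) = 0) {z : ι₂ →₀ MvPolynomial (Fin r) K}
    (hz : z ∈ relCycles (k + 1) g) : connecting hk g z ∈ relCycles k h := by
  apply mem_relCycles_of_mulVar_mem hk
  have h1 := map_varSub_mem h (connecting_sub_mem hk hz)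
  rw [map_sub, hgh, zero_sub, neg_mem_iff] at h1
  exact h1

theorem connecting_mulVar (hk : k < r) (u : ι₂ →₀ MvPolynomial (Fin r) K) :
    connecting hk g (mulVar K ⟨k, hk⟩ ι₂ u) = g u := by
  simp only [connecting, LinearMap.comp_apply, LinearMap.restrictScalars_apply, mulVar,
    LinearMap.lsmul_apply, map_smul]
  exact divVar_X_smul _ _

theorem connecting_mem_varSub (hk : k < r) {z : ι₂ →₀ MvPolynomial (Fin r) K} (hz : z ∈ relCycles k g) :
    connecting hk g z ∈ varSub K r ι₁ k :=
  divVar_mem_varSub hk hz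

theorem relBoundaries_le_relCycles (hfg : ∀ z, g (f z) = 0) (k : ℕ) :
    relBoundaries k f ≤ relCycles k g := by
  intro z hz
  obtain ⟨u, v, hv, rfl⟩ := mem_relBoundaries.mp hz
  change g _ ∈ varSub K r ι₁ _
  rw [map_add, hfg, zero_add]
  exact map_varSub_mem g hv

theorem varSub_le_relBoundaries (k : ℕ) : varSub K r ι₂ k ≤ relBoundaries k f := le_sup_right

theorem map_mem_relBoundaries (k : ℕ) (u : ι₂ →₀ MvPolynomial (Fin r) K) :
    g u ∈ relBoundaries k g :=
  Submodule.mem_sup_left ⟨u, rfl⟩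

theorem connecting_mem_relBoundaries (hk : k < r) (hfg : ∀ z, g (f z) = 0)
    {z : ι₂ →₀ MvPolynomial (Fin r) K} (hz : z ∈ relBoundaries (k + 1) f) :
    connecting hk g z ∈ relBoundaries k g := by
  obtain ⟨u, b, hb, rfl⟩ := (mem_relBoundaries_succ hk).mp hz
  rw [map_add, connecting_mulVar]
  exact add_mem (varSub_le_relBoundaries k
    (connecting_mem_varSub hk (relBoundaries_le_relCycles hfg k hb))) (map_mem_relBoundaries k u)

/-- The connecting homomorphism. -/
def connectingHom (hk : k < r) (hfg : ∀ z, g (f z) = 0) (hgh : ∀ z, h (g z) = 0)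
    (hg : IsHomogeneousMap a deg₂ deg₁ g) (j : ℕ) :
    RelHomology (k + 1) f g (freePart K a deg₂ j) →ₗ[K]
      RelHomology k g h (freePart K a (fun i => deg₁ i + a ⟨k, hk⟩) j) :=
  Subquotient.map (connecting hk g)
    (fun _ hz => ⟨connecting_mem_relCycles hk hgh hz.1, divVar_mem_shift _ (hg.map_mem hz.2)⟩)
    (fun _ _ hz => connecting_mem_relBoundaries hk hfg hz)

/-- A cycle that becomes a boundary has the form `z = b + x_k u` with `b` a boundary modulo the old
variables; then `x_k u`, hence `u`, is a cycle. -/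
theorem exact_mulHom_projHom (hk : k < r) (hf : IsHomogeneousMap a deg₃ deg₂ f) (hfg : ∀ z, g (f z) = 0)
    (j : ℕ) : Function.Exact (mulHom hk f g a deg₂ j) (projHom k f g (freePart K a deg₂ j)) := by
  refine Subquotient.map_exact _ _ _ _ (fun z _ => ?_) (fun z hz hz' => ?_)
  · exact varSub_le_relBoundaries _ (X_smul_mem_varSub hk z)
  · obtain ⟨u, b, hb, hu⟩ := (mem_relBoundaries_succ hk).mp hz'
    -- `z` is homogeneous of degree `j`, so `b` and `u` may be replaced by their components of
    -- degree `j`, the latter for the shifted degrees.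
    have h1 : degComp a deg₂ j b +
        mulVar K ⟨k, hk⟩ ι₂ (degComp a (fun i => deg₂ i + a ⟨k, hk⟩) j u) = z := by
      rw [← (isHomogeneousMap_mulVar ⟨k, hk⟩ deg₂).degComp_map, ← map_add, hu]
      exact degComp_of_mem a hz.2
    have h2 := degComp_mem_relBoundaries hf j hb
    refine ⟨degComp a (fun i => deg₂ i + a ⟨k, hk⟩) j u, ⟨?_, degComp_mem _ _ _ _⟩, ?_⟩
    · apply mem_relCycles_of_mulVar_mem hk
      rw [← h1] at hz
      exact ((relCycles k g).add_mem_iff_right (relBoundaries_le_relCycles hfg k h2)).mp hz.1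
    · rw [LinearMap.restrictScalars_apply]
      nth_rw 1 [← h1]
      simpa using h2

/-- If the quotient of `g z` by `x_k` is `g u + v` with `v` in the span of the old variables, then
`z - x_k u` is a cycle modulo the old variables, and it has the same image as `z` modulo `x_k`. -/
theorem exact_projHom_connectingHom (hk : k < r) (hfg : ∀ z, g (f z) = 0) (hgh : ∀ z, h (g z) = 0)
    (hg : IsHomogeneousMap a deg₂ deg₁ g) (j : ℕ) :
    Function.Exact (projHom k f g (freePart K a deg₂ j))
      (connectingHom (f := f) hk hfg hgh hg j) := by
  refine Subquotient.map_exact _ _ _ _ (fun z hz => ?_) (fun z hz hz' => ?_)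
  · exact varSub_le_relBoundaries _ (connecting_mem_varSub hk hz.1)
  · obtain ⟨u, v, hv, hu⟩ := mem_relBoundaries.mp hz'
    have h1 : z - mulVar K ⟨k, hk⟩ ι₂ u ∈ relCycles k g := by
      change g _ ∈ varSub K r ι₁ _
      have h2 := connecting_sub_mem hk hz.1
      rw [← hu, map_add] at h2
      have h3 := add_mem h2 (Submodule.smul_mem _ (MvPolynomial.X ⟨k, hk⟩) hv)
      have h4 : g (mulVar K ⟨k, hk⟩ ι₂ u) = mulVar K ⟨k, hk⟩ ι₁ (g u) := map_smul _ _ _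
      rw [map_sub, h4]
      convert h3 using 1
      simp only [mulVar, LinearMap.lsmul_apply]
      abel
    refine ⟨degComp a deg₂ j (z - mulVar K ⟨k, hk⟩ ι₂ u),
      ⟨degComp_mem_relCycles hg j h1, degComp_mem _ _ _ _⟩, ?_⟩
    rw [map_sub, degComp_of_mem a hz.2, (isHomogeneousMap_mulVar ⟨k, hk⟩ deg₂).degComp_map]
    simp only [LinearMap.id_apply, sub_sub_cancel]
    exact varSub_le_relBoundaries _ (X_smul_mem_varSub hk _)

/-- If `x_k z = g u + v` with `v` in the span of the old variables, then `u` is a cycle modulo one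
more variable, and dividing `g u` by `x_k` gives `z` up to the quotient of `v`. -/
theorem exact_connectingHom_mulHom (hk : k < r) (hfg : ∀ z, g (f z) = 0) (hgh : ∀ z, h (g z) = 0)
    (hg : IsHomogeneousMap a deg₂ deg₁ g) (j : ℕ) :
    Function.Exact (connectingHom (f := f) hk hfg hgh hg j) (mulHom hk g h a deg₁ j) := by
  refine Subquotient.map_exact _ _ _ _ (fun z hz => ?_) (fun z hz hz' => ?_)
  · have h1 := neg_mem (varSub_le_relBoundaries (f := g) k (connecting_sub_mem hk hz.1))
    have h2 := add_mem h1 (map_mem_relBoundaries k z)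
    simpa using h2
  · obtain ⟨u, v, hv, hu⟩ := mem_relBoundaries.mp hz'
    have h1 : g (degComp a deg₂ j u) + degComp a deg₁ j v = mulVar K ⟨k, hk⟩ ι₁ z := by
      rw [← hg.degComp_map, ← map_add, hu]
      exact degComp_of_mem a ((isHomogeneousMap_mulVar _ deg₁).map_mem hz.2)
    have h2 := degComp_mem_varSub a deg₁ j hv
    have h3 : g (degComp a deg₂ j u) = mulVar K ⟨k, hk⟩ ι₁ z - degComp a deg₁ j v := by
      rw [← h1, add_sub_cancel_right]
    refine ⟨degComp a deg₂ j u, ⟨?_, degComp_mem _ _ _ _⟩, ?_⟩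
    · change g _ ∈ varSub K r ι₁ _
      rw [h3]
      exact sub_mem (X_smul_mem_varSub hk z) (varSub_mono (Nat.le_succ k) h2)
    · have h4 : connecting hk g (degComp a deg₂ j u) = z - divVar ⟨k, hk⟩ (degComp a deg₁ j v) := by
        simp only [connecting, LinearMap.comp_apply, LinearMap.restrictScalars_apply, h3, map_sub]
        congr 1
        exact divVar_X_smul _ _
      rw [h4, sub_sub_cancel]
      exact varSub_le_relBoundaries _ (divVar_mem_varSub hk h2)

/-- The dimension formula for the homology modulo one more variable. -/
theorem finrank_relHomology_succ (hk : k < r) (hf : IsHomogeneousMap a deg₃ deg₂ f)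
    (hfg : ∀ z, g (f z) = 0) (hgh : ∀ z, h (g z) = 0) (hg : IsHomogeneousMap a deg₂ deg₁ g) (j : ℕ)
    [Module.Finite K (RelHomology k f g (freePart K a deg₂ j))]
    [Module.Finite K (RelHomology k g h (freePart K a (fun i => deg₁ i + a ⟨k, hk⟩) j))] :
    Module.Finite K (RelHomology (k + 1) f g (freePart K a deg₂ j)) ∧
      Module.finrank K (RelHomology (k + 1) f g (freePart K a deg₂ j)) +
        Module.finrank K (LinearMap.range (mulHom hk f g a deg₂ j)) +
        Module.finrank K (LinearMap.range (mulHom hk g h a deg₁ j)) =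
      Module.finrank K (RelHomology k f g (freePart K a deg₂ j)) +
        Module.finrank K (RelHomology k g h (freePart K a (fun i => deg₁ i + a ⟨k, hk⟩) j)) :=
  finrank_of_exact (exact_mulHom_projHom hk hf hfg j)
    (exact_projHom_connectingHom hk hfg hgh hg j) (exact_connectingHom_mulHom hk hfg hgh hg j)

end Connecting

/-- Lifting finitely many generators of the image; `W` itself lies in a free module of possibly
infinite rank and need not be finitely generated. -/
theorem exists_fg_map_eq {R M N : Type*} [CommRing R] [AddCommGroup M] [Module R M]
    [AddCommGroup N] [Module R N] (q : M →ₗ[R] N) (W : Submodule R M) (hW : (W.map q).FG) :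
    ∃ W' ≤ W, W'.FG ∧ W'.map q = W.map q := by
  classical
  obtain ⟨t, ht⟩ := hW
  have ht' : (t : Set N) ⊆ q '' W := fun x hx => by
    have : x ∈ W.map q := ht ▸ Submodule.subset_span hx
    exact this
  obtain ⟨s, hs, rfl⟩ := Finset.subset_set_image_iff.mp ht'
  refine ⟨Submodule.span R s, Submodule.span_le.mpr hs, ⟨s, rfl⟩, ?_⟩
  rw [← ht, Submodule.map_span, Finset.coe_image]

/-- Finite generation of the homology passes to the homology modulo one more variable. -/
theorem exists_fg_relCycles_succ (hk : k < r) (hgh : ∀ z, h (g z) = 0)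
    (h₂ : ∃ N : Submodule (MvPolynomial (Fin r) K) (ι₂ →₀ MvPolynomial (Fin r) K),
      N.FG ∧ relCycles k g ≤ N ⊔ relBoundaries k f)
    (h₁ : ∃ N : Submodule (MvPolynomial (Fin r) K) (ι₁ →₀ MvPolynomial (Fin r) K),
      N.FG ∧ relCycles k h ≤ N ⊔ relBoundaries k g) :
    ∃ N : Submodule (MvPolynomial (Fin r) K) (ι₂ →₀ MvPolynomial (Fin r) K),
      N.FG ∧ relCycles (k + 1) g ≤ N ⊔ relBoundaries (k + 1) f := by
  obtain ⟨N₂, hN₂, h₂⟩ := h₂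
  obtain ⟨N₁, hN₁, h₁⟩ := h₁
  -- `connecting` is only `K`-linear. `W` is its `S`-linear substitute: the pairs `(z, y)` with `z`
  -- a cycle and `g z ≡ x_k y` modulo the earlier variables.
  let W : Submodule (MvPolynomial (Fin r) K)
      ((ι₂ →₀ MvPolynomial (Fin r) K) × (ι₁ →₀ MvPolynomial (Fin r) K)) :=
    (relCycles (k + 1) g).comap (LinearMap.fst _ _ _) ⊓
      (varSub K r ι₁ k).comap (g ∘ₗ LinearMap.fst _ _ _ - mulVar K ⟨k, hk⟩ ι₁ ∘ₗ LinearMap.snd _ _ _)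
  have hW (z) (hz : z ∈ relCycles (k + 1) g) : (z, connecting hk g z) ∈ W :=
    Submodule.mem_inf.mpr ⟨hz, connecting_sub_mem hk hz⟩
  have hW' (x) (hx : x ∈ W) : x.1 ∈ relCycles (k + 1) g ∧
      g x.1 - mulVar K ⟨k, hk⟩ ι₁ x.2 ∈ varSub K r ι₁ k := Submodule.mem_inf.mp hx
  have hWc (x) (hx : x ∈ W) : x.2 ∈ relCycles k h := by
    apply mem_relCycles_of_mulVar_mem hk
    have h1 := map_varSub_mem h (hW' x hx).2
    rw [map_sub, hgh, zero_sub, neg_mem_iff] at h1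
    exact h1
  let q := (relBoundaries k g).mkQ ∘ₗ LinearMap.snd (MvPolynomial (Fin r) K)
    (ι₂ →₀ MvPolynomial (Fin r) K) (ι₁ →₀ MvPolynomial (Fin r) K)
  -- The second components are cycles, so their classes lie in the image of `N₁`, a finitely
  -- generated module over a Noetherian ring.
  have hfg : (W.map q).FG := by
    have hN : IsNoetherian (MvPolynomial (Fin r) K) (N₁.map (relBoundaries k g).mkQ) :=
      isNoetherian_of_fg_of_noetherian _ (hN₁.map _)
    refine isNoetherian_submodule.mp hN _ ?_
    rintro _ ⟨x, hx, rfl⟩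
    obtain ⟨n, hn, b, hb, hnb⟩ := Submodule.mem_sup.mp (h₁ (hWc x hx))
    refine ⟨n, hn, ?_⟩
    simp only [q, LinearMap.comp_apply, LinearMap.snd_apply, ← hnb, map_add]
    simpa using hb
  obtain ⟨W', hW'W, hW'fg, hW'q⟩ := exists_fg_map_eq q W hfg
  refine ⟨N₂ ⊔ W'.map (LinearMap.fst _ _ _), hN₂.sup (hW'fg.map _), fun z hz => ?_⟩
  obtain ⟨x, hx, hxz⟩ : q (z, connecting hk g z) ∈ W'.map q := by
    rw [hW'q]
    exact ⟨_, hW z hz, rfl⟩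
  have h3 : connecting hk g z - x.2 ∈ relBoundaries k g := by
    rw [← Submodule.Quotient.eq]
    exact hxz.symm
  obtain ⟨u, v, hv, huv⟩ := mem_relBoundaries.mp h3
  -- Once `z` is corrected by a generator combination `x.1` with the same connecting class, a
  -- multiple of `x_k` turns it into a cycle modulo the old variables, which `N₂` covers.
  have h4 : z - x.1 - mulVar K ⟨k, hk⟩ ι₂ u ∈ relCycles k g := by
    change g _ ∈ varSub K r ι₁ _
    have h5 := sub_mem (connecting_sub_mem hk hz) (hW' x (hW'W hx)).2
    have h6 := add_mem h5 (Submodule.smul_mem _ (MvPolynomial.X ⟨k, hk⟩) hv)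
    have h7 : g (mulVar K ⟨k, hk⟩ ι₂ u) = mulVar K ⟨k, hk⟩ ι₁ (g u) := map_smul _ _ _
    have h8 : v = connecting hk g z - x.2 - g u := by rw [← huv]; abel
    rw [map_sub, map_sub, h7]
    convert h6 using 1
    rw [h8]
    simp only [mulVar, LinearMap.lsmul_apply, smul_sub]
    abel
  have h5 : z = x.1 + mulVar K ⟨k, hk⟩ ι₂ u + (z - x.1 - mulVar K ⟨k, hk⟩ ι₂ u) := by abel
  rw [h5]
  refine add_mem (add_mem ?_ ?_) ?_
  · exact Submodule.mem_sup_left (Submodule.mem_sup_right ⟨x, hx, rfl⟩)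
  · exact Submodule.mem_sup_right (varSub_le_relBoundaries _ (X_smul_mem_varSub hk u))
  · exact sup_le_sup le_sup_left (relBoundaries_mono (Nat.le_succ k) f) (h₂ h4)

end RelativeHomology

/-- The ranks `ρ` telescope. Here `t` and `t'` will be dimensions before and after killing a
variable, `s` the dimensions shifted in internal degree, and `ρ` the ranks of multiplication; the
two leftover terms at `N` vanish for large `N`. -/
theorem alternating_sum_of_recursion {t t' s ρ : ℕ → ℤ} (h0 : t' 0 + ρ 0 = t 0)
    (h1 : ∀ n, t' (n + 1) + ρ (n + 1) + ρ n = t (n + 1) + s n) (N : ℕ) :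
    ∑ n ∈ Finset.range (N + 1), (-1) ^ n * t' n + (-1) ^ N * ρ N + (-1) ^ (N + 1) * s N =
      ∑ n ∈ Finset.range (N + 1), (-1) ^ n * t n - ∑ n ∈ Finset.range (N + 1), (-1) ^ n * s n := by
  induction N with
  | zero => simp; linarith
  | succ N ih =>
    rw [Finset.sum_range_succ, Finset.sum_range_succ _ (N + 1), Finset.sum_range_succ _ (N + 1)]
    have := h1 N
    have h2 : t' (N + 1) = t (N + 1) + s N - ρ (N + 1) - ρ N := by linarith
    rw [h2]
    linear_combination ih

theorem Subquotient.finite_of_le {K V : Type u} [Field K] [AddCommGroup V] [Module K V]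
    {Z B : Submodule K V} (h : Z ≤ B) : Module.Finite K (Subquotient Z B) :=
  have := Subquotient.subsingleton h
  inferInstance

/-! ### Euler series and finite generation for the homology modulo the first variables -/

namespace GradedFreeResolution

variable {K : Type u} [Field K] {r : ℕ} {a : Fin r → ℕ} {M : Type u} [AddCommGroup M] [Module K M]
  [Module (MvPolynomial (Fin r) K) M] {𝓜 : ℕ → Submodule K M} (F : GradedFreeResolution a 𝓜)

/-- The basis of the free module preceding a term of the resolution. -/
def ιOut : ℕ → Type u
  -- A zero module follows `F_0`, not `M`: every element of `F_0` is then a cycle, and the homology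
  -- there is `M` instead of zero.
  | 0 => PEmpty
  | n + 1 => F.ι n

/-- The degrees of the basis of the free module preceding a term of the resolution. -/
def degOut : ∀ n, F.ιOut n → ℕ
  | 0 => PEmpty.elim
  | n + 1 => F.deg n

/-- The differential starting at a term of the resolution. -/
def dOut : ∀ n, (F.ι n →₀ MvPolynomial (Fin r) K) →ₗ[MvPolynomial (Fin r) K]
    (F.ιOut n →₀ MvPolynomial (Fin r) K)
  | 0 => 0
  | n + 1 => F.d n

theorem isHomogeneousMap_d (n : ℕ) : IsHomogeneousMap a (F.deg (n + 1)) (F.deg n) (F.d n) :=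
  F.d_mem n

theorem isHomogeneousMap_dOut : ∀ n, IsHomogeneousMap a (F.deg n) (F.degOut n) (F.dOut n)
  | 0 => fun _ => zero_mem _
  | n + 1 => F.d_mem n

theorem dOut_d : ∀ n z, F.dOut n (F.d n z) = 0
  | 0, _ => rfl
  | n + 1, z => (F.exact_succ n).apply_apply_eq_zero z

/-- The homology in `P` of the resolution modulo the first `k` variables. -/
abbrev RelTor (k n : ℕ) (P : Submodule K (F.ι n →₀ MvPolynomial (Fin r) K)) : Type u :=
  RelHomology k (F.d n) (F.dOut n) P

/-- The rank of multiplication by the variable with index `k` on the homology modulo the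
preceding variables. -/
def mulRank (k : ℕ) (hk : k < r) (n j : ℕ) : ℕ :=
  Module.finrank K (LinearMap.range (mulHom hk (F.d n) (F.dOut n) a (F.deg n) j))

/-- The dimension of a graded piece of the homology modulo the first `k` variables. -/
def relBetti (k n j : ℕ) : ℕ :=
  Module.finrank K (F.RelTor k n (freePart K a (F.deg n) j))

theorem finite_shift {k : ℕ} (hfin : ∀ n j, Module.Finite K (F.RelTor k n (freePart K a (F.deg n) j)))
    (c n j : ℕ) : Module.Finite K (F.RelTor k n (freePart K a (fun i => F.deg n i + c) j)) ∧
      Module.finrank K (F.RelTor k n (freePart K a (fun i => F.deg n i + c) j)) =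
        if c ≤ j then F.relBetti k n (j - c) else 0 := by
  split_ifs with h
  · obtain ⟨j, rfl⟩ := Nat.exists_eq_add_of_le' h
    rw [freePart_shift_add, Nat.add_sub_cancel]
    exact ⟨hfin n j, rfl⟩
  · rw [freePart_shift_of_lt _ (not_le.mp h)]
    have : Subsingleton (F.RelTor k n ⊥) := Subquotient.subsingleton (by simp)
    exact ⟨inferInstance, Module.finrank_zero_of_subsingleton⟩

theorem relBetti_succ_zero {k : ℕ} (hk : k < r)
    (hfin : ∀ n j, Module.Finite K (F.RelTor k n (freePart K a (F.deg n) j))) (j : ℕ) :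
    Module.Finite K (F.RelTor (k + 1) 0 (freePart K a (F.deg 0) j)) ∧
      F.relBetti (k + 1) 0 j + F.mulRank k hk 0 j = F.relBetti k 0 j := by
  -- The complex is prolonged by one more zero map, so that the end of the long exact sequence is an
  -- instance of the general formula.
  let h : (F.ιOut 0 →₀ MvPolynomial (Fin r) K) →ₗ[MvPolynomial (Fin r) K]
    (F.ιOut 0 →₀ MvPolynomial (Fin r) K) := 0
  have hempty : IsEmpty (F.ιOut 0) := inferInstanceAs (IsEmpty PEmpty)
  have hs (P : Submodule K (F.ιOut 0 →₀ MvPolynomial (Fin r) K)) :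
      Subsingleton (RelHomology k (F.dOut 0) h P) := by
    refine Subquotient.subsingleton fun x _ => ?_
    rw [Subsingleton.elim x 0]
    exact zero_mem _
  have := hfin 0 j
  obtain ⟨h1, h2⟩ := finrank_relHomology_succ (a := a) hk (h := h) (F.isHomogeneousMap_d 0)
    (F.dOut_d 0) (fun _ => rfl) (F.isHomogeneousMap_dOut 0) j
  refine ⟨h1, ?_⟩
  have h3 : Module.finrank K (RelHomology k (F.dOut 0) h
      (freePart K a (fun i => F.degOut 0 i + a ⟨k, hk⟩) j)) = 0 :=
    Module.finrank_zero_of_subsingleton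
  have h4 : Module.finrank K (LinearMap.range (mulHom hk (F.dOut 0) h a (F.degOut 0) j)) = 0 :=
    Module.finrank_zero_of_subsingleton
  rw [h3, h4] at h2
  exact h2

theorem relBetti_succ_succ {k : ℕ} (hk : k < r)
    (hfin : ∀ n j, Module.Finite K (F.RelTor k n (freePart K a (F.deg n) j))) (n j : ℕ) :
    Module.Finite K (F.RelTor (k + 1) (n + 1) (freePart K a (F.deg (n + 1)) j)) ∧
      F.relBetti (k + 1) (n + 1) j + F.mulRank k hk (n + 1) j + F.mulRank k hk n j =
        F.relBetti k (n + 1) j +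
          if a ⟨k, hk⟩ ≤ j then F.relBetti k n (j - a ⟨k, hk⟩) else 0 := by
  have : Module.Finite K (RelHomology k (F.d (n + 1)) (F.d n) (freePart K a (F.deg (n + 1)) j)) :=
    hfin (n + 1) j
  obtain ⟨h3, h4⟩ := F.finite_shift hfin (a ⟨k, hk⟩) n j
  obtain ⟨h1, h2⟩ := finrank_relHomology_succ (a := a) hk (f := F.d (n + 1)) (g := F.d n)
    (h := F.dOut n) (F.isHomogeneousMap_d (n + 1))
    (F.dOut_d (n + 1)) (F.dOut_d n) (F.isHomogeneousMap_d n) j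
  refine ⟨h1, ?_⟩
  rw [h4] at h2
  exact h2

theorem mulRank_le {k : ℕ} (hk : k < r)
    (hfin : ∀ n j, Module.Finite K (F.RelTor k n (freePart K a (F.deg n) j))) (n j : ℕ) :
    F.mulRank k hk n j ≤ F.relBetti k n j := by
  have := hfin n j
  exact Submodule.finrank_le _

section Base

theorem relCycles_zero_le (n : ℕ) :
    relCycles 0 (F.dOut (n + 1)) ≤ relBoundaries 0 (F.d (n + 1)) := by
  intro z hz
  have h : F.d n z ∈ varSub K r (F.ι n) 0 := hz
  rw [varSub_zero, Submodule.mem_bot] at h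
  obtain ⟨u, hu⟩ := (F.exact_succ n z).mp h
  exact mem_relBoundaries.mpr ⟨u, 0, zero_mem _, by simp [hu]⟩

/-- For `k = 0` this is exactness of the resolution. Each further variable extends the range of
nonzero homology by at most one step, since `H_(n+1)(k+1)` lies between quotients and subspaces of
`H_(n+1)(k)` and `H_n(k)`. Hence the Euler characteristics below are finite sums. -/
theorem relTor_induction (h0 : ∀ j, Module.Finite K (F.RelTor 0 0 (freePart K a (F.deg 0) j)))
    (k : ℕ) (hk : k ≤ r) :
    (∀ n j, Module.Finite K (F.RelTor k n (freePart K a (F.deg n) j))) ∧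
      ∀ n j, k < n → F.relBetti k n j = 0 := by
  induction k with
  | zero =>
    have h1 (n) (P : Submodule K (F.ι (n + 1) →₀ MvPolynomial (Fin r) K)) :
        Subsingleton (F.RelTor 0 (n + 1) P) :=
      Subquotient.subsingleton fun z hz => F.relCycles_zero_le n hz.1
    refine ⟨fun n j => ?_, fun n j hn => ?_⟩
    · cases n with
      | zero => exact h0 j
      | succ n =>
        exact Subquotient.finite_of_le fun z hz => F.relCycles_zero_le n hz.1
    · obtain ⟨n, rfl⟩ := Nat.exists_eq_succ_of_ne_zero hn.ne'
      have := h1 n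
      exact Module.finrank_zero_of_subsingleton
  | succ k ih =>
    obtain ⟨hfin, hzero⟩ := ih (by omega)
    refine ⟨fun n j => ?_, fun n j hn => ?_⟩
    · cases n with
      | zero => exact (F.relBetti_succ_zero hk hfin j).1
      | succ n => exact (F.relBetti_succ_succ hk hfin n j).1
    · obtain ⟨n, rfl⟩ := Nat.exists_eq_succ_of_ne_zero (by omega : n ≠ 0)
      have h2 := (F.relBetti_succ_succ hk hfin n j).2
      rw [hzero (n + 1) j (by omega), hzero n _ (by omega)] at h2
      simp at h2
      exact h2.1.1

/-- The alternating sum of the dimensions of the graded pieces of the homology modulo the first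
`k` variables, as a power series. -/
def eulerSeries (k N : ℕ) : PowerSeries ℤ :=
  PowerSeries.mk fun j => ∑ n ∈ Finset.range (N + 1), (-1) ^ n * (F.relBetti k n j : ℤ)

/-- The long exact sequence expresses the new Euler characteristic as the old one minus its shift by
`a_k`; truncation at `N > k` loses nothing. -/
theorem eulerSeries_succ (h0 : ∀ j, Module.Finite K (F.RelTor 0 0 (freePart K a (F.deg 0) j)))
    {k N : ℕ} (hk : k < r) (hN : k < N) :
    F.eulerSeries (k + 1) N = (1 - PowerSeries.X ^ a ⟨k, hk⟩) * F.eulerSeries k N := by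
  obtain ⟨hfin, hzero⟩ := F.relTor_induction h0 k hk.le
  ext j
  rw [sub_mul, one_mul, map_sub, PowerSeries.coeff_X_pow_mul', eulerSeries, eulerSeries,
    PowerSeries.coeff_mk, PowerSeries.coeff_mk, PowerSeries.coeff_mk]
  have h1 := alternating_sum_of_recursion (t := fun n => (F.relBetti k n j : ℤ))
    (t' := fun n => (F.relBetti (k + 1) n j : ℤ)) (ρ := fun n => (F.mulRank k hk n j : ℤ))
    (s := fun n => ((if a ⟨k, hk⟩ ≤ j then F.relBetti k n (j - a ⟨k, hk⟩) else 0 : ℕ) : ℤ))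
    (by exact_mod_cast (F.relBetti_succ_zero hk hfin j).2)
    (fun n => by exact_mod_cast (F.relBetti_succ_succ hk hfin n j).2) N
  have h2 : F.mulRank k hk N j = 0 := by
    have := F.mulRank_le hk hfin N j
    rw [hzero N j hN] at this
    omega
  simp only [h2, hzero N _ hN, ite_self, Nat.cast_zero, mul_zero, add_zero] at h1
  rw [h1]
  congr 1
  split_ifs <;> simp

theorem eulerSeries_eq (h0 : ∀ j, Module.Finite K (F.RelTor 0 0 (freePart K a (F.deg 0) j)))
    {N : ℕ} (hN : r ≤ N) :
    F.eulerSeries r N = (∏ i, (1 - PowerSeries.X ^ a i)) * F.eulerSeries 0 N := by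
  have h (k : ℕ) (hk : k ≤ r) : F.eulerSeries k N =
      (∏ i : Fin k, (1 - PowerSeries.X ^ a (Fin.castLE hk i))) * F.eulerSeries 0 N := by
    induction k with
    | zero => simp
    | succ k ih =>
      rw [F.eulerSeries_succ h0 hk (by omega), ih (by omega), Fin.prod_univ_castSucc, ← mul_assoc,
        mul_comm (1 - _)]
      rfl
  exact h r le_rfl

/-- The coefficients of the Euler series modulo no variables. -/
theorem coeff_eulerSeries_zero
    (h0 : ∀ j, Module.Finite K (F.RelTor 0 0 (freePart K a (F.deg 0) j))) (N j : ℕ) :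
    PowerSeries.coeff j (F.eulerSeries 0 N) = F.relBetti 0 0 j := by
  rw [eulerSeries, PowerSeries.coeff_mk, Finset.sum_range_succ']
  rw [Finset.sum_eq_zero]
  · simp
  · intro n _
    rw [(F.relTor_induction h0 0 (Nat.zero_le _)).2 (n + 1) j (by omega)]
    simp

/-- Finite generation starts from `M`, the only homology for `k = 0`, and is carried through the
long exact sequences; the free modules themselves do not provide it. -/
theorem exists_fg_relCycles [Module.Finite (MvPolynomial (Fin r) K) M] (k : ℕ) (hk : k ≤ r) (n : ℕ) :
    ∃ N : Submodule (MvPolynomial (Fin r) K) (F.ι n →₀ MvPolynomial (Fin r) K),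
      N.FG ∧ relCycles k (F.dOut n) ≤ N ⊔ relBoundaries k (F.d n) := by
  induction k generalizing n with
  | zero =>
    cases n with
    | zero =>
      obtain ⟨N, -, hN, hN'⟩ := exists_fg_map_eq F.ε ⊤ (by
        rw [Submodule.map_top, LinearMap.range_eq_top.mpr F.ε_surjective]
        exact Module.Finite.fg_top)
      refine ⟨N, hN, fun z _ => ?_⟩
      obtain ⟨y, hy, hyz⟩ : F.ε z ∈ N.map F.ε := hN' ▸ ⟨z, trivial, rfl⟩
      obtain ⟨u, hu⟩ := (F.exact_zero (z - y)).mp (by rw [map_sub, hyz, sub_self])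
      exact Submodule.mem_sup.mpr ⟨y, hy, z - y,
        mem_relBoundaries.mpr ⟨u, 0, zero_mem _, by simp [hu]⟩, by abel⟩
    | succ n => exact ⟨⊥, Submodule.fg_bot, by simpa using F.relCycles_zero_le n⟩
  | succ k ih =>
    cases n with
    | zero =>
      refine exists_fg_relCycles_succ hk
        (h := (0 : _ →ₗ[MvPolynomial (Fin r) K] (F.ιOut 0 →₀ MvPolynomial (Fin r) K)))
        (fun _ => rfl) (ih (by omega) 0) ⟨⊥, Submodule.fg_bot, fun x _ => ?_⟩
      have hempty : IsEmpty (F.ιOut 0) := inferInstanceAs (IsEmpty PEmpty)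
      rw [Subsingleton.elim x 0]
      exact zero_mem _
    | succ n => exact exists_fg_relCycles_succ hk (F.dOut_d n) (ih (by omega) (n + 1)) (ih (by omega) n)

end Base

end GradedFreeResolution

/-! ### Graded parts of a finitely generated module -/

section Parts

variable {K : Type u} [Field K] {r : ℕ} {a : Fin r → ℕ} {M : Type u} [AddCommGroup M] [Module K M]
  [Module (MvPolynomial (Fin r) K) M] {𝓜 : ℕ → Submodule K M} [DirectSum.Decomposition 𝓜]

variable (𝓜) in
/-- The projection to a graded part. -/
def partProj (n : ℕ) : M →ₗ[K] 𝓜 n :=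
  DirectSum.component K ℕ (fun n => 𝓜 n) n ∘ₗ (DirectSum.decomposeLinearEquiv 𝓜).toLinearMap

theorem partProj_of_mem {n : ℕ} {x : M} (hx : x ∈ 𝓜 n) : (partProj 𝓜 n x : M) = x :=
  DirectSum.decompose_of_mem_same 𝓜 hx

theorem partProj_of_mem_ne {n l : ℕ} (hnl : l ≠ n) {x : M} (hx : x ∈ 𝓜 l) :
    partProj 𝓜 n x = 0 :=
  Subtype.ext (DirectSum.decompose_of_mem_ne 𝓜 hx hnl)

theorem finite_setOf_weight_le (ha : ∀ i, 0 < a i) (n : ℕ) :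
    {m : Fin r →₀ ℕ | Finsupp.weight a m ≤ n}.Finite := by
  refine (Finset.finite_toSet (Finset.Iic (Finsupp.equivFunOnFinite.symm fun _ : Fin r => n))).subset
    fun m hm => ?_
  simp only [Finset.coe_Iic, Set.mem_Iic]
  intro i
  have h1 : m i * a i ≤ Finsupp.weight a m := by
    rw [Finsupp.weight_apply, Finsupp.sum_fintype _ _ (by simp)]
    exact Finset.single_le_sum (f := fun i => m i • a i) (fun _ _ => Nat.zero_le _)
      (Finset.mem_univ i)
  have h2 : m i ≤ m i * a i := Nat.le_mul_of_pos_right _ (ha i)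
  simp only [Finsupp.equivFunOnFinite_symm_apply_apply]
  exact h2.trans (h1.trans hm)

variable [SetLike.GradedSMul (MvPolynomial.weightedHomogeneousSubmodule K a) 𝓜]

/-- Degrees in `M` are nonnegative, so such a monomial pushes every component above degree `n`. -/
theorem partProj_monomial_smul {n : ℕ} {m : Fin r →₀ ℕ} (hm : n < Finsupp.weight a m) (x : M) :
    partProj 𝓜 n ((MvPolynomial.monomial m (1 : K)) • x) = 0 := by
  have h (l : ℕ) (y : M) (hy : y ∈ 𝓜 l) :
      (MvPolynomial.monomial m (1 : K)) • y ∈ 𝓜 (Finsupp.weight a m + l) :=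
    SetLike.GradedSMul.smul_mem (A := MvPolynomial.weightedHomogeneousSubmodule K a)
      (MvPolynomial.isWeightedHomogeneous_monomial a m 1 rfl) hy
  induction x using DirectSum.Decomposition.inductionOn 𝓜 with
  | zero => simp
  | homogeneous y => exact partProj_of_mem_ne (by omega) (h _ _ y.2)
  | add x y hx hy => rw [smul_add, map_add, hx, hy, add_zero]

variable (a 𝓜) in
/-- The graded parts of a finitely generated module are finite-dimensional. -/
theorem finite_part [IsScalarTower K (MvPolynomial (Fin r) K) M]
    [Module.Finite (MvPolynomial (Fin r) K) M] (ha : ∀ i, 0 < a i) (n : ℕ) :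
    Module.Finite K (𝓜 n) := by
  obtain ⟨s, hs⟩ := Module.Finite.fg_top (R := MvPolynomial (Fin r) K) (M := M)
  -- The generators need not be homogeneous; the degree `n` components of their multiples by the
  -- finitely many monomials of weight at most `n` suffice.
  let T : Set (𝓜 n) := (fun q : (Fin r →₀ ℕ) × M =>
    partProj 𝓜 n ((MvPolynomial.monomial q.1 (1 : K)) • q.2)) ''
      ({m | Finsupp.weight a m ≤ n} ×ˢ (s : Set M))
  have hT : T.Finite := ((finite_setOf_weight_le ha n).prod s.finite_toSet).image _
  -- All monomials `m` are kept in the claim so that the scalar step of the induction can absorb a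
  -- monomial into `m`.
  have key (x : M) : ∀ m : Fin r →₀ ℕ, partProj 𝓜 n ((MvPolynomial.monomial m (1 : K)) • x) ∈
      Submodule.span K T := by
    have hx : x ∈ Submodule.span (MvPolynomial (Fin r) K) (s : Set M) := hs ▸ trivial
    induction hx using Submodule.span_induction with
    | mem x hx =>
      intro m
      by_cases hm : Finsupp.weight a m ≤ n
      · exact Submodule.subset_span ⟨(m, x), ⟨hm, hx⟩, rfl⟩
      · rw [partProj_monomial_smul (not_le.mp hm)]
        exact zero_mem _
    | zero => simp
    | add x y _ _ hx hy =>
      intro m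
      rw [smul_add, map_add]
      exact add_mem (hx m) (hy m)
    | smul c x _ hx =>
      intro m
      induction c using MvPolynomial.induction_on' with
      | monomial m' c =>
        have : MvPolynomial.monomial m (1 : K) • MvPolynomial.monomial m' c • x =
            c • MvPolynomial.monomial (m + m') (1 : K) • x := by
          rw [smul_smul, MvPolynomial.monomial_mul, one_mul, ← smul_assoc,
            MvPolynomial.smul_monomial, smul_eq_mul, mul_one]
        rw [this, map_smul]
        exact Submodule.smul_mem _ _ (hx _)
      | add p q hp hq =>
        rw [add_smul, smul_add, map_add]
        exact add_mem hp hq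
  refine Module.Finite.of_fg_top ⟨hT.toFinset, ?_⟩
  rw [Set.Finite.coe_toFinset, eq_top_iff]
  rintro x -
  have := key x 0
  rw [MvPolynomial.monomial_zero', map_one, one_smul] at this
  convert this
  exact Subtype.ext (partProj_of_mem x.2).symm

end Parts

/-! ### Comparison of the homology with `M` and with `Tor` -/

namespace GradedFreeResolution

variable {K : Type u} [Field K] {r : ℕ} {a : Fin r → ℕ} {M : Type u} [AddCommGroup M] [Module K M]
  [Module (MvPolynomial (Fin r) K) M] {𝓜 : ℕ → Submodule K M} (F : GradedFreeResolution a 𝓜)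

section Augmentation

variable [SetLike.GradedSMul (MvPolynomial.weightedHomogeneousSubmodule K a) 𝓜]

theorem ε_mem_part {j : ℕ} {z : F.ι 0 →₀ MvPolynomial (Fin r) K}
    (hz : z ∈ freePart K a (F.deg 0) j) : F.ε z ∈ 𝓜 j :=
  map_mem a 𝓜 (fun _ _ _ _ hx hy => SetLike.GradedSMul.smul_mem hx hy) (F.deg 0) F.ε F.ε_mem j z hz

variable [DirectSum.Decomposition 𝓜]

theorem partProj_ε (j : ℕ) (z : F.ι 0 →₀ MvPolynomial (Fin r) K) :
    (partProj 𝓜 j (F.ε z) : M) = F.ε (degComp a (F.deg 0) j z) := by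
  refine Submodule.iSup_induction (freePart K a (F.deg 0))
    (motive := fun z => (partProj 𝓜 j (F.ε z) : M) = F.ε (degComp a (F.deg 0) j z))
    (mem_iSup_freePart a (F.deg 0) z) (fun l f hf => ?_) (by simp) (fun f g hf hg => ?_)
  · by_cases hl : l = j
    · subst hl
      rw [degComp_of_mem a hf, partProj_of_mem (F.ε_mem_part hf)]
    · rw [degComp_of_mem_ne a hl hf, partProj_of_mem_ne hl (F.ε_mem_part hf), map_zero]
      rfl
  · rw [map_add, map_add, map_add, map_add, ← hf, ← hg]
    rfl

variable [IsScalarTower K (MvPolynomial (Fin r) K) M]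

/-- With no variable killed, the homology at `F_0` is the cokernel of `F_1 → F_0`, which the
augmentation identifies with `M` degree by degree. -/
theorem nonempty_relTor_zero_equiv (j : ℕ) :
    Nonempty (F.RelTor 0 0 (freePart K a (F.deg 0) j) ≃ₗ[K] 𝓜 j) := by
  have hZ : ∀ z ∈ (relCycles 0 (F.dOut 0)).restrictScalars K ⊓ freePart K a (F.deg 0) j,
      F.ε.restrictScalars K z ∈ 𝓜 j := fun z hz => F.ε_mem_part (Submodule.mem_inf.mp hz).2
  have hB : ∀ z ∈ (relCycles 0 (F.dOut 0)).restrictScalars K ⊓ freePart K a (F.deg 0) j,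
      z ∈ (relBoundaries 0 (F.d 0)).restrictScalars K →
        F.ε.restrictScalars K z ∈ (⊥ : Submodule K M) := by
    intro z _ hz
    obtain ⟨u, v, hv, rfl⟩ := mem_relBoundaries.mp hz
    rw [varSub_zero, Submodule.mem_bot] at hv
    rw [hv, add_zero]
    exact F.exact_zero.apply_apply_eq_zero u
  have h := Subquotient.map_bijective hZ hB (fun z _ hz => ?_) (fun x hx => ?_)
  · refine ⟨(LinearEquiv.ofBijective _ h).trans (Submodule.quotEquivOfEqBot _ ?_)⟩
    rw [Submodule.eq_bot_iff]
    exact fun x hx => Subtype.ext hx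
  · obtain ⟨u, hu⟩ := (F.exact_zero z).mp hz
    exact mem_relBoundaries.mpr ⟨u, 0, zero_mem _, by simp [hu]⟩
  · obtain ⟨z, rfl⟩ := F.ε_surjective x
    refine ⟨degComp a (F.deg 0) j z, Submodule.mem_inf.mpr ⟨?_, degComp_mem _ _ _ _⟩, ?_⟩
    · exact zero_mem (varSub K r (F.ιOut 0) 0)
    · exact (F.partProj_ε j z).symm.trans (partProj_of_mem hx)

end Augmentation

/-! ### Comparison with the complex of constant coefficients -/

/-- The reduction of a free module modulo the variables. -/
def redK {ι : Type u} : (ι →₀ MvPolynomial (Fin r) K) →ₗ[K] (ι →₀ K) :=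
  Finsupp.mapRange.linearMap (MvPolynomial.lcoeff K 0)

theorem redK_apply {ι : Type u} (f : ι →₀ MvPolynomial (Fin r) K) (i : ι) :
    redK f i = MvPolynomial.constantCoeff (f i) := rfl

theorem mem_varSub_iff_redK {ι : Type u} {f : ι →₀ MvPolynomial (Fin r) K} :
    f ∈ varSub K r ι r ↔ redK f = 0 := by
  rw [mem_varSub]
  constructor
  · intro h
    ext i
    rw [redK_apply, MvPolynomial.constantCoeff_eq, Finsupp.zero_apply]
    by_contra h1
    obtain ⟨l, -, hl⟩ := h i 0 h1
    simp at hl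
  · intro h i m hm
    by_contra! h1
    have : m = 0 := by
      ext l
      exact h1 l l.2
    subst this
    exact hm (DFunLike.congr_fun h i)

theorem redK_smul {ι : Type u} (p : MvPolynomial (Fin r) K) (f : ι →₀ MvPolynomial (Fin r) K) :
    redK (p • f) = MvPolynomial.constantCoeff p • redK f := by
  ext i
  simp [redK_apply]

theorem redK_d (n : ℕ) (f : F.ι (n + 1) →₀ MvPolynomial (Fin r) K) :
    redK (F.d n f) = F.dK n (redK f) := by
  induction f using Finsupp.induction_linear with
  | zero => simp
  | add f g hf hg => rw [map_add, map_add, map_add, map_add, hf, hg]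
  | single i p =>
    have h1 : Finsupp.single i p = p • Finsupp.single i (1 : MvPolynomial (Fin r) K) := by simp
    rw [h1, map_smul, redK_smul, redK_smul, map_smul]
    congr 1
    have h2 : redK (Finsupp.single i (1 : MvPolynomial (Fin r) K)) = Finsupp.single i 1 := by
      simp [redK, MvPolynomial.lcoeff_apply]
    rw [h2, dK, Finsupp.linearCombination_single, one_smul]
    rfl

theorem redK_mem_partK {n j : ℕ} {f : F.ι n →₀ MvPolynomial (Fin r) K}
    (hf : f ∈ freePart K a (F.deg n) j) : redK f ∈ F.partK n j := by
  rw [partK, Finsupp.mem_supported]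
  intro i hi
  have h1 : MvPolynomial.coeff 0 (f i) ≠ 0 := by
    rw [Finset.mem_coe, Finsupp.mem_support_iff] at hi
    exact hi
  simpa using hf i 0 h1

theorem exists_redK_eq {n j : ℕ} {v : F.ι n →₀ K} (hv : v ∈ F.partK n j) :
    ∃ f ∈ freePart K a (F.deg n) j, redK f = v := by
  classical
  refine ⟨Finsupp.mapRange MvPolynomial.C (map_zero _) v, fun i m hm => ?_, ?_⟩
  · rw [Finsupp.mapRange_apply, MvPolynomial.coeff_C] at hm
    have hm0 : 0 = m := by
      by_contra h
      simp [h] at hm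
    subst hm0
    rw [if_pos rfl] at hm
    have : F.deg n i = j := hv (Finsupp.mem_support_iff.mpr hm)
    simpa using this
  · ext i
    simp [redK_apply]

theorem mem_cycles_iff : ∀ {n j : ℕ} {f : F.ι n →₀ MvPolynomial (Fin r) K},
    redK f ∈ F.partK n j → (redK f ∈ F.cycles n j ↔ f ∈ relCycles r (F.dOut n))
  | 0, _, _, hf => iff_of_true hf (zero_mem (varSub K r (F.ιOut 0) r))
  | n + 1, j, f, hf => by
    have h1 : f ∈ relCycles r (F.dOut (n + 1)) ↔ redK (F.d n f) = 0 := mem_varSub_iff_redK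
    rw [h1, redK_d, cycles, Submodule.mem_inf, LinearMap.mem_ker]
    exact and_iff_right hf

theorem cycles_le_partK : ∀ n j : ℕ, F.cycles n j ≤ F.partK n j
  | 0, _ => le_rfl
  | _ + 1, _ => inf_le_left

/-- With all variables killed, `varSub K r _ r` is the kernel of `redK`, which commutes with the
differentials; constants lift homogeneous elements. -/
theorem nonempty_relTor_equiv_tor (n j : ℕ) :
    Nonempty (F.RelTor r n (freePart K a (F.deg n) j) ≃ₗ[K] F.Tor n j) := by
  have hZ : ∀ z ∈ (relCycles r (F.dOut n)).restrictScalars K ⊓ freePart K a (F.deg n) j,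
      redK z ∈ F.cycles n j := fun z hz =>
    (F.mem_cycles_iff (F.redK_mem_partK (Submodule.mem_inf.mp hz).2)).mpr (Submodule.mem_inf.mp hz).1
  have hB : ∀ z ∈ (relCycles r (F.dOut n)).restrictScalars K ⊓ freePart K a (F.deg n) j,
      z ∈ (relBoundaries r (F.d n)).restrictScalars K → redK z ∈ F.boundaries n j := by
    intro z hz hz'
    have h1 := degComp_of_mem a (Submodule.mem_inf.mp hz).2
    obtain ⟨u, v, hv, rfl⟩ := mem_relBoundaries.mp hz'
    rw [map_add, (F.isHomogeneousMap_d n).degComp_map] at h1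
    rw [← h1, map_add, mem_varSub_iff_redK.mp (degComp_mem_varSub a (F.deg n) j hv), add_zero, redK_d]
    exact ⟨_, F.redK_mem_partK (degComp_mem _ _ _ _), rfl⟩
  refine ⟨LinearEquiv.ofBijective _ (Subquotient.map_bijective hZ hB (fun z _ hz => ?_)
    (fun x hx => ?_))⟩
  · obtain ⟨y, hy, hyz⟩ := hz
    obtain ⟨u, -, rfl⟩ := F.exists_redK_eq hy
    refine mem_relBoundaries.mpr ⟨u, z - F.d n u, ?_, by abel⟩
    rw [mem_varSub_iff_redK, map_sub, redK_d, hyz, sub_self]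
  · obtain ⟨f, hf, rfl⟩ := F.exists_redK_eq (F.cycles_le_partK n j hx)
    exact ⟨f, Submodule.mem_inf.mpr ⟨(F.mem_cycles_iff (F.redK_mem_partK hf)).mp hx, hf⟩, rfl⟩

theorem finrank_tor (n j : ℕ) : Module.finrank K (F.Tor n j) = F.relBetti r n j :=
  (F.nonempty_relTor_equiv_tor n j).some.finrank_eq.symm

theorem finite_setOf_degComp_ne_zero {ι : Type u} (deg : ι → ℕ)
    (f : ι →₀ MvPolynomial (Fin r) K) : {j | degComp a deg j f ≠ 0}.Finite := by
  classical
  refine (Finset.finite_toSet (f.support.biUnion fun i => (f i).support.image fun m =>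
    Finsupp.weight a m + deg i)).subset fun j hj => ?_
  obtain ⟨i, hi⟩ := Finsupp.ne_iff.mp hj
  obtain ⟨m, hm⟩ := MvPolynomial.ne_zero_iff.mp hi
  rw [coeff_degComp] at hm
  have h1 : Finsupp.weight a m + deg i = j := by
    by_contra h
    simp [h] at hm
  rw [if_pos h1] at hm
  simp only [Finset.coe_biUnion, Finset.mem_coe, Set.mem_iUnion, Finset.mem_image]
  refine ⟨i, ?_, m, ?_, h1⟩
  · rw [Finsupp.mem_support_iff]
    rintro h
    simp [h] at hm
  · exact MvPolynomial.mem_support_iff.mpr hm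

/-- The variables act by zero on the homology modulo all of them, so finitely many `S`-generators
span it over `K`, and only the degrees of their components occur. -/
theorem finite_setOf_tor_ne [Module.Finite (MvPolynomial (Fin r) K) M] (n : ℕ) :
    {j | F.relBetti r n j ≠ 0}.Finite := by
  obtain ⟨N, ⟨s, rfl⟩, hN⟩ := F.exists_fg_relCycles r le_rfl n
  refine (s.finite_toSet.biUnion fun f _ => finite_setOf_degComp_ne_zero (a := a) (F.deg n) f).subset
    fun j hj => ?_
  by_contra h
  simp only [Finset.mem_coe, Set.mem_iUnion, not_exists] at h
  replace h : ∀ f ∈ s, degComp a (F.deg n) j f = 0 := fun f hf => by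
    by_contra h1
    exact h f hf h1
  apply hj
  have h2 : ∀ f ∈ Submodule.span (MvPolynomial (Fin r) K) (s : Set (F.ι n →₀ MvPolynomial (Fin r) K)),
      degComp a (F.deg n) j f ∈ varSub K r (F.ι n) r := by
    intro f hf
    induction hf using Submodule.span_induction with
    | mem f hf => rw [h f hf]; exact zero_mem _
    | zero => rw [map_zero]; exact zero_mem _
    | add f g _ _ hf hg => rw [map_add]; exact add_mem hf hg
    | smul p f _ hf =>
      have h3 : p • f = MvPolynomial.constantCoeff p • f +
          (p • f - MvPolynomial.constantCoeff p • f) := by abel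
      rw [h3, map_add, map_smul]
      refine add_mem ?_ (degComp_mem_varSub _ _ _ ?_)
      · rw [← algebraMap_smul (MvPolynomial (Fin r) K)]
        exact Submodule.smul_mem _ _ hf
      · rw [mem_varSub_iff_redK, map_sub, redK_smul, map_smul, sub_self]
  have h4 : Subsingleton (F.RelTor r n (freePart K a (F.deg n) j)) := by
    refine Subquotient.subsingleton fun z hz => ?_
    obtain ⟨y, hy, b, hb, rfl⟩ := Submodule.mem_sup.mp (hN (Submodule.mem_inf.mp hz).1)
    rw [← degComp_of_mem a (Submodule.mem_inf.mp hz).2, map_add]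
    exact add_mem (varSub_le_relBoundaries r (h2 y hy))
      (degComp_mem_relBoundaries (F.isHomogeneousMap_d n) j hb)
  exact Module.finrank_zero_of_subsingleton

end GradedFreeResolution

/-! ### Projective dimension of modules over polynomial rings -/

section ProjectiveDimension

open CategoryTheory TensorProduct
open scoped Polynomial

theorem hasProjectiveDimensionLT_of_surjective {R P L : Type u} [CommRing R] [AddCommGroup P]
    [Module R P] [AddCommGroup L] [Module R L] [Module.Projective R P] {f : P →ₗ[R] L}
    (hf : Function.Surjective f) (n : ℕ)
    (h : HasProjectiveDimensionLT (ModuleCat.of R L) (n + 2)) :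
    HasProjectiveDimensionLT (ModuleCat.of R (LinearMap.ker f)) (n + 1) := by
  have hS := LinearMap.shortExact_shortComplexKer hf
  have hP : Projective (ModuleCat.of R P) := (IsProjective.iff_projective P).mp inferInstance
  exact (hS.hasProjectiveDimensionLT_X₃_iff n hP).mp h

/-- Dimension shifting along a free cover, whose kernel sequence stays exact by flatness. -/
theorem hasProjectiveDimensionLE_baseChange {R A : Type u} [CommRing R] [CommRing A] [Algebra R A]
    [Module.Flat R A] (n : ℕ) (M : Type u) [AddCommGroup M] [Module R M]
    (h : HasProjectiveDimensionLE (ModuleCat.of R M) n) :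
    HasProjectiveDimensionLE (ModuleCat.of A (A ⊗[R] M)) n := by
  induction n generalizing M with
  | zero =>
    rw [← projective_iff_hasProjectiveDimensionLE_zero, ← IsProjective.iff_projective] at h ⊢
    infer_instance
  | succ n ih =>
    obtain ⟨P, _, _, _, f, hf⟩ : ∃ (P : Type u) (_ : AddCommGroup P) (_ : Module R P)
        (_ : Module.Projective R P) (f : P →ₗ[R] M), Function.Surjective f :=
      ⟨M →₀ R, inferInstance, inferInstance, inferInstance, _,
        Finsupp.linearCombination_id_surjective R M⟩
    have h1 := ih _ (hasProjectiveDimensionLT_of_surjective hf n h)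
    have hS : (ModuleCat.shortComplexOfCompEqZero ((LinearMap.ker f).subtype.baseChange A)
        (f.baseChange A) (by rw [← LinearMap.baseChange_comp, LinearMap.comp_ker_subtype,
          LinearMap.baseChange_zero])).ShortExact := by
      have hex := lTensor_exact A (f := (LinearMap.ker f).subtype) (g := f)
        (LinearMap.exact_subtype_ker_map f) hf
      refine ModuleCat.shortComplex_shortExact _ ?_ ?_ ?_
      · exact hex
      · exact Module.Flat.lTensor_preserves_injective_linearMap (M := A)
          (LinearMap.ker f).subtype (LinearMap.ker f).injective_subtype
      · exact LinearMap.lTensor_surjective A hf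
    have hP : Projective (ModuleCat.of A (A ⊗[R] P)) :=
      (IsProjective.iff_projective _).mp inferInstance
    exact (hS.hasProjectiveDimensionLT_X₃_iff n hP).mpr h1

section CharacteristicSequence

variable {R M : Type u} [CommRing R] [AddCommGroup M] [Module R M]

variable (R M) in
/-- The coefficients of an element of `R[X] ⊗ M`. -/
def tensorCoeff (x : R[X] ⊗[R] M) (n : ℕ) : M :=
  (PolynomialModule.polynomialTensorProductLEquivPolynomialModule R M x).coeff n

theorem tensorCoeff_tmul (p : R[X]) (m : M) (n : ℕ) :
    tensorCoeff R M (p ⊗ₜ m) n = p.coeff n • m := by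
  have : PolynomialModule.polynomialTensorProductLEquivPolynomialModule R M (p ⊗ₜ m) =
    p • PolynomialModule.single R 0 m := LinearMap.liftBaseChange_tmul _ _ _ _
  rw [tensorCoeff, this, PolynomialModule.smul_single_apply]
  simp

theorem tensorCoeff_add (x y : R[X] ⊗[R] M) (n : ℕ) :
    tensorCoeff R M (x + y) n = tensorCoeff R M x n + tensorCoeff R M y n := by
  simp [tensorCoeff]

variable [Module R[X] M] [IsScalarTower R R[X] M]

variable (R M) in
/-- The difference of the two actions of the variable on `R[X] ⊗ M`. -/
def varDiff : R[X] ⊗[R] M →ₗ[R[X]] R[X] ⊗[R] M :=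
  (Polynomial.X : R[X]) • LinearMap.id -
    ((LinearMap.lsmul R[X] M Polynomial.X).restrictScalars R).baseChange R[X]

variable (R M) in
/-- The action map `R[X] ⊗ M → M`. -/
def actionMap : R[X] ⊗[R] M →ₗ[R[X]] M :=
  LinearMap.liftBaseChange R[X] (LinearMap.id : M →ₗ[R] M)

theorem varDiff_tmul (p : R[X]) (m : M) :
    varDiff R M (p ⊗ₜ m) = (Polynomial.X * p) ⊗ₜ m - p ⊗ₜ ((Polynomial.X : R[X]) • m) := by
  simp [varDiff, TensorProduct.smul_tmul']

theorem actionMap_tmul (p : R[X]) (m : M) : actionMap R M (p ⊗ₜ m) = p • m := by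
  simp [actionMap]

theorem actionMap_varDiff (x : R[X] ⊗[R] M) : actionMap R M (varDiff R M x) = 0 := by
  induction x with
  | zero => simp
  | add x y hx hy => rw [map_add, map_add, hx, hy, add_zero]
  | tmul p m => rw [varDiff_tmul, map_sub, actionMap_tmul, actionMap_tmul, smul_smul, mul_comm,
      sub_self]

/-- Modulo the range of `varDiff`, a factor `X` may be moved across the tensor sign, so `p ⊗ m`
becomes `1 ⊗ p m`. -/
theorem sub_one_tmul_actionMap_mem (x : R[X] ⊗[R] M) :
    x - 1 ⊗ₜ actionMap R M x ∈ LinearMap.range (varDiff R M) := by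
  induction x with
  | zero => simp
  | add x y hx hy =>
    rw [map_add, tmul_add, add_sub_add_comm]
    exact add_mem hx hy
  | tmul p m =>
    rw [actionMap_tmul]
    induction p using Polynomial.induction_on' with
    | add p q hp hq =>
      rw [add_tmul, add_smul, tmul_add, add_sub_add_comm]
      exact add_mem hp hq
    | monomial n c =>
      induction n generalizing m with
      | zero =>
        rw [Polynomial.monomial_zero_left, ← Polynomial.algebraMap_eq, algebraMap_smul,
          Algebra.algebraMap_eq_smul_one, TensorProduct.smul_tmul, sub_self]
        exact zero_mem _
      | succ n ih =>
        have h1 := add_mem (LinearMap.mem_range_self (varDiff R M) (Polynomial.monomial n c ⊗ₜ m))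
          (ih ((Polynomial.X : R[X]) • m))
        rw [varDiff_tmul, smul_smul, Polynomial.X_mul_monomial, Polynomial.monomial_mul_X] at h1
        simpa using h1

theorem exact_varDiff_actionMap : Function.Exact (varDiff R M) (actionMap R M) := by
  intro x
  constructor
  · intro hx
    simpa [hx] using sub_one_tmul_actionMap_mem x
  · rintro ⟨y, rfl⟩
    exact actionMap_varDiff y

theorem actionMap_surjective : Function.Surjective (actionMap R M) :=
  fun m => ⟨1 ⊗ₜ m, by rw [actionMap_tmul, one_smul]⟩

theorem tensorCoeff_varDiff (x : R[X] ⊗[R] M) (n : ℕ) :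
    tensorCoeff R M (varDiff R M x) (n + 1) =
      tensorCoeff R M x n - (Polynomial.X : R[X]) • tensorCoeff R M x (n + 1) := by
  induction x with
  | zero => simp [tensorCoeff]
  | add x y hx hy =>
    rw [map_add, tensorCoeff_add, tensorCoeff_add, tensorCoeff_add, hx, hy, smul_add]
    abel
  | tmul p m =>
    have h : tensorCoeff R M (varDiff R M (p ⊗ₜ m)) (n + 1) =
        tensorCoeff R M ((Polynomial.X * p) ⊗ₜ m) (n + 1) -
          tensorCoeff R M (p ⊗ₜ ((Polynomial.X : R[X]) • m)) (n + 1) := by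
      rw [eq_sub_iff_add_eq, ← tensorCoeff_add, varDiff_tmul, sub_add_cancel]
    rw [h, tensorCoeff_tmul, tensorCoeff_tmul, tensorCoeff_tmul, tensorCoeff_tmul,
      Polynomial.coeff_X_mul, smul_comm (Polynomial.X : R[X])]

/-- For `x` in the kernel, the `n`-th coefficient is `X ^ k` times the `(n + k)`-th, which is zero
for large `k`. -/
theorem varDiff_injective : Function.Injective (varDiff R M) := by
  rw [← LinearMap.ker_eq_bot, Submodule.eq_bot_iff]
  intro x hx
  have h1 (n) : tensorCoeff R M x n = (Polynomial.X : R[X]) • tensorCoeff R M x (n + 1) := by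
    have := tensorCoeff_varDiff x n
    rw [LinearMap.mem_ker.mp hx] at this
    rw [eq_comm, ← sub_eq_zero, ← neg_eq_zero, neg_sub, ← this]
    simp [tensorCoeff]
  have h2 (k n) : tensorCoeff R M x n = (Polynomial.X : R[X]) ^ k • tensorCoeff R M x (n + k) := by
    induction k with
    | zero => simp
    | succ k ih => rw [ih, h1 (n + k), smul_smul, pow_succ, add_assoc]
  apply (PolynomialModule.polynomialTensorProductLEquivPolynomialModule R M).injective
  rw [map_zero]
  ext n
  obtain ⟨N, hN⟩ := (PolynomialModule.polynomialTensorProductLEquivPolynomialModule R M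
    x).coeff.support.exists_nat_subset_range
  have h3 : tensorCoeff R M x (n + N) = 0 := by
    by_contra h
    have := Finset.mem_range.mp (hN (Finsupp.mem_support_iff.mpr h))
    omega
  exact (h2 N n).trans (by rw [h3, smul_zero]; rfl)

end CharacteristicSequence

/-- The global dimension of a polynomial ring exceeds that of the coefficients by at most one. -/
theorem hasProjectiveDimensionLE_polynomial {R : Type u} [CommRing R] {n : ℕ}
    (h : ∀ M : ModuleCat.{u} R, HasProjectiveDimensionLE M n) (M : ModuleCat.{u} R[X]) :
    HasProjectiveDimensionLE M (n + 1) := by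
  let := Module.compHom M (algebraMap R R[X])
  have : IsScalarTower R R[X] M := IsScalarTower.of_algebraMap_smul fun _ _ => rfl
  have h1 : HasProjectiveDimensionLE (ModuleCat.of R[X] (R[X] ⊗[R] M)) n :=
    hasProjectiveDimensionLE_baseChange n M (h (ModuleCat.of R M))
  have hS : (ModuleCat.shortComplexOfCompEqZero (varDiff R M) (actionMap R M)
      (LinearMap.ext actionMap_varDiff)).ShortExact :=
    ModuleCat.shortComplex_shortExact _ exact_varDiff_actionMap varDiff_injective
      actionMap_surjective
  exact hS.hasProjectiveDimensionLT_X₃ (n + 1) h1 (hasProjectiveDimensionLT_of_ge _ (n + 1) _ (by omega))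

theorem hasProjectiveDimensionLE_of_ringEquiv {R R' : Type u} [CommRing R] [CommRing R']
    (e : R ≃+* R') {n : ℕ} (h : ∀ M : ModuleCat.{u} R, HasProjectiveDimensionLE M n)
    (M : ModuleCat.{u} R') : HasProjectiveDimensionLE M n := by
  let := Module.compHom M e.toRingHom
  have := h (ModuleCat.of R M)
  let := RingHomInvPair.of_ringEquiv e
  let := RingHomInvPair.of_ringEquiv e.symm
  let e' : ModuleCat.of R M ≃ₛₗ[RingHomClass.toRingHom e] M :=
    { AddEquiv.refl M with map_smul' := fun _ _ => rfl }
  exact ModuleCat.hasProjectiveDimensionLE_of_semiLinearEquiv e e' n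

/-- Hilbert's syzygy theorem: the global dimension of `K[x_1, …, x_r]` is at most `r`. -/
theorem hasProjectiveDimensionLE_mvPolynomial (K : Type u) [Field K] (r : ℕ)
    (M : ModuleCat.{u} (MvPolynomial (Fin r) K)) : HasProjectiveDimensionLE M r := by
  induction r with
  | zero =>
    refine hasProjectiveDimensionLE_of_ringEquiv
      (MvPolynomial.isEmptyRingEquiv K (Fin 0)).symm (fun M => ?_) M
    rw [← projective_iff_hasProjectiveDimensionLE_zero, ← IsProjective.iff_projective]
    have := Module.Free.of_divisionRing K M
    exact Module.Projective.of_free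
  | succ r ih =>
    exact hasProjectiveDimensionLE_of_ringEquiv (MvPolynomial.finSuccEquiv K r).symm.toRingEquiv
      (hasProjectiveDimensionLE_polynomial ih) M

end ProjectiveDimension

/-! ### Reduction modulo an ideal at a projective syzygy -/

section Syzygies

open CategoryTheory

variable {R : Type u} [CommRing R] {Q P L : Type u} [AddCommGroup Q] [Module R Q]
  [AddCommGroup P] [Module R P] [AddCommGroup L] [Module R L]

/-- As `q` splits, there is a projection `σ` of `P` onto the range of `d`; applying it to `d z`
shows that `d z` lies in `I` times that range, which is the image of `I Q`. -/
theorem exists_mem_smul_top_of_projective [Module.Projective R L] (I : Ideal R) {d : Q →ₗ[R] P}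
    {q : P →ₗ[R] L} (hq : Function.Surjective q) (hd : Function.Exact d q) {z : Q}
    (hz : d z ∈ I • (⊤ : Submodule R P)) : ∃ u ∈ I • (⊤ : Submodule R Q), d u = d z := by
  obtain ⟨s, hs⟩ := Module.projective_lifting_property q LinearMap.id hq
  let σ := LinearMap.id - s ∘ₗ q
  have hσ (x) : σ x ∈ LinearMap.range d := by
    apply (hd _).mp
    have := LinearMap.congr_fun hs (q x)
    simp only [LinearMap.comp_apply, LinearMap.id_apply] at this
    simp [σ, this]
  have hσd (x) : σ (d x) = d x := by
    simp [σ, hd.apply_apply_eq_zero]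
  have h1 : d z ∈ (I • (⊤ : Submodule R Q)).map d := by
    rw [Submodule.map_smul'', Submodule.map_top]
    have h2 : σ (d z) ∈ (I • (⊤ : Submodule R P)).map σ := ⟨_, hz, rfl⟩
    rw [hσd, Submodule.map_smul'', Submodule.map_top] at h2
    refine Submodule.smul_mono le_rfl ?_ h2
    rintro _ ⟨x, rfl⟩
    exact hσ x
  obtain ⟨u, hu, huz⟩ := h1
  exact ⟨u, hu, huz⟩

theorem exact_rangeRestrict {d : Q →ₗ[R] P} {e : P →ₗ[R] L} (h : Function.Exact d e) :
    Function.Exact d e.rangeRestrict := by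
  intro x
  rw [← h x]
  exact Subtype.ext_iff

theorem exists_mem_smul_top_of_projective_range (I : Ideal R) {d : Q →ₗ[R] P}
    {e : P →ₗ[R] L} (h : Function.Exact d e)
    (he : HasProjectiveDimensionLT (ModuleCat.of R (LinearMap.range e)) 1) {z : Q}
    (hz : d z ∈ I • (⊤ : Submodule R P)) : ∃ u ∈ I • (⊤ : Submodule R Q), d u = d z := by
  rw [← projective_iff_hasProjectiveDimensionLT_one, ← IsProjective.iff_projective] at he
  exact exists_mem_smul_top_of_projective I (LinearMap.surjective_rangeRestrict e)
    (exact_rangeRestrict h) hz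

theorem hasProjectiveDimensionLT_range_of_surjective [Module.Projective R P] {d : Q →ₗ[R] P}
    {q : P →ₗ[R] L} (hq : Function.Surjective q) (hd : Function.Exact d q) (m : ℕ)
    (h : HasProjectiveDimensionLT (ModuleCat.of R L) (m + 2)) :
    HasProjectiveDimensionLT (ModuleCat.of R (LinearMap.range d)) (m + 1) := by
  have h1 := hasProjectiveDimensionLT_of_surjective hq m h
  exact hasProjectiveDimensionLT_of_iso
    (LinearEquiv.ofEq _ _ (LinearMap.exact_iff.mp hd)).toModuleIso _

theorem hasProjectiveDimensionLT_range_of_exact [Module.Projective R P] {d : Q →ₗ[R] P}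
    {e : P →ₗ[R] L} (hd : Function.Exact d e) (m : ℕ)
    (h : HasProjectiveDimensionLT (ModuleCat.of R (LinearMap.range e)) (m + 2)) :
    HasProjectiveDimensionLT (ModuleCat.of R (LinearMap.range d)) (m + 1) :=
  hasProjectiveDimensionLT_range_of_surjective (LinearMap.surjective_rangeRestrict e)
    (exact_rangeRestrict hd) m h

end Syzygies

/-! ### Vanishing of Betti numbers beyond the projective dimension -/

namespace GradedFreeResolution

open CategoryTheory

variable {K : Type u} [Field K] {r : ℕ} {a : Fin r → ℕ} {M : Type u} [AddCommGroup M] [Module K M]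
  [Module (MvPolynomial (Fin r) K) M] {𝓜 : ℕ → Submodule K M} (F : GradedFreeResolution a 𝓜)

/-- The homology modulo the variables vanishes above a projective syzygy. -/
theorem relCycles_le_of_forall_exists (n : ℕ)
    (h : ∀ z, F.d n z ∈ varSub K r (F.ι n) r → ∃ u ∈ varSub K r (F.ι (n + 1)) r,
      F.d n u = F.d n z) :
    relCycles r (F.dOut (n + 1)) ≤ relBoundaries r (F.d (n + 1)) := by
  intro z hz
  obtain ⟨u, hu, huz⟩ := h z hz
  obtain ⟨v, hv⟩ := (F.exact_succ n (z - u)).mp (by rw [map_sub, huz, sub_self])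
  exact mem_relBoundaries.mpr ⟨v, u, hu, by rw [hv, sub_add_cancel]⟩

/-- The range of `d n` is the syzygy number `n + 1`, and each syzygy lowers a bound on the
projective dimension by one. -/
theorem hasProjectiveDimensionLT_syzygy (n m : ℕ)
    (h : HasProjectiveDimensionLT (ModuleCat.of (MvPolynomial (Fin r) K) M) (n + m + 2)) :
    HasProjectiveDimensionLT
      (ModuleCat.of (MvPolynomial (Fin r) K) (LinearMap.range (F.d n))) (m + 1) := by
  induction n generalizing m with
  | zero =>
    rw [zero_add] at h
    exact hasProjectiveDimensionLT_range_of_surjective F.ε_surjective F.exact_zero m h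
  | succ n ih =>
    refine hasProjectiveDimensionLT_range_of_exact (F.exact_succ n) m (ih (m + 1) ?_)
    convert h using 1
    omega

/-- Betti numbers vanish beyond the projective dimension. -/
theorem relBetti_eq_zero_of_projectiveDimension {p n : ℕ} (hpn : p < n)
    (h : HasProjectiveDimensionLE (ModuleCat.of (MvPolynomial (Fin r) K) M) p) (j : ℕ) :
    F.relBetti r n j = 0 := by
  have key : relCycles r (F.dOut n) ≤ relBoundaries r (F.d n) := by
    match n, hpn with
    -- For `n = 1` the projective module is `M` itself; afterwards it is the range of an earlier
    -- differential.
    | 1, hpn =>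
      have hp : p = 0 := by omega
      subst hp
      rw [← projective_iff_hasProjectiveDimensionLE_zero, ← IsProjective.iff_projective] at h
      exact F.relCycles_le_of_forall_exists 0 fun z hz =>
        exists_mem_smul_top_of_projective (varIdeal K r r) F.ε_surjective F.exact_zero hz
    | n + 2, hpn =>
      have h1 := F.hasProjectiveDimensionLT_syzygy n 0
        (hasProjectiveDimensionLT_of_ge _ (p + 1) _ (by omega))
      exact F.relCycles_le_of_forall_exists (n + 1) fun z hz =>
        exists_mem_smul_top_of_projective_range (varIdeal K r r) (F.exact_succ n) h1 hz
  have h4 : Subsingleton (F.RelTor r n (freePart K a (F.deg n) j)) :=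
    Subquotient.subsingleton fun z hz => key (Submodule.mem_inf.mp hz).1
  exact Module.finrank_zero_of_subsingleton

end GradedFreeResolution

/-! ### Betti numbers and the Hilbert series -/

section Summary

open CategoryTheory

variable {K : Type u} [Field K] {r : ℕ} {a : Fin r → ℕ}
    {M : Type u} [AddCommGroup M] [Module (MvPolynomial (Fin r) K) M]

variable (K r M) in
theorem projectiveDimension_ne_top :
    projectiveDimension (ModuleCat.of (MvPolynomial (Fin r) K) M) ≠ ⊤ :=
  (projectiveDimension_ne_top_iff _).mpr ⟨r, hasProjectiveDimensionLE_mvPolynomial K r _⟩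

variable (K r M) in
theorem hasProjectiveDimensionLE_projDim :
    HasProjectiveDimensionLE (ModuleCat.of (MvPolynomial (Fin r) K) M)
      (projDim (MvPolynomial (Fin r) K) M) := by
  rw [← projectiveDimension_le_iff, projDim]
  have h := projectiveDimension_ne_top K r M
  generalize projectiveDimension (ModuleCat.of (MvPolynomial (Fin r) K) M) = d at h
  induction d with
  | bot => exact bot_le
  | coe d =>
    have hd : d ≠ ⊤ := fun h' => h (by rw [h']; rfl)
    lift d to ℕ using hd
    simp

variable [Module K M] (𝓜 : ℕ → Submodule K M) [DirectSum.Decomposition 𝓜]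
    [SetLike.GradedSMul (MvPolynomial.weightedHomogeneousSubmodule K a) 𝓜]

theorem gradedBetti_eq_relBetti (i j : ℕ) :
    gradedBetti a 𝓜 i j = (standardResolution a 𝓜).relBetti r i j :=
  (standardResolution a 𝓜).finrank_tor i j

theorem gradedBetti_eq_zero {i : ℕ} (hi : projDim (MvPolynomial (Fin r) K) M < i) (j : ℕ) :
    gradedBetti a 𝓜 i j = 0 := by
  rw [gradedBetti_eq_relBetti]
  exact (standardResolution a 𝓜).relBetti_eq_zero_of_projectiveDimension hi
    (hasProjectiveDimensionLE_projDim K r M) j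

/-- The alternating sum of the graded Betti numbers. -/
def eulerBetti (a : Fin r → ℕ) (𝓜 : ℕ → Submodule K M) [DirectSum.Decomposition 𝓜]
    [SetLike.GradedSMul (MvPolynomial.weightedHomogeneousSubmodule K a) 𝓜] (j : ℕ) : ℤ :=
  ∑ i ∈ Finset.range (projDim (MvPolynomial (Fin r) K) M + 1), (-1) ^ i * (gradedBetti a 𝓜 i j : ℤ)

theorem eulerBetti_eq_sum {N : ℕ} (hN : projDim (MvPolynomial (Fin r) K) M ≤ N) (j : ℕ) :
    eulerBetti a 𝓜 j = ∑ i ∈ Finset.range (N + 1), (-1) ^ i * (gradedBetti a 𝓜 i j : ℤ) := by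
  refine Finset.sum_subset (Finset.range_mono (by omega)) fun i _ hi => ?_
  rw [Finset.mem_range, not_lt] at hi
  rw [gradedBetti_eq_zero 𝓜 (by omega) j]
  simp

variable [Module.Finite (MvPolynomial (Fin r) K) M]

theorem finite_setOf_gradedBetti_ne_zero (i : ℕ) : {j | gradedBetti a 𝓜 i j ≠ 0}.Finite := by
  simp_rw [gradedBetti_eq_relBetti]
  exact (standardResolution a 𝓜).finite_setOf_tor_ne i

variable [IsScalarTower K (MvPolynomial (Fin r) K) M]

theorem finite_relTor_zero (ha : ∀ i, 0 < a i) (j : ℕ) :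
    Module.Finite K ((standardResolution a 𝓜).RelTor 0 0
      (freePart K a ((standardResolution a 𝓜).deg 0) j)) :=
  have := finite_part a 𝓜 ha j
  Module.Finite.equiv ((standardResolution a 𝓜).nonempty_relTor_zero_equiv j).some.symm

theorem finite_tor (ha : ∀ i, 0 < a i) (i j : ℕ) :
    Module.Finite K ((standardResolution a 𝓜).Tor i j) :=
  have := ((standardResolution a 𝓜).relTor_induction (finite_relTor_zero 𝓜 ha) r le_rfl).1 i j
  Module.Finite.equiv ((standardResolution a 𝓜).nonempty_relTor_equiv_tor i j).some

/-- The Hilbert series of `M` is determined by its graded Betti numbers. -/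
theorem prod_mul_hilbertSeries (ha : ∀ i, 0 < a i) :
    (∏ i, (1 - PowerSeries.X ^ a i)) * PowerSeries.mk (fun n => (hilbertFunction 𝓜 n : ℤ)) =
      PowerSeries.mk (eulerBetti a 𝓜) := by
  set F := standardResolution a 𝓜
  -- `N ≥ r` makes all `r` recursion steps valid; `N ≥ projDim` makes the truncated sum equal to
  -- `eulerBetti`.
  set N := max r (projDim (MvPolynomial (Fin r) K) M)
  have h0 := finite_relTor_zero (a := a) 𝓜 ha
  have h1 : F.eulerSeries 0 N = PowerSeries.mk (fun n => (hilbertFunction 𝓜 n : ℤ)) := by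
    ext j
    rw [F.coeff_eulerSeries_zero h0, PowerSeries.coeff_mk]
    exact congrArg _ (F.nonempty_relTor_zero_equiv j).some.finrank_eq
  have h2 : F.eulerSeries r N = PowerSeries.mk (eulerBetti a 𝓜) := by
    ext j
    rw [GradedFreeResolution.eulerSeries, PowerSeries.coeff_mk, PowerSeries.coeff_mk,
      eulerBetti_eq_sum 𝓜 (le_max_right _ _ : _ ≤ N)]
    simp_rw [gradedBetti_eq_relBetti]
    rfl
  rw [← h1, ← h2, F.eulerSeries_eq h0 (le_max_left _ _)]

end Summary

/-! ### Asymptotic expansions at zero -/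

section Expansion

open Asymptotics

/-- `G t` has the asymptotic expansion `∑ k, (coeff k q) t ^ k` as `t` tends to `0` from above. -/
def HasExpansion (G : ℝ → ℂ) (q : PowerSeries ℂ) : Prop :=
  ∀ N, (fun t : ℝ => G t - (PowerSeries.trunc N q).eval (t : ℂ)) =O[𝓝[>] 0] fun t : ℝ => t ^ N

theorem isBigO_one_of_continuous {P : ℝ → ℂ} (hP : Continuous P) :
    P =O[𝓝[>] 0] fun _ : ℝ => (1 : ℝ) :=
  ((hP.tendsto 0).mono_left nhdsWithin_le_nhds).isBigO_one ℝ

theorem isBigO_one_polynomial (P : Polynomial ℂ) :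
    (fun t : ℝ => P.eval (t : ℂ)) =O[𝓝[>] 0] fun _ : ℝ => (1 : ℝ) :=
  isBigO_one_of_continuous (P.continuous.comp Complex.continuous_ofReal)

theorem isBigO_pow_polynomial {P : Polynomial ℂ} {N : ℕ} (h : ∀ k < N, P.coeff k = 0) :
    (fun t : ℝ => P.eval (t : ℂ)) =O[𝓝[>] 0] fun t : ℝ => t ^ N := by
  obtain ⟨Q, rfl⟩ := Polynomial.X_pow_dvd_iff.mpr h
  have h1 : (fun t : ℝ => ((t : ℂ)) ^ N) =O[𝓝[>] 0] fun t : ℝ => t ^ N :=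
    IsBigO.of_norm_right (.of_bound 1 (.of_forall fun t => by simp))
  simpa using h1.mul (isBigO_one_polynomial Q)

variable {G G₁ G₂ : ℝ → ℂ} {p q : PowerSeries ℂ}

theorem HasExpansion.isBigO_one (h : HasExpansion G q) : G =O[𝓝[>] 0] fun _ : ℝ => (1 : ℝ) := by
  have h0 := h 0
  simp only [pow_zero] at h0
  simpa using h0.add (isBigO_one_polynomial (PowerSeries.trunc 0 q))

theorem HasExpansion.congr' (h : HasExpansion G₁ q) (hG : G₁ =ᶠ[𝓝[>] 0] G₂) :
    HasExpansion G₂ q := fun N =>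
  (h N).congr' (hG.mono fun t ht => by simp only [ht]) EventuallyEq.rfl

theorem hasExpansion_polynomial (P : Polynomial ℂ) :
    HasExpansion (fun t => P.eval (t : ℂ)) P := by
  intro N
  have h : ∀ k < N, (P - PowerSeries.trunc N (P : PowerSeries ℂ)).coeff k = 0 := by
    intro k hk
    simp [PowerSeries.coeff_trunc, hk]
  simpa using isBigO_pow_polynomial h

theorem HasExpansion.add (h₁ : HasExpansion G₁ p) (h₂ : HasExpansion G₂ q) :
    HasExpansion (fun t => G₁ t + G₂ t) (p + q) := fun N =>
  ((h₁ N).add (h₂ N)).congr_left fun t => by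
    rw [map_add, Polynomial.eval_add]
    ring

/-- With `p_N` and `q_N` the truncations, the error is `(G₁ - p_N) G₂ + p_N (G₂ - q_N)` plus the
polynomial `p_N q_N - (p q)_N`, which is divisible by `t ^ N`. -/
theorem HasExpansion.mul (h₁ : HasExpansion G₁ p) (h₂ : HasExpansion G₂ q) :
    HasExpansion (fun t => G₁ t * G₂ t) (p * q) := by
  intro N
  have e1 := (h₁ N).mul h₂.isBigO_one
  have e2 := (isBigO_one_polynomial (PowerSeries.trunc N p)).mul (h₂ N)
  have h3 : ∀ k < N, (PowerSeries.trunc N p * PowerSeries.trunc N q -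
      PowerSeries.trunc N (p * q)).coeff k = 0 := by
    intro k hk
    rw [Polynomial.coeff_sub, PowerSeries.coeff_trunc, if_pos hk,
      PowerSeries.coeff_mul_eq_coeff_trunc_mul_trunc₂ p q hk hk, ← Polynomial.coe_mul,
      Polynomial.coeff_coe, sub_self]
  have e3 := isBigO_pow_polynomial h3
  simp only [mul_one, one_mul] at e1 e2
  refine ((e1.add e2).add e3).congr_left fun t => ?_
  rw [Polynomial.eval_sub, Polynomial.eval_mul]
  ring

theorem hasExpansion_const (c : ℂ) : HasExpansion (fun _ => c) (PowerSeries.C c) := by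
  simpa using hasExpansion_polynomial (Polynomial.C c)

theorem HasExpansion.sum {ι : Type*} {s : Finset ι} {G : ι → ℝ → ℂ} {q : ι → PowerSeries ℂ}
    (h : ∀ i ∈ s, HasExpansion (G i) (q i)) :
    HasExpansion (fun t => ∑ i ∈ s, G i t) (∑ i ∈ s, q i) := by
  classical
  induction s using Finset.induction_on with
  | empty => simpa using hasExpansion_const 0
  | insert i s hi ih =>
    simp only [Finset.sum_insert hi]
    exact (h i (Finset.mem_insert_self _ _)).add
      (ih fun j hj => h j (Finset.mem_insert_of_mem hj))

theorem HasExpansion.prod {ι : Type*} {s : Finset ι} {G : ι → ℝ → ℂ} {q : ι → PowerSeries ℂ}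
    (h : ∀ i ∈ s, HasExpansion (G i) (q i)) :
    HasExpansion (fun t => ∏ i ∈ s, G i t) (∏ i ∈ s, q i) := by
  classical
  induction s using Finset.induction_on with
  | empty => simpa using hasExpansion_const 1
  | insert i s hi ih =>
    simp only [Finset.prod_insert hi]
    exact (h i (Finset.mem_insert_self _ _)).mul
      (ih fun j hj => h j (Finset.mem_insert_of_mem hj))

theorem HasExpansion.tendsto (h : HasExpansion G p) :
    Tendsto G (𝓝[>] 0) (𝓝 (PowerSeries.constantCoeff p)) := by
  have h1 := (h 1).trans_tendsto (by
    simp only [pow_one]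
    exact tendsto_id.mono_left nhdsWithin_le_nhds)
  have h2 : ∀ t : ℂ, (PowerSeries.trunc 1 p).eval t = PowerSeries.constantCoeff p := by
    intro t
    simp [PowerSeries.trunc_apply]
  simp only [h2] at h1
  simpa using h1.add_const (PowerSeries.constantCoeff p)

/-- The error is `G⁻¹ (1 - G q_N)`, where `G⁻¹` is bounded near `0` and `G q_N` agrees with `1` up
to `O(t ^ N)`. -/
theorem HasExpansion.inv (h : HasExpansion G p) (hpq : p * q = 1) :
    HasExpansion (fun t => (G t)⁻¹) q := by
  have hp : PowerSeries.constantCoeff p ≠ 0 := fun h0 => by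
    simpa [h0] using congrArg PowerSeries.constantCoeff hpq
  have h1 := (h.tendsto.inv₀ hp).isBigO_one ℝ
  have hne : ∀ᶠ t in 𝓝[>] 0, G t ≠ 0 := h.tendsto.eventually_ne hp
  intro N
  have h2 := h.mul (hasExpansion_polynomial (PowerSeries.trunc N q)) N
  rw [PowerSeries.trunc_mul_trunc, hpq] at h2
  have h3 : ∀ k < N, (1 - PowerSeries.trunc N (1 : PowerSeries ℂ)).coeff k = 0 := by
    intro k hk
    simp [PowerSeries.coeff_trunc, hk, PowerSeries.coeff_one, Polynomial.coeff_one]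
  have h4 := h1.mul ((isBigO_pow_polynomial h3).sub h2)
  simp only [one_mul] at h4
  refine h4.congr' (hne.mono fun t ht => ?_) EventuallyEq.rfl
  simp only [Polynomial.eval_sub, Polynomial.eval_one]
  field_simp
  ring

theorem HasExpansion.of_mul_X (h : HasExpansion (fun t => t * G t) (PowerSeries.X * q)) :
    HasExpansion G q := by
  intro N
  have h1 := h (N + 1)
  have h2 : (fun t : ℝ => (t : ℂ)⁻¹) =O[𝓝[>] 0] fun t : ℝ => t⁻¹ :=
    IsBigO.of_norm_right (.of_bound 1 (.of_forall fun t => by simp))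
  have h3 : PowerSeries.trunc (N + 1) (PowerSeries.X * q) =
      Polynomial.X * PowerSeries.trunc N q := by
    ext k
    cases k with
    | zero => simp [PowerSeries.coeff_trunc]
    | succ k => simp [PowerSeries.coeff_trunc, PowerSeries.coeff_succ_X_mul]
  rw [h3] at h1
  refine (h2.mul h1).congr' ?_ ?_
  · filter_upwards [self_mem_nhdsWithin] with t ht
    have : (t : ℂ) ≠ 0 := by exact_mod_cast (ne_of_gt ht)
    simp only [Polynomial.eval_mul, Polynomial.eval_X]
    field_simp
  · filter_upwards [self_mem_nhdsWithin] with t ht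
    have : t ≠ 0 := ne_of_gt ht
    field_simp
    ring

theorem hasExpansion_exp (c : ℂ) :
    HasExpansion (fun t => Complex.exp (c * t)) (PowerSeries.rescale c (PowerSeries.exp ℂ)) := by
  intro N
  have h0 : Tendsto (fun t : ℝ => c * (t : ℂ)) (𝓝[>] 0) (𝓝 0) := by
    have : Continuous fun t : ℝ => c * (t : ℂ) := by fun_prop
    simpa using (this.tendsto 0).mono_left nhdsWithin_le_nhds
  have h1 := (Complex.exp_sub_sum_range_isBigO_pow N).comp_tendsto h0
  have h2 : (fun t : ℝ => (c * (t : ℂ)) ^ N) =O[𝓝[>] 0] fun t : ℝ => t ^ N :=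
    IsBigO.of_norm_right (.of_bound (‖c‖ ^ N) (.of_forall fun t => by simp [mul_pow]))
  refine (h1.trans h2).congr_left fun t => ?_
  simp only [Function.comp_apply]
  congr 1
  rw [PowerSeries.trunc_apply, Nat.Ico_zero_eq_range, Polynomial.eval_finsetSum]
  refine Finset.sum_congr rfl fun k _ => ?_
  rw [Polynomial.eval_monomial, PowerSeries.coeff_rescale, PowerSeries.coeff_exp]
  simp only [one_div, map_inv₀, map_natCast]
  rw [mul_pow]
  ring

/-- Replacing `X` by `-X` in `(e ^ (c X) - 1) / X` gives this function; this substitution is the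
source of the sign `(-1) ^ (r - ℓ)` in the residues. -/
theorem hasExpansion_one_sub_exp_div (c : ℕ) :
    HasExpansion (fun t => (1 - Complex.exp (-c * t)) / t)
      (PowerSeries.rescale (-1) (expSubOneDivX c)) := by
  apply HasExpansion.of_mul_X
  have h1 : PowerSeries.X * PowerSeries.rescale (-1) (expSubOneDivX c) =
      PowerSeries.C 1 + PowerSeries.C (-1) * PowerSeries.rescale (-c : ℂ) (PowerSeries.exp ℂ) := by
    have h2 := congrArg (PowerSeries.rescale (-1 : ℂ)) (X_mul_expSubOneDivX (c : ℂ))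
    rw [map_mul, PowerSeries.rescale_X, map_sub, map_one, PowerSeries.rescale_rescale,
      mul_neg_one] at h2
    simp only [map_neg, map_one, neg_mul, one_mul] at h2 ⊢
    rw [← neg_neg (PowerSeries.X * _), h2]
    ring
  rw [h1]
  refine ((hasExpansion_const 1).add ((hasExpansion_const (-1)).mul
    (hasExpansion_exp (-c)))).congr' ?_
  filter_upwards [self_mem_nhdsWithin] with t ht
  have : (t : ℂ) ≠ 0 := by exact_mod_cast (ne_of_gt ht)
  field_simp
  ring

theorem hasExpansion_div_one_sub_exp {c : ℕ} (hc : 0 < c) :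
    HasExpansion (fun t => t / (1 - Complex.exp (-c * t)))
      (PowerSeries.rescale (-1) (expSubOneDivX c)⁻¹) := by
  have h := (hasExpansion_one_sub_exp_div c).inv
    (q := PowerSeries.rescale (-1) (expSubOneDivX c)⁻¹) (by
      rw [← map_mul, PowerSeries.mul_inv_cancel, map_one]
      have : (c : ℂ) ≠ 0 := by exact_mod_cast hc.ne'
      simpa [expSubOneDivX, PowerSeries.constantCoeff_mk] using this)
  simpa only [inv_div] using h

/-- The expansion of the generating function of the Bernoulli-Barnes polynomials. -/
theorem hasExpansion_bernoulliBarnes {r : ℕ} (a : Fin r → ℕ) (ha : ∀ i, 0 < a i) (x : ℂ) :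
    HasExpansion (fun t => Complex.exp (-x * t) * ∏ i, (t / (1 - Complex.exp (-a i * t))))
      (PowerSeries.rescale (-1) (bernoulliBarnesSeries a x)) := by
  rw [bernoulliBarnesSeries, map_mul, map_prod, PowerSeries.rescale_rescale, mul_neg_one]
  exact (hasExpansion_exp (-x)).mul
    (HasExpansion.prod fun i _ => hasExpansion_div_one_sub_exp (ha i))

theorem coeff_rescale_bernoulliBarnesSeries {r : ℕ} (a : Fin r → ℕ) (x : ℂ) (k : ℕ) :
    PowerSeries.coeff k (PowerSeries.rescale (-1) (bernoulliBarnesSeries a x)) =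
      (-1) ^ k / (k ! : ℂ) * bernoulliBarnes a k x := by
  have hk : (k ! : ℂ) ≠ 0 := by exact_mod_cast Nat.factorial_ne_zero k
  rw [PowerSeries.coeff_rescale, bernoulliBarnes]
  field_simp

end Expansion

/-! ### Meromorphic continuation of Mellin transforms -/

section Mellin

open Asymptotics Set MeasureTheory

/-- `F` with the leading terms of its expansion at `0` removed on the unit interval. -/
def mellinRemainder (F : ℝ → ℂ) (r : ℕ) (q : PowerSeries ℂ) (N : ℕ) (t : ℝ) : ℂ :=
  F t - ∑ k ∈ Finset.range N, PowerSeries.coeff k q *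
    indicator (Ioc 0 1) (fun t : ℝ => (t : ℂ) ^ ((k : ℂ) - r)) t

/-- The continuation of the Mellin transform of `F` to the half plane `r - N < re z`. -/
def mellinCont (F : ℝ → ℂ) (r : ℕ) (q : PowerSeries ℂ) (N : ℕ) (z : ℂ) : ℂ :=
  mellin (mellinRemainder F r q N) z +
    ∑ k ∈ Finset.range N, PowerSeries.coeff k q / (z + ((k : ℂ) - r))

variable {F : ℝ → ℂ} {r : ℕ} {q : PowerSeries ℂ} {b : ℝ}

theorem locallyIntegrableOn_mellinRemainder (hF : ContinuousOn F (Ioi 0)) (N : ℕ) :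
    LocallyIntegrableOn (mellinRemainder F r q N) (Ioi 0) := by
  have h1 (k : ℕ) : ContinuousOn (fun t : ℝ => (t : ℂ) ^ ((k : ℂ) - r)) (Ioi 0) := fun t ht =>
    (Complex.continuousAt_ofReal_cpow_const _ _ (Or.inr (ne_of_gt ht))).continuousWithinAt
  rw [locallyIntegrableOn_iff isOpen_Ioi.isLocallyClosed]
  intro s hs hsc
  refine ((hF.mono hs).integrableOn_compact hsc).sub (integrable_finsetSum _ fun k _ => ?_)
  exact ((((h1 k).mono hs).integrableOn_compact hsc).indicator measurableSet_Ioc).const_mul _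

theorem mellinRemainder_isBigO_top (hF : F =O[atTop] fun t => Real.exp (-b * t)) (N : ℕ) :
    mellinRemainder F r q N =O[atTop] fun t => Real.exp (-b * t) := by
  refine hF.congr' ?_ EventuallyEq.rfl
  filter_upwards [eventually_gt_atTop 1] with t ht
  have h : t ∉ Ioc (0 : ℝ) 1 := fun h => absurd h.2 (not_le.mpr ht)
  simp [mellinRemainder, h]

theorem mellinRemainder_isBigO_zero (hF : HasExpansion (fun t => (t : ℂ) ^ r * F t) q) (N : ℕ) :
    mellinRemainder F r q N =O[𝓝[>] 0] fun t => t ^ (-((r : ℝ) - N)) := by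
  have h2 : (fun t : ℝ => ((t : ℂ) ^ r)⁻¹) =O[𝓝[>] 0] fun t : ℝ => (t ^ r)⁻¹ :=
    IsBigO.of_norm_right (.of_bound 1 (.of_forall fun t => by simp))
  refine (h2.mul (hF N)).congr' ?_ ?_
  · filter_upwards [Ioc_mem_nhdsGT (zero_lt_one (α := ℝ))] with t ht
    have ht0 : (t : ℂ) ≠ 0 := by exact_mod_cast (ne_of_gt ht.1)
    have htr : (t : ℂ) ^ r ≠ 0 := pow_ne_zero _ ht0
    rw [mellinRemainder, PowerSeries.trunc_apply, Nat.Ico_zero_eq_range,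
      Polynomial.eval_finsetSum, mul_sub, inv_mul_cancel_left₀ htr, Finset.mul_sum]
    congr 1
    refine Finset.sum_congr rfl fun k _ => ?_
    rw [Polynomial.eval_monomial, indicator_of_mem ht, Complex.cpow_sub _ _ ht0,
      Complex.cpow_natCast, Complex.cpow_natCast]
    field_simp
  · filter_upwards [self_mem_nhdsWithin] with t ht
    have ht : 0 < t := ht
    rw [neg_sub, Real.rpow_sub ht, Real.rpow_natCast, Real.rpow_natCast, div_eq_inv_mul]

variable (hF : ContinuousOn F (Ioi 0)) (hb : 0 < b) (hF' : F =O[atTop] fun t => Real.exp (-b * t))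
  (hq : HasExpansion (fun t => (t : ℂ) ^ r * F t) q)

include hF hb hF' hq

theorem differentiableAt_mellin_mellinRemainder {N : ℕ} {z : ℂ} (hz : (r : ℝ) - N < z.re) :
    DifferentiableAt ℂ (mellin (mellinRemainder F r q N)) z :=
  mellin_differentiableAt_of_isBigO_rpow_exp hb (locallyIntegrableOn_mellinRemainder hF N)
    (mellinRemainder_isBigO_top hF' N) (mellinRemainder_isBigO_zero hq N) hz

theorem mellinConvergent_mellinRemainder {N : ℕ} {z : ℂ} (hz : (r : ℝ) - N < z.re) :
    MellinConvergent (mellinRemainder F r q N) z :=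
  mellinConvergent_of_isBigO_rpow_exp hb (locallyIntegrableOn_mellinRemainder hF N)
    (mellinRemainder_isBigO_top hF' N) (mellinRemainder_isBigO_zero hq N) hz

theorem analyticAt_mellin_mellinRemainder {N : ℕ} {z : ℂ} (hz : (r : ℝ) - N < z.re) :
    AnalyticAt ℂ (mellin (mellinRemainder F r q N)) z := by
  have h : IsOpen {z : ℂ | (r : ℝ) - N < z.re} := isOpen_lt continuous_const Complex.continuous_re
  exact DifferentiableOn.analyticAt (s := {z : ℂ | (r : ℝ) - N < z.re}) (fun w hw =>
    (differentiableAt_mellin_mellinRemainder hF hb hF' hq hw).differentiableWithinAt)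
    (h.mem_nhds hz)

/-- The Mellin transform of `t ^ (N - r)` on `(0, 1]` is `1 / (z + N - r)`, so one term moves from
the integral to the explicit sum. -/
theorem mellinCont_succ {N : ℕ} {z : ℂ} (hz : (r : ℝ) - N < z.re) :
    mellinCont F r q N z = mellinCont F r q (N + 1) z := by
  have h1 := hasMellin_cpow_Ioc ((N : ℂ) - r) (s := z) (by simp; linarith)
  have h2 := mellinConvergent_mellinRemainder hF hb hF' hq (N := N + 1) (z := z)
    (by push_cast; linarith)
  have h3 := hasMellin_add h2 (hasMellin_const_smul h1.1 (PowerSeries.coeff N q)).1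
  have h4 : (fun t => mellinRemainder F r q (N + 1) t + PowerSeries.coeff N q •
      indicator (Ioc 0 1) (fun t : ℝ => (t : ℂ) ^ ((N : ℂ) - r)) t) =
      mellinRemainder F r q N := by
    ext t
    rw [mellinRemainder, mellinRemainder, Finset.sum_range_succ, smul_eq_mul]
    ring
  have h5 := h3.2
  rw [h4, (hasMellin_const_smul h1.1 (PowerSeries.coeff N q)).2, h1.2] at h5
  rw [mellinCont, mellinCont, Finset.sum_range_succ, h5, smul_eq_mul]
  ring

theorem mellinCont_eq_of_le {N N' : ℕ} (hN : N ≤ N') {z : ℂ} (hz : (r : ℝ) - N < z.re) :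
    mellinCont F r q N z = mellinCont F r q N' z := by
  induction N', hN using Nat.le_induction with
  | base => rfl
  | succ m hm ih =>
    have : (N : ℝ) ≤ m := by exact_mod_cast hm
    rw [ih, mellinCont_succ hF hb hF' hq (by linarith)]

theorem mellinCont_eq {N N' : ℕ} {z : ℂ} (hz : (r : ℝ) - N < z.re) (hz' : (r : ℝ) - N' < z.re) :
    mellinCont F r q N z = mellinCont F r q N' z := by
  rcases le_total N N' with h | h
  · exact mellinCont_eq_of_le hF hb hF' hq h hz
  · exact (mellinCont_eq_of_le hF hb hF' hq h hz').symm

theorem meromorphicAt_mellinCont {N : ℕ} {z : ℂ} (hz : (r : ℝ) - N < z.re) :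
    MeromorphicAt (mellinCont F r q N) z := by
  refine (analyticAt_mellin_mellinRemainder hF hb hF' hq hz).meromorphicAt.add ?_
  refine MeromorphicAt.fun_sum fun k _ => ?_
  fun_prop

omit hF hb hF' hq

/-- The meromorphic continuation of the Dirichlet series whose Mellin representation is given
by `F`. -/
def dirichletCont (F : ℝ → ℂ) (r : ℕ) (q : PowerSeries ℂ) (z : ℂ) : ℂ :=
  -- The number of removed terms varies with `z` and is large enough for convergence; any other
  -- sufficient number gives the same value.
  (Complex.Gamma z)⁻¹ * mellinCont F r q (⌊(r : ℝ) - z.re⌋₊ + 1) z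

include hF hb hF' hq

theorem dirichletCont_eq {N : ℕ} {z : ℂ} (hz : (r : ℝ) - N < z.re) :
    dirichletCont F r q z = (Complex.Gamma z)⁻¹ * mellinCont F r q N z := by
  rw [dirichletCont, mellinCont_eq hF hb hF' hq (N' := N) _ hz]
  have := Nat.lt_floor_add_one ((r : ℝ) - z.re)
  push_cast
  linarith

theorem eventually_dirichletCont_eq {N : ℕ} {c : ℂ} (hc : (r : ℝ) - N < c.re) :
    ∀ᶠ z in 𝓝 c, dirichletCont F r q z = (Complex.Gamma z)⁻¹ * mellinCont F r q N z := by
  have h : IsOpen {z : ℂ | (r : ℝ) - N < z.re} := isOpen_lt continuous_const Complex.continuous_re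
  filter_upwards [h.mem_nhds hc] with z hz
  exact dirichletCont_eq hF hb hF' hq hz

theorem meromorphic_dirichletCont : Meromorphic (dirichletCont F r q) := by
  intro c
  have hc : (r : ℝ) - ((⌊(r : ℝ) - c.re⌋₊ + 1 : ℕ) : ℝ) < c.re := by
    have := Nat.lt_floor_add_one ((r : ℝ) - c.re)
    push_cast
    linarith
  have h := (Complex.differentiable_one_div_Gamma.analyticAt c).meromorphicAt.fun_mul
    (meromorphicAt_mellinCont hF hb hF' hq hc)
  refine h.congr (EventuallyEq.symm ?_)
  exact (eventually_dirichletCont_eq hF hb hF' hq hc).filter_mono nhdsWithin_le_nhds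

/-- Only the term `k = r - l` is singular at `l`, with a simple pole, and the entire function `1 /
Γ` takes the value `1 / (l - 1)!` there. -/
theorem hasResidueAt_dirichletCont {l : ℕ} (hl : 1 ≤ l) (hlr : l ≤ r) :
    HasResidueAt (dirichletCont F r q) l (PowerSeries.coeff (r - l) q / ((l - 1)! : ℂ)) := by
  set H : ℂ → ℂ := fun z => (Complex.Gamma z)⁻¹
  have hH : AnalyticAt ℂ H l := Complex.differentiable_one_div_Gamma.analyticAt l
  have hHl : H l = ((l - 1)! : ℂ)⁻¹ := by
    obtain ⟨m, rfl⟩ := Nat.exists_eq_add_of_le' hl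
    have := Complex.Gamma_nat_eq_factorial m
    simp only [H, Nat.add_sub_cancel]
    push_cast
    rw [this]
  have hN : (r : ℝ) - ((r - l + 1 : ℕ) : ℝ) < ((l : ℂ)).re := by
    rw [Complex.natCast_re]
    push_cast [Nat.cast_sub hlr]
    linarith
  have hdslope : AnalyticAt ℂ (dslope H l) l := by
    obtain ⟨s, hs⟩ := hH
    exact ⟨_, hs.has_fpower_series_dslope_fslope⟩
  -- Near `l`, `H z / (z - l) = H l / (z - l) + dslope H l z`; the second summand joins the analytic
  -- part.
  refine ⟨0, 0, fun z => PowerSeries.coeff (r - l) q * dslope H l z +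
    H z * (mellin (mellinRemainder F r q (r - l + 1)) z +
      ∑ k ∈ Finset.range (r - l), PowerSeries.coeff k q / (z + ((k : ℂ) - r))), ?_, ?_⟩
  · refine (analyticAt_const.mul hdslope).fun_add (hH.fun_mul
      ((analyticAt_mellin_mellinRemainder hF hb hF' hq hN).fun_add ?_))
    refine Finset.analyticAt_fun_sum _ fun k hk => ?_
    refine analyticAt_const.fun_div (by fun_prop) ?_
    have hk' := Finset.mem_range.mp hk
    have : (l : ℤ) + (k - r) ≠ 0 := by omega
    exact_mod_cast this
  · filter_upwards [nhdsWithin_le_nhds (eventually_dirichletCont_eq hF hb hF' hq hN),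
      self_mem_nhdsWithin] with z hz hzl
    have hzl' : z - l ≠ 0 := sub_ne_zero.mpr hzl
    have h1 : ((r - l : ℕ) : ℂ) = r - l := by push_cast [Nat.cast_sub hlr]; ring
    have h2 : z + (((r - l : ℕ) : ℂ) - r) = z - l := by rw [h1]; ring
    rw [hz, mellinCont, Finset.sum_range_succ, h2, dslope_of_ne _ hzl, slope_def_field, hHl]
    simp only [Finset.range_zero, Finset.sum_empty, add_zero]
    change H z * _ = _
    field_simp
    ring

omit hF hb hF' hq

theorem HasResidueAt.congr {f g : ℂ → ℂ} {c R : ℂ} (h : HasResidueAt f c R)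
    (hfg : ∀ᶠ z in 𝓝[≠] c, f z = g z) : HasResidueAt g c R := by
  obtain ⟨N, b, u, hu, h⟩ := h
  refine ⟨N, b, u, hu, ?_⟩
  filter_upwards [h, hfg] with z hz hz'
  rw [← hz', hz]

/-- Two meromorphic continuations of the same series agree near every point. -/
theorem IsMeromorphicContinuation.eventually_eq {f : ℕ → ℂ → ℂ} {Z Z' : ℂ → ℂ}
    (h : IsMeromorphicContinuation f Z) (h' : IsMeromorphicContinuation f Z') (c : ℂ) :
    ∀ᶠ z in 𝓝[≠] c, Z z = Z' z := by
  obtain ⟨hZ, σ, hσ⟩ := h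
  obtain ⟨hZ', σ', hσ'⟩ := h'
  have hm : Meromorphic (Z - Z') := hZ.sub hZ'
  have htop : meromorphicOrderAt (Z - Z') c = ⊤ := by
    by_contra hne
    -- Finite order at one point would force finite order everywhere, contradicted at a point of the
    -- common half plane of convergence.
    have h1 := hm.exists_meromorphicOrderAt_ne_top_iff_forall.mp ⟨c, hne⟩
      ((max σ σ' + 1 : ℝ) : ℂ)
    apply h1
    rw [meromorphicOrderAt_eq_top_iff]
    have hopen : IsOpen {z : ℂ | max σ σ' < z.re} := isOpen_lt continuous_const Complex.continuous_re
    refine nhdsWithin_le_nhds ?_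
    filter_upwards [hopen.mem_nhds (show max σ σ' < (((max σ σ' + 1 : ℝ) : ℂ)).re by simp)] with z hz
    have hz : max σ σ' < z.re := hz
    rw [Pi.sub_apply, (hσ z ((le_max_left _ _).trans_lt hz)).unique
      (hσ' z ((le_max_right _ _).trans_lt hz)), sub_self]
  rw [meromorphicOrderAt_eq_top_iff] at htop
  filter_upwards [htop] with z hz
  exact sub_eq_zero.mp hz

/-- Meromorphic continuation and residues of a Dirichlet series from the expansion at `0` of
the corresponding exponential series. -/
theorem isMeromorphicContinuation_dirichletCont {h : ℕ → ℂ} {p : ℕ → ℝ}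
    (hF : ContinuousOn F (Ioi 0)) (hb : 0 < b) (hF' : F =O[atTop] fun t => Real.exp (-b * t))
    (hq : HasExpansion (fun t => (t : ℂ) ^ r * F t) q)
    (hp : ∀ n, 0 < p n) (hsum : ∀ t > 0, HasSum (fun n => h n * Real.exp (-p n * t)) (F t))
    {σ : ℝ} (hσ : ∀ s > σ, Summable fun n => ‖h n‖ / p n ^ s) :
    IsMeromorphicContinuation (fun n z => h n / (p n : ℂ) ^ z) (dirichletCont F r q) := by
  refine ⟨meromorphic_dirichletCont hF hb hF' hq, max σ r, fun z hz => ?_⟩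
  have hzσ : σ < z.re := (le_max_left _ _).trans_lt hz
  have hzr : (r : ℝ) < z.re := (le_max_right _ _).trans_lt hz
  have hz0 : 0 < z.re := lt_of_le_of_lt (Nat.cast_nonneg r) hzr
  have h1 := hasSum_mellin (fun n => Or.inr (hp n)) hz0 hsum (hσ _ hzσ)
  have h2 := h1.mul_left (Complex.Gamma z)⁻¹
  have h3 : mellinCont F r q 0 z = mellin F z := by
    rw [mellinCont]
    have : mellinRemainder F r q 0 = F := by
      ext t
      simp [mellinRemainder]
    rw [this]
    simp
  rw [dirichletCont_eq hF hb hF' hq (N := 0) (by simpa using hzr), h3]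
  refine h2.congr_fun fun n => ?_
  rw [mul_div_assoc, inv_mul_cancel_left₀ (Complex.Gamma_ne_zero_of_re_pos hz0)]

end Mellin

/-! ### Power series with polynomially bounded coefficients -/

section Growth

open PowerSeries Asymptotics

/-- The recursion `f_n = g_n + f_(n - c)` costs one power of `n`, because `(n + 1) ^ k + (n + 1) ^ k
* n = (n + 1) ^ (k + 1)`. -/
theorem exists_norm_coeff_le_of_one_sub_X_pow_mul {c : ℕ} (hc : 0 < c) {f : ℂ⟦X⟧} {k : ℕ}
    (h : ∃ C : ℝ, 0 ≤ C ∧ ∀ n, ‖coeff n ((1 - X ^ c) * f)‖ ≤ C * ((n : ℝ) + 1) ^ k) :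
    ∃ C : ℝ, 0 ≤ C ∧ ∀ n, ‖coeff n f‖ ≤ C * ((n : ℝ) + 1) ^ (k + 1) := by
  obtain ⟨C, hC, h⟩ := h
  refine ⟨C, hC, fun n => ?_⟩
  induction n using Nat.strong_induction_on with
  | _ n ih =>
    have h1 := h n
    rw [sub_mul, one_mul, map_sub, coeff_X_pow_mul'] at h1
    have hn : (0 : ℝ) ≤ n := Nat.cast_nonneg n
    have hpos : (0 : ℝ) ≤ C * ((n : ℝ) + 1) ^ k := by positivity
    split_ifs at h1 with hcn
    · have h2 := ih (n - c) (by omega)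
      have h3 : ((n - c : ℕ) : ℝ) + 1 ≤ n := by
        exact_mod_cast (show n - c + 1 ≤ n by omega)
      have h4 : C * (((n - c : ℕ) : ℝ) + 1) ^ (k + 1) ≤ C * (((n : ℝ) + 1) ^ k * n) := by
        rw [pow_succ]
        gcongr
        exact Nat.sub_le n c
      have h5 := norm_sub_norm_le (coeff n f) (coeff (n - c) f)
      calc ‖coeff n f‖ ≤ C * ((n : ℝ) + 1) ^ k + C * (((n : ℝ) + 1) ^ k * n) := by linarith
        _ = C * ((n : ℝ) + 1) ^ (k + 1) := by ring
    · rw [sub_zero] at h1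
      refine h1.trans ?_
      rw [pow_succ, ← mul_assoc]
      exact le_mul_of_one_le_right hpos (by linarith)

theorem exists_norm_coeff_le_of_prod_mul {ι : Type*} (s : Finset ι) {a : ι → ℕ}
    (ha : ∀ i, 0 < a i) {k : ℕ} : ∀ {f : ℂ⟦X⟧},
    (∃ C : ℝ, 0 ≤ C ∧ ∀ n, ‖coeff n ((∏ i ∈ s, (1 - X ^ a i)) * f)‖ ≤ C * ((n : ℝ) + 1) ^ k) →
    ∃ C : ℝ, 0 ≤ C ∧ ∀ n, ‖coeff n f‖ ≤ C * ((n : ℝ) + 1) ^ (k + s.card) := by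
  classical
  induction s using Finset.induction_on with
  | empty => simp
  | insert i s hi ih =>
    intro f h
    rw [Finset.prod_insert hi, mul_comm (1 - X ^ a i), mul_assoc] at h
    rw [Finset.card_insert_of_notMem hi, ← add_assoc]
    exact exists_norm_coeff_le_of_one_sub_X_pow_mul (ha i) (ih h)

theorem summable_coeff_mul_pow {f : ℂ⟦X⟧} {k : ℕ} {C : ℝ}
    (h : ∀ n, ‖coeff n f‖ ≤ C * ((n : ℝ) + 1) ^ k) {T : ℂ} (hT : ‖T‖ < 1) :
    Summable fun n => coeff n f * T ^ n := by
  have h1 : Summable fun n : ℕ => ((n : ℝ) + 1) ^ k * ‖T‖ ^ n := by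
    refine summable_of_isBigO_nat (summable_norm_pow_mul_geometric_of_norm_lt_one k
      (r := (‖T‖ : ℝ)) (by simpa using hT)) ?_
    refine IsBigO.of_bound (2 ^ k) ?_
    filter_upwards [eventually_ge_atTop 1] with n hn
    have hn' : (1 : ℝ) ≤ n := by exact_mod_cast hn
    rw [norm_norm, norm_mul, norm_mul, ← mul_assoc]
    gcongr
    rw [norm_pow, norm_pow, ← mul_pow, Real.norm_of_nonneg (by positivity),
      Real.norm_of_nonneg (by positivity)]
    gcongr
    linarith
  refine Summable.of_norm_bounded (h1.mul_left C) fun n => ?_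
  rw [norm_mul, norm_pow, ← mul_assoc]
  gcongr
  exact h n

theorem hasSum_one_sub_X_pow_mul {f : ℂ⟦X⟧} {T s : ℂ} (c : ℕ)
    (h : HasSum (fun n => coeff n f * T ^ n) s) :
    HasSum (fun n => coeff n ((1 - X ^ c) * f) * T ^ n) ((1 - T ^ c) * s) := by
  have h1 : HasSum (fun n => coeff n (X ^ c * f) * T ^ n) (T ^ c * s) := by
    rw [← (add_left_injective c).hasSum_iff]
    · refine (h.mul_left (T ^ c)).congr_fun fun n => ?_
      rw [Function.comp_apply, coeff_X_pow_mul', if_pos (Nat.le_add_left c n),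
        Nat.add_sub_cancel, pow_add]
      ring
    · intro n hn
      rw [coeff_X_pow_mul', if_neg, zero_mul]
      exact fun hcn => hn ⟨n - c, Nat.sub_add_cancel hcn⟩
  rw [sub_mul, sub_mul, one_mul, one_mul]
  refine (h.sub h1).congr_fun fun n => ?_
  rw [map_sub, sub_mul]

theorem hasSum_prod_one_sub_X_pow_mul {ι : Type*} (u : Finset ι) (a : ι → ℕ) {f : ℂ⟦X⟧} {T s : ℂ}
    (h : HasSum (fun n => coeff n f * T ^ n) s) :
    HasSum (fun n => coeff n ((∏ i ∈ u, (1 - X ^ a i)) * f) * T ^ n)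
      ((∏ i ∈ u, (1 - T ^ a i)) * s) := by
  classical
  induction u using Finset.induction_on with
  | empty => simpa using h
  | insert i u hi ih =>
    rw [Finset.prod_insert hi, Finset.prod_insert hi, mul_assoc, mul_assoc]
    exact hasSum_one_sub_X_pow_mul _ ih

/-- An exponential series with exponents at least `b` is `O(exp (-b t))` at infinity. -/
theorem isBigO_exp_of_hasSum {h : ℕ → ℂ} {p : ℕ → ℝ} {F : ℝ → ℂ} {b : ℝ} (hp : ∀ n, b ≤ p n)
    (hsum : ∀ t > 0, HasSum (fun n => h n * Real.exp (-p n * t)) (F t)) :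
    F =O[atTop] fun t => Real.exp (-b * t) := by
  have h1 : Summable fun n => ‖h n‖ * Real.exp (-p n) := by
    refine (hsum 1 one_pos).summable.norm.congr fun n => ?_
    rw [norm_mul, Complex.norm_real, Real.norm_of_nonneg (Real.exp_pos _).le, mul_one]
  -- Comparison with the series at `t = 1`: for `t ≥ 1`, `(p n - b) (t - 1) ≥ 0` gives `e ^ (-p n t)
  -- ≤ e ^ (-p n) e ^ b e ^ (-b t)`.
  refine IsBigO.of_bound ((∑' n, ‖h n‖ * Real.exp (-p n)) * Real.exp b) ?_
  filter_upwards [eventually_ge_atTop (1 : ℝ)] with t ht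
  rw [Real.norm_of_nonneg (Real.exp_pos _).le, mul_assoc]
  refine tsum_of_norm_bounded (h1.hasSum.mul_right (Real.exp b * Real.exp (-b * t))) (fun n => ?_)
    |> fun H => (hsum t (by linarith)).tsum_eq ▸ H
  rw [norm_mul, Complex.norm_real, Real.norm_of_nonneg (Real.exp_pos _).le, mul_assoc,
    ← Real.exp_add, ← Real.exp_add]
  gcongr
  nlinarith [hp n]

theorem summable_norm_div_rpow {h : ℕ → ℂ} {p : ℕ → ℝ} {k : ℕ} {C b : ℝ} (hb : 0 < b)
    (h_le : ∀ n, ‖h n‖ ≤ C * ((n : ℝ) + 1) ^ k) (hp : ∀ n : ℕ, b * ((n : ℝ) + 1) ≤ p n) {s : ℝ}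
    (hs : (k : ℝ) + 1 < s) : Summable fun n => ‖h n‖ / p n ^ s := by
  have h1 : Summable fun n : ℕ => ((n : ℝ) + 1) ^ ((k : ℝ) - s) := by
    have := (summable_nat_add_iff 1).mpr
      (Real.summable_nat_rpow.mpr (show (k : ℝ) - s < -1 by linarith))
    simpa using this
  refine Summable.of_nonneg_of_le (fun n => ?_) (fun n => ?_) (h1.mul_left (C * (b ^ s)⁻¹))
  · have : 0 ≤ p n := le_trans (by positivity) (hp n)
    positivity
  · have hn : (0 : ℝ) < (n : ℝ) + 1 := by positivity
    have hpow : (b * ((n : ℝ) + 1)) ^ s ≤ p n ^ s :=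
      Real.rpow_le_rpow (by positivity) (hp n) (by have := Nat.cast_nonneg (α := ℝ) k; linarith)
    calc ‖h n‖ / p n ^ s ≤ (C * ((n : ℝ) + 1) ^ k) / (b * ((n : ℝ) + 1)) ^ s := by
          have := (norm_nonneg _).trans (h_le n)
          gcongr
          exact h_le n
      _ = _ := by
          rw [Real.mul_rpow hb.le hn.le, Real.rpow_sub hn, Real.rpow_natCast]
          field_simp

end Growth

/-! ### Dirichlet series with rational generating function -/

section Rational

open PowerSeries Asymptotics Set

variable {r : ℕ} {a : Fin r → ℕ} {J : Finset ℕ} {e H : ℕ → ℂ}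

/-- The function `e ^ (-x t) * (∑ j ∈ J, e_j T ^ j) / ∏ i, (1 - T ^ a_i)`, where `T = e ^ (-t)`. -/
def barnesGen (a : Fin r → ℕ) (J : Finset ℕ) (e : ℕ → ℂ) (x t : ℝ) : ℂ :=
  ∑ j ∈ J, e j * (Complex.exp (-((x : ℂ) + j) * t) * ∏ i, (1 - Complex.exp (-(a i : ℂ) * t))⁻¹)

/-- The expansion at `0` of `t ^ r * barnesGen a J e x t`. -/
def barnesGenSeries (a : Fin r → ℕ) (J : Finset ℕ) (e : ℕ → ℂ) (x : ℝ) : ℂ⟦X⟧ :=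
  ∑ j ∈ J, C (e j) * rescale (-1) (bernoulliBarnesSeries a ((x : ℂ) + j))

theorem coeff_barnesGenSeries (x : ℝ) (k : ℕ) : coeff k (barnesGenSeries a J e x) =
    ∑ j ∈ J, e j * ((-1) ^ k / (k ! : ℂ) * bernoulliBarnes a k ((x : ℂ) + j)) := by
  rw [barnesGenSeries, map_sum]
  refine Finset.sum_congr rfl fun j _ => ?_
  rw [coeff_C_mul, coeff_rescale_bernoulliBarnesSeries]

theorem hasExpansion_barnesGen (ha : ∀ i, 0 < a i) (x : ℝ) :
    HasExpansion (fun t => (t : ℂ) ^ r * barnesGen a J e x t) (barnesGenSeries a J e x) := by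
  have h : HasExpansion (fun t => ∑ j ∈ J, e j * (Complex.exp (-((x : ℂ) + j) * t) *
      ∏ i, ((t : ℂ) / (1 - Complex.exp (-(a i : ℂ) * t))))) (barnesGenSeries a J e x) :=
    HasExpansion.sum fun j _ =>
      (hasExpansion_const (e j)).mul (hasExpansion_bernoulliBarnes a ha ((x : ℂ) + j))
  refine h.congr' (.of_forall fun t => ?_)
  simp only [barnesGen, Finset.mul_sum]
  refine Finset.sum_congr rfl fun j _ => ?_
  simp only [div_eq_mul_inv, Finset.prod_mul_distrib, Finset.prod_const, Finset.card_univ,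
    Fintype.card_fin]
  ring

theorem norm_exp_neg_lt_one {t : ℝ} (ht : 0 < t) : ‖Complex.exp (-(t : ℂ))‖ < 1 := by
  rw [Complex.norm_exp]
  simpa using ht

theorem one_sub_exp_neg_mul_ne_zero {c : ℕ} (hc : 0 < c) {t : ℝ} (ht : 0 < t) :
    1 - Complex.exp (-(c : ℂ) * t) ≠ 0 := by
  intro h
  have h1 := norm_exp_neg_lt_one (t := c * t) (by positivity)
  push_cast at h1
  rw [← neg_mul, ← sub_eq_zero.mp h, norm_one] at h1
  exact lt_irrefl _ h1

theorem continuousOn_barnesGen (ha : ∀ i, 0 < a i) (x : ℝ) :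
    ContinuousOn (barnesGen a J e x) (Ioi 0) := by
  refine continuousOn_finsetSum _ fun j _ => continuousOn_const.mul
    ((by fun_prop : Continuous _).continuousOn.mul (continuousOn_finsetProd _ fun i _ => ?_))
  exact (by fun_prop : Continuous _).continuousOn.inv₀ fun t ht =>
    one_sub_exp_neg_mul_ne_zero (ha i) ht

/-- The numerator has finite support, hence bounded coefficients; each of the `r` factors of the
denominator adds one power of growth. -/
theorem exists_norm_le_of_prod_mul_eq (ha : ∀ i, 0 < a i) (he : ∀ j ∉ J, e j = 0)
    (hH : (∏ i, (1 - X ^ a i)) * mk H = mk e) :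
    ∃ C : ℝ, 0 ≤ C ∧ ∀ n, ‖H n‖ ≤ C * ((n : ℝ) + 1) ^ r := by
  have h := exists_norm_coeff_le_of_prod_mul (f := mk H) (k := 0) Finset.univ ha
    ⟨∑ j ∈ J, ‖e j‖, by positivity, fun n => ?_⟩
  · simpa using h
  · rw [hH, coeff_mk, pow_zero, mul_one]
    by_cases hn : n ∈ J
    · exact Finset.single_le_sum (f := fun j => ‖e j‖) (fun _ _ => norm_nonneg _) hn
    · rw [he n hn, norm_zero]
      positivity

/-- The polynomial bound makes the series converge at `T = e ^ (-t)`, where the formal identity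
becomes an identity of numbers that can be divided by the nonzero product. -/
theorem hasSum_barnesGen (ha : ∀ i, 0 < a i) (he : ∀ j ∉ J, e j = 0)
    (hH : (∏ i, (1 - X ^ a i)) * mk H = mk e) (x : ℝ) {t : ℝ} (ht : 0 < t) :
    HasSum (fun n : ℕ => H n * Real.exp (-((n : ℝ) + x) * t)) (barnesGen a J e x t) := by
  set T := Complex.exp (-(t : ℂ)) with hTdef
  have hpow (n : ℕ) : T ^ n = Complex.exp (-(n : ℂ) * t) := by
    rw [hTdef, ← Complex.exp_nat_mul]
    ring_nf
  obtain ⟨C, -, hC⟩ := exists_norm_le_of_prod_mul_eq ha he hH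
  have h1 := (summable_coeff_mul_pow (f := mk H) (by simpa using hC)
    (norm_exp_neg_lt_one ht)).hasSum
  have h2 := hasSum_prod_one_sub_X_pow_mul Finset.univ a h1
  rw [hH] at h2
  have h3 : HasSum (fun n => coeff n (mk e) * T ^ n) (∑ j ∈ J, e j * T ^ j) := by
    simpa using hasSum_sum_of_ne_finset_zero (f := fun n => coeff n (mk e) * T ^ n) (s := J)
      fun j hj => by rw [coeff_mk, he j hj, zero_mul]
  have h4 := h2.unique h3
  have hne : ∏ i, (1 - T ^ a i) ≠ 0 := Finset.prod_ne_zero_iff.mpr fun i _ => by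
    rw [hpow]
    exact one_sub_exp_neg_mul_ne_zero (ha i) ht
  have h5 : ∑' n, coeff n (mk H) * T ^ n = (∑ j ∈ J, e j * T ^ j) * ∏ i, (1 - T ^ a i)⁻¹ := by
    rw [← h4, Finset.prod_inv_distrib, mul_comm (∏ i, _), mul_inv_cancel_right₀ hne]
  have h6 : barnesGen a J e x t = Complex.exp (-(x : ℂ) * t) * ∑' n, coeff n (mk H) * T ^ n := by
    rw [h5, barnesGen, Finset.sum_mul, Finset.mul_sum]
    refine Finset.sum_congr rfl fun j _ => ?_
    simp only [hpow]
    rw [neg_add, add_mul, Complex.exp_add]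
    ring
  rw [h6]
  refine (h1.mul_left _).congr_fun fun n => ?_
  rw [coeff_mk, hpow]
  push_cast
  rw [neg_add, add_mul, Complex.exp_add]
  ring

theorem coeff_barnesGenSeries_div {l : ℕ} (x : ℝ) :
    coeff (r - l) (barnesGenSeries a J e x) / ((l - 1)! : ℂ) =
      ∑ j ∈ J, e j * ((-1) ^ (r - l) / (((l - 1)! : ℂ) * ((r - l)! : ℂ)) *
        bernoulliBarnes a (r - l) ((x : ℂ) + j)) := by
  rw [coeff_barnesGenSeries, Finset.sum_div]
  refine Finset.sum_congr rfl fun j _ => ?_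
  field_simp

/-- Continuation and residues of `∑ n, H n / (n + x) ^ z`, where `∑ n, H n X ^ n` is a rational
function with denominator `∏ i, (1 - X ^ a i)`. -/
theorem exists_continuation_add (ha : ∀ i, 0 < a i) (he : ∀ j ∉ J, e j = 0)
    (hH : (∏ i, (1 - X ^ a i)) * mk H = mk e) {x : ℝ} (hx : 0 < x) :
    ∃ Z, IsMeromorphicContinuation (fun n z => H n / ((n : ℂ) + (x : ℂ)) ^ z) Z ∧
      ∀ l : ℕ, 1 ≤ l → l ≤ r → HasResidueAt Z l
        (∑ j ∈ J, e j * ((-1) ^ (r - l) / (((l - 1)! : ℂ) * ((r - l)! : ℂ)) *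
          bernoulliBarnes a (r - l) ((x : ℂ) + j))) := by
  have hsum : ∀ t > 0, HasSum (fun n : ℕ => H n * Real.exp (-((n : ℝ) + x) * t))
      (barnesGen a J e x t) := fun t ht => hasSum_barnesGen ha he hH x ht
  have hO := isBigO_exp_of_hasSum (b := x) (p := fun n => (n : ℝ) + x) (fun n => by simp) hsum
  have hcont := continuousOn_barnesGen (J := J) (e := e) ha x
  have hexp := hasExpansion_barnesGen (J := J) (e := e) ha x
  obtain ⟨C, -, hC⟩ := exists_norm_le_of_prod_mul_eq ha he hH
  refine ⟨dirichletCont (barnesGen a J e x) r (barnesGenSeries a J e x), ?_, fun l hl hlr => ?_⟩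
  · have h := isMeromorphicContinuation_dirichletCont hcont hx hO hexp
      (p := fun n => (n : ℝ) + x) (fun n => by positivity) hsum (σ := (r : ℝ) + 1)
      -- `min x 1` is chosen so that `n + x ≥ min x 1 * (n + 1)` for all `n`.
      fun s hs => summable_norm_div_rpow (b := min x 1) (lt_min hx one_pos) hC (fun n => ?_) hs
    · push_cast at h
      exact h
    · have h1 : min x 1 * (n : ℝ) ≤ 1 * n := by
        gcongr
        exact min_le_right _ _
      have h2 := min_le_left x 1
      linarith
  · rw [← coeff_barnesGenSeries_div]
    exact hasResidueAt_dirichletCont hcont hx hO hexp hl hlr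

/-- Continuation and residues of `∑ n ≥ 1, H n / n ^ z`, where `∑ n, H n X ^ n` is a rational
function with denominator `∏ i, (1 - X ^ a i)`. -/
theorem exists_continuation_succ (ha : ∀ i, 0 < a i) (he : ∀ j ∉ J, e j = 0)
    (hH : (∏ i, (1 - X ^ a i)) * mk H = mk e) :
    ∃ Z, IsMeromorphicContinuation (fun n z => H (n + 1) / ((n : ℂ) + 1) ^ z) Z ∧
      ∀ l : ℕ, 1 ≤ l → l ≤ r → HasResidueAt Z l
        (∑ j ∈ J, e j * ((-1) ^ (r - l) / (((l - 1)! : ℂ) * ((r - l)! : ℂ)) *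
          bernoulliBarnes a (r - l) (j : ℂ))) := by
  -- At `x = 0` the term `n = 0` does not decay, so it is removed; the remaining exponents are at
  -- least `1`.
  set F : ℝ → ℂ := fun t => barnesGen a J e 0 t + -H 0 with hFdef
  set q : ℂ⟦X⟧ := barnesGenSeries a J e 0 + ((Polynomial.X ^ r : Polynomial ℂ) : ℂ⟦X⟧) *
    C (-H 0) with hqdef
  have hsum : ∀ t > 0, HasSum (fun n : ℕ => H (n + 1) * Real.exp (-((n : ℝ) + 1) * t)) (F t) := by
    intro t ht
    have h := (hasSum_nat_add_iff' 1).mpr (hasSum_barnesGen ha he hH 0 ht)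
    simpa [hFdef, sub_eq_add_neg] using h
  have hO := isBigO_exp_of_hasSum (b := 1) (p := fun n => (n : ℝ) + 1) (fun n => by simp) hsum
  have hcont : ContinuousOn F (Ioi 0) :=
    (continuousOn_barnesGen ha 0).add continuousOn_const
  have hexp : HasExpansion (fun t => (t : ℂ) ^ r * F t) q := by
    refine ((hasExpansion_barnesGen ha 0).add ((hasExpansion_polynomial (Polynomial.X ^ r)).mul
      (hasExpansion_const (-H 0)))).congr' (.of_forall fun t => ?_)
    simp only [hFdef, Polynomial.eval_pow, Polynomial.eval_X]
    ring
  obtain ⟨C, hC0, hC⟩ := exists_norm_le_of_prod_mul_eq ha he hH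
  refine ⟨dirichletCont F r q, ?_, fun l hl hlr => ?_⟩
  · have h := isMeromorphicContinuation_dirichletCont hcont one_pos hO hexp
      (p := fun n => (n : ℝ) + 1) (fun n => by positivity) hsum (σ := (r : ℝ) + 1)
      -- The factor `2 ^ r` pays for the index shift, through `n + 2 ≤ 2 (n + 1)`.
      fun s hs => summable_norm_div_rpow (h := fun n => H (n + 1)) (C := C * 2 ^ r) one_pos
        (fun n => ?_) (fun n => by simp) hs
    · push_cast at h
      exact h
    · refine (hC (n + 1)).trans ?_
      rw [mul_assoc, ← mul_pow]
      gcongr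
      push_cast
      linarith [Nat.cast_nonneg (α := ℝ) n]
  -- The removed constant contributes only to the coefficient of index `r`, and `r - l < r` since `l
  -- ≥ 1`.
  · have h1 : coeff (r - l) q = coeff (r - l) (barnesGenSeries a J e 0) := by
      rw [hqdef, map_add, Polynomial.coe_pow, Polynomial.coe_X, coeff_X_pow_mul',
        if_neg (by omega), add_zero]
    have h2 := coeff_barnesGenSeries_div (a := a) (J := J) (e := e) (l := l) 0
    rw [← h1] at h2
    simp only [Complex.ofReal_zero, zero_add] at h2
    rw [← h2]
    exact hasResidueAt_dirichletCont hcont one_pos hO hexp hl hlr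

end Rational

/-! ### Specialisation to the Hilbert function -/

section Main

variable {K : Type u} [Field K] {r : ℕ} {a : Fin r → ℕ} {M : Type u} [AddCommGroup M] [Module K M]
  [Module (MvPolynomial (Fin r) K) M] (𝓜 : ℕ → Submodule K M) [DirectSum.Decomposition 𝓜]
  [SetLike.GradedSMul (MvPolynomial.weightedHomogeneousSubmodule K a) 𝓜]

theorem sum_eulerBetti_mul {J : Finset ℕ} (hJ : ∀ j ∉ J, ∀ i, gradedBetti a 𝓜 i j = 0)
    (s : ℕ) (c : ℂ) (B : ℕ → ℂ) :
    ∑ j ∈ J, (eulerBetti a 𝓜 j : ℂ) * ((-1) ^ s / c * B j) =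
      ∑ i ∈ Finset.range (projDim (MvPolynomial (Fin r) K) M + 1), ∑ᶠ j : ℕ,
        (gradedBetti a 𝓜 i j : ℂ) * ((-1) ^ (i + s) / c) * B j := by
  have h (i : ℕ) : ∑ᶠ j : ℕ, (gradedBetti a 𝓜 i j : ℂ) * ((-1) ^ (i + s) / c) * B j =
      ∑ j ∈ J, (gradedBetti a 𝓜 i j : ℂ) * ((-1) ^ (i + s) / c) * B j := by
    refine finsum_eq_sum_of_support_subset _ fun j hj => ?_
    by_contra hjJ
    exact hj (by simp [hJ j hjJ i])
  simp only [h, eulerBetti]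
  rw [Finset.sum_comm]
  refine Finset.sum_congr rfl fun j _ => ?_
  push_cast
  rw [Finset.sum_mul]
  refine Finset.sum_congr rfl fun i _ => ?_
  rw [pow_add]
  ring

variable [Module.Finite (MvPolynomial (Fin r) K) M]

/-- One finite set serves all `i`, because only `i` up to the projective dimension contribute. -/
theorem exists_finset_gradedBetti_eq_zero :
    ∃ J : Finset ℕ, ∀ j ∉ J, ∀ i, gradedBetti a 𝓜 i j = 0 := by
  classical
  refine ⟨(Finset.range (projDim (MvPolynomial (Fin r) K) M + 1)).biUnion
    fun i => (finite_setOf_gradedBetti_ne_zero (a := a) 𝓜 i).toFinset, fun j hj i => ?_⟩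
  by_cases hi : projDim (MvPolynomial (Fin r) K) M < i
  · exact gradedBetti_eq_zero 𝓜 hi j
  · by_contra hne
    exact hj (Finset.mem_biUnion.mpr ⟨i, Finset.mem_range.mpr (by omega), by simpa using hne⟩)

theorem prod_mul_hilbertSeries_complex [IsScalarTower K (MvPolynomial (Fin r) K) M]
    (ha : ∀ i, 0 < a i) :
    (∏ i, (1 - PowerSeries.X ^ a i)) * PowerSeries.mk (fun n => (hilbertFunction 𝓜 n : ℂ)) =
      PowerSeries.mk fun j => (eulerBetti a 𝓜 j : ℂ) := by
  have h := congrArg (PowerSeries.map (Int.castRingHom ℂ)) (prod_mul_hilbertSeries 𝓜 ha)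
  simp only [map_mul, map_prod, map_sub, map_one, map_pow, PowerSeries.map_X] at h
  convert h using 2 <;> ext n <;> simp

end Main

end ZetaBarnes

end

theorem corollary2p2 {K : Type u} [Field K] {r : ℕ} (a : Fin r → ℕ) (ha : ∀ i, 0 < a i)
    {M : Type u} [AddCommGroup M] [Module K M] [Module (MvPolynomial (Fin r) K) M]
    [IsScalarTower K (MvPolynomial (Fin r) K) M] [Module.Finite (MvPolynomial (Fin r) K) M]
    (𝓜 : ℕ → Submodule K M) [DirectSum.Decomposition 𝓜]
    [SetLike.GradedSMul (MvPolynomial.weightedHomogeneousSubmodule K a) 𝓜]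
    (w : ℝ) (hw : 0 < w) :
    -- the sums over `i` and `j` below are finite
    CategoryTheory.projectiveDimension (ModuleCat.of (MvPolynomial (Fin r) K) M) ≠ ⊤ ∧
    (∀ i j, Module.Finite K ((ZetaBarnes.standardResolution a 𝓜).Tor i j)) ∧
    (∀ i, {j | ZetaBarnes.gradedBetti a 𝓜 i j ≠ 0}.Finite) ∧
    -- the residues of `ζ_M(z, w)`
    (∃ Z, ZetaBarnes.IsZetaW 𝓜 w Z) ∧
    (∀ Z, ZetaBarnes.IsZetaW 𝓜 w Z → ∀ l : ℕ, 1 ≤ l → l ≤ r →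
      ZetaBarnes.HasResidueAt Z l
        (∑ i ∈ Finset.range (ZetaBarnes.projDim (MvPolynomial (Fin r) K) M + 1), ∑ᶠ j : ℕ,
          (ZetaBarnes.gradedBetti a 𝓜 i j : ℂ) *
            ((-1) ^ (i + (r - l)) / (((l - 1)! : ℂ) * ((r - l)! : ℂ))) *
            ZetaBarnes.bernoulliBarnes a (r - l) ((w : ℂ) + j))) ∧
    -- the residues of `ζ_M(z)`
    (∃ Z, ZetaBarnes.IsZeta 𝓜 Z) ∧
    (∀ Z, ZetaBarnes.IsZeta 𝓜 Z → ∀ l : ℕ, 1 ≤ l → l ≤ r →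
      ZetaBarnes.HasResidueAt Z l
        (∑ i ∈ Finset.range (ZetaBarnes.projDim (MvPolynomial (Fin r) K) M + 1), ∑ᶠ j : ℕ,
          (ZetaBarnes.gradedBetti a 𝓜 i j : ℂ) *
            ((-1) ^ (i + (r - l)) / (((l - 1)! : ℂ) * ((r - l)! : ℂ))) *
            ZetaBarnes.bernoulliBarnes a (r - l) (j : ℂ))) := by
  obtain ⟨J, hJ⟩ := ZetaBarnes.exists_finset_gradedBetti_eq_zero (a := a) 𝓜
  have he : ∀ j ∉ J, (ZetaBarnes.eulerBetti a 𝓜 j : ℂ) = 0 := fun j hj => by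
    simp [ZetaBarnes.eulerBetti, hJ j hj]
  have hH := ZetaBarnes.prod_mul_hilbertSeries_complex 𝓜 ha
  obtain ⟨Zw, hZw, hRw⟩ := ZetaBarnes.exists_continuation_add ha he hH hw
  obtain ⟨Z₁, hZ₁, hR₁⟩ := ZetaBarnes.exists_continuation_succ ha he hH
  refine ⟨ZetaBarnes.projectiveDimension_ne_top K r M, ZetaBarnes.finite_tor 𝓜 ha,
    ZetaBarnes.finite_setOf_gradedBetti_ne_zero 𝓜, ⟨Zw, hZw⟩, fun Z hZ l hl hlr => ?_, ⟨Z₁, hZ₁⟩,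
    fun Z hZ l hl hlr => ?_⟩
  · rw [← ZetaBarnes.sum_eulerBetti_mul 𝓜 hJ]
    -- The residue of the constructed continuation passes to an arbitrary one by the identity
    -- theorem.
    exact (hRw l hl hlr).congr (hZw.eventually_eq hZ l)
  · rw [← ZetaBarnes.sum_eulerBetti_mul 𝓜 hJ]
    exact (hR₁ l hl hlr).congr (hZ₁.eventually_eq hZ l)
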